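/- Let $p$ be a prime, let $G$ be a group of order $p$, and let $X$ be a finite $G$-CW-complex: a finite (Hausdorff) CW complex on which $G$ acts continuously, permuting the open cells, such that an element of $G$ which maps a cell to itself fixes this cell pointwise. Let $A$ be $\mathbb Z$ or $\mathbb Z/p$. Let $C_\bullet(X;A)$, with $C_s(X;A)=H_s(X^{(s)},X^{(s-1)};A)$, be the cellular chain complex of $X$, regarded as a complex of $\mathbb Z G$-modules; let $H_s(G,X;A)$ be the $s$-th homology group of the complex of invariants $C_\bullet(X;A)^G$; and let $X^G$ be the fixed point set, a subcomplex of $X$. Let $P_\bullet\to\mathbb Z$ be any projective resolution over $\mathbb Z G$. Consider the double complex ${}^{I}E^0_{s,t}=\operatorname{Hom}_{\mathbb Z G}(P_{-t},C_s(X;A))$ ($s\ge 0$, $t\le 0$), let $S_n(G,X;A)$ be the $n$-th homology group of its total complex, where ${}^{I}E^0_{s,t}$ has total degree $s+t$, and let ${}^{I}E^r_{s,t}$, with $d^r\colon {}^{I}E^r_{s,t}\to {}^{I}E^r_{s-r,t+r-1}$, be the spectral sequence of the filtration of the total complex by the columns $\le s$. Then: 1. ${}^{I}E^1_{s,t}\cong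 H^{-t}(G,C_s(X;A))$ for $s\ge 0$, $t\le 0$, with $d^1$ corresponding to the map induced by the boundary map of $C_\bullet(X;A)$, and ${}^{I}E^r_{s,t}=0$ if $s<0$ or $t>0$. 2. The spectral sequence converges to $S_{s+t}(G,X;A)$: the induced filtration $F_\bullet$ of $S_n(G,X;A)$ is finite, with bounds independent of $n$, and ${}^{I}E^\infty_{s,t}\cong F_sS_{s+t}(G,X;A)/F_{s-1}S_{s+t}(G,X;A)$ canonically. 3. ${}^{I}E^2={}^{I}E^\infty$; that is, $d^r=0$ for all $r\ge 2$, and ${}^{I}E^2_{s,t}$ is canonically identified with ${}^{I}E^\infty_{s,t}$. 4. For all $s\ge 0$, ${}^{I}E^2_{s,0}\cong H_s(G,X;A)$. If $A=\mathbb Z/p$, then ${}^{I}E^2_{s,t}\cong H_s(X^G;\mathbb Z/p)$ for all $t<0$. If $A=\mathbb Z$, then for all $t<0$, ${}^{I}E^2_{s,t}\cong H_s(X^G;\mathbb Z/p)$ if $t$ is even and ${}^{I}E^2_{s,t}=0$ if $t$ is odd. -/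

import Mathlib

open CategoryTheory Topology

noncomputable section

namespace GCW

/-! ### Singular chains, relative homology, cellular chains -/

section Cellular

variable (A : Type) [AddCommGroup A] {X : Type} [TopologicalSpace X]

/-- The singular chain complex of the space `X` with coefficients in the abelian group `A`. -/
abbrev singularChains (X : Type) [TopologicalSpace X] : ChainComplex (ModuleCat.{0} ℤ) ℕ :=
  ((AlgebraicTopology.singularChainComplexFunctor (ModuleCat.{0} ℤ)).obj
    (ModuleCat.of ℤ A)).obj (TopCat.of X)

/-- The map of singular chain complexes induced by a continuous map. -/
abbrev singularMap {Y : Type} [TopologicalSpace Y] (f : C(Y, X)) :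
    singularChains A Y ⟶ singularChains A X :=
  ((AlgebraicTopology.singularChainComplexFunctor (ModuleCat.{0} ℤ)).obj
    (ModuleCat.of ℤ A)).map (TopCat.ofHom f)

/-- The boundary map on singular `n`-chains, zero for `n = 0`. -/
def bdry (n : ℕ) : (singularChains A X).X n →+ (singularChains A X).X (n - 1) :=
  ((singularChains A X).d n (n - 1)).hom.toAddMonoidHom

/-- The singular `n`-chains of `X` that lie in the subspace `U`. -/
def chainsIn (U : Set X) (n : ℕ) : AddSubgroup ((singularChains A X).X n) :=
  ((singularMap A (⟨Subtype.val, continuous_subtype_val⟩ : C(U, X))).f n).hom.toAddMonoidHom.range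

/-- The relative cycles of the pair `(U, V)`: chains in `U` whose boundary lies in `V`. -/
def relCycles (U V : Set X) (n : ℕ) : AddSubgroup ((singularChains A X).X n) :=
  chainsIn A U n ⊓ (chainsIn A V (n - 1)).comap (bdry A n)

/-- The relative boundaries of the pair `(U, V)`: sums of a chain in `V` and the boundary of a chain
in `U`. -/
def relBoundaries (U V : Set X) (n : ℕ) : AddSubgroup ((singularChains A X).X n) :=
  chainsIn A V n ⊔ (chainsIn A U (n + 1)).map (bdry A (n + 1))

/-- The relative singular homology `H_n(U, V; A)` of a pair of subspaces `V ⊆ U` of `X`. -/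
abbrev RelHomology (U V : Set X) (n : ℕ) : Type :=
  relCycles A U V n ⧸ (relBoundaries A U V n).addSubgroupOf (relCycles A U V n)

lemma bdry_bdry (n : ℕ) (c : (singularChains A X).X (n + 1)) :
    bdry A n (bdry A (n + 1) c) = 0 := by
  have h := (singularChains A X).d_comp_d (n + 1) n (n - 1)
  exact congrArg (fun f => f.hom c) h

variable (F : ℕ → Set X)

/-- For an increasing sequence `F` of subspaces, the connecting map of the triple
`(F (n + 2), F (n + 1), F n)`, sending the class of a relative cycle to the class of its boundary. -/
def cellularD (n : ℕ) :
    RelHomology A (F (n + 2)) (F (n + 1)) (n + 1) →+ RelHomology A (F (n + 1)) (F n) n :=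
  QuotientAddGroup.map _ _
    (((bdry A (n + 1)).comp (relCycles A (F (n + 2)) (F (n + 1)) (n + 1)).subtype).codRestrict
      (relCycles A (F (n + 1)) (F n) n) (by
        rintro ⟨c, hc⟩
        refine AddSubgroup.mem_inf.2 ⟨(AddSubgroup.mem_inf.1 hc).2, ?_⟩
        change bdry A n (bdry A (n + 1) c) ∈ chainsIn A (F n) (n - 1)
        rw [bdry_bdry]
        exact AddSubgroup.zero_mem _))
    (by
      rintro ⟨c, hc⟩ h
      change bdry A (n + 1) c ∈ relBoundaries A (F (n + 1)) (F n) n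
      change c ∈ relBoundaries A (F (n + 2)) (F (n + 1)) (n + 1) at h
      obtain ⟨a, ha, b, ⟨e, he, rfl⟩, rfl⟩ := AddSubgroup.mem_sup.1 h
      rw [map_add]
      refine AddSubgroup.add_mem _
        (AddSubgroup.mem_sup_right (AddSubgroup.mem_map_of_mem _ ha)) ?_
      have : bdry A (n + 1) (bdry A (n + 1 + 1) e) = 0 := bdry_bdry A (n + 1) e
      rw [this]
      exact AddSubgroup.zero_mem _)

lemma cellularD_comp (n : ℕ) (x : RelHomology A (F (n + 3)) (F (n + 2)) (n + 2)) :
    cellularD A F n (cellularD A F (n + 1) x) = 0 := by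
  obtain ⟨⟨c, hc⟩, rfl⟩ := QuotientAddGroup.mk_surjective x
  have h0 : bdry A (n + 1) (bdry A (n + 1 + 1) c) = 0 := bdry_bdry A (n + 1) c
  refine (QuotientAddGroup.eq_zero_iff _).2 ?_
  change bdry A (n + 1) (bdry A (n + 1 + 1) c) ∈ relBoundaries A _ _ n
  rw [h0]
  exact AddSubgroup.zero_mem _

/-- The chain complex with `n`-chains `H_n(F (n + 1), F n; A)` and the connecting maps as
boundary. -/
def filtrationComplex : ChainComplex (ModuleCat.{0} ℤ) ℕ :=
  ChainComplex.of (fun n => ModuleCat.of ℤ (RelHomology A (F (n + 1)) (F n) n))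
    (fun n => ModuleCat.ofHom (cellularD A F n).toIntLinearMap)
    (fun n => by ext x; exact cellularD_comp A F n x)

/-- The cellular chain complex of a CW complex `K`:
`C_n(K; A) = H_n(K^n, K^{n-1}; A)`, where `K^n` is the `n`-skeleton. -/
def cellularComplex [T2Space X] (K : Set X) [CWComplex K] : ChainComplex (ModuleCat.{0} ℤ) ℕ :=
  filtrationComplex A (fun n : ℕ => ((RelCWComplex.skeletonLT K (n : ℕ∞) : Set X)))

/-! ### Group actions on cellular chains -/

variable (G : Type) [Group G] [MulAction G X] [ContinuousConstSMul G X]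

/-- The homeomorphism given by `g`, as a continuous map. -/
abbrev smulMap (g : G) : C(X, X) := ⟨fun x => g • x, continuous_const_smul g⟩

/-- The action of `g` on singular `n`-chains. -/
def chainAct (g : G) (n : ℕ) : (singularChains A X).X n →+ (singularChains A X).X n :=
  ((singularMap A (smulMap G g : C(X, X))).f n).hom.toAddMonoidHom

lemma chainAct_one (n : ℕ) (c : (singularChains A X).X n) : chainAct A G 1 n c = c := by
  have h : TopCat.ofHom (smulMap G (1 : G) : C(X, X)) = 𝟙 (TopCat.of X) := by
    ext x; exact one_smul G x
  have e : singularMap A (smulMap G (1 : G) : C(X, X)) = 𝟙 _ := by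
    rw [singularMap, h, CategoryTheory.Functor.map_id]
  exact congrArg (fun f => (f.f n).hom c) e

lemma chainAct_mul (g h : G) (n : ℕ) (c : (singularChains A X).X n) :
    chainAct A G (g * h) n c = chainAct A G g n (chainAct A G h n c) := by
  have e : TopCat.ofHom (smulMap G (g * h) : C(X, X)) =
      TopCat.ofHom (smulMap G h) ≫ TopCat.ofHom (smulMap G g) := by
    ext x; exact mul_smul g h x
  have e' : singularMap A (smulMap G (g * h) : C(X, X)) =
      singularMap A (smulMap G h) ≫ singularMap A (smulMap G g) := by
    rw [singularMap, e, CategoryTheory.Functor.map_comp]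
  exact congrArg (fun f => (f.f n).hom c) e'

variable {G}

lemma chainAct_bdry (g : G) (n : ℕ) (c : (singularChains A X).X n) :
    bdry A n (chainAct A G g n c) = chainAct A G g (n - 1) (bdry A n c) := by
  have h := (singularMap A (smulMap G g : C(X, X))).comm n (n - 1)
  exact congrArg (fun f => f.hom c) h

lemma chainAct_chainsIn {U : Set X} (g : G) (hU : ∀ x ∈ U, g • x ∈ U) (n : ℕ)
    {c : (singularChains A X).X n} (hc : c ∈ chainsIn A U n) :
    chainAct A G g n c ∈ chainsIn A U n := by
  obtain ⟨b, rfl⟩ := hc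
  let φ : C(U, U) := ⟨fun x => ⟨g • x.1, hU x.1 x.2⟩, by fun_prop⟩
  refine ⟨((singularMap A φ).f n).hom b, ?_⟩
  have e : TopCat.ofHom φ ≫ TopCat.ofHom (⟨Subtype.val, continuous_subtype_val⟩ : C(U, X)) =
      TopCat.ofHom (⟨Subtype.val, continuous_subtype_val⟩ : C(U, X)) ≫
        TopCat.ofHom (smulMap G g) := by
    ext x; rfl
  have h := congrArg (fun f => (((AlgebraicTopology.singularChainComplexFunctor
    (ModuleCat.{0} ℤ)).obj (ModuleCat.of ℤ A)).map f)) e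
  simp only [CategoryTheory.Functor.map_comp] at h
  exact congrArg (fun f => (f.f n).hom b) h

lemma chainAct_relCycles {U V : Set X} (g : G) (hU : ∀ x ∈ U, g • x ∈ U)
    (hV : ∀ x ∈ V, g • x ∈ V) (n : ℕ) {c : (singularChains A X).X n}
    (hc : c ∈ relCycles A U V n) : chainAct A G g n c ∈ relCycles A U V n := by
  refine AddSubgroup.mem_inf.2
    ⟨chainAct_chainsIn A g hU n (AddSubgroup.mem_inf.1 hc).1, ?_⟩
  change bdry A n (chainAct A G g n c) ∈ chainsIn A V (n - 1)
  rw [chainAct_bdry]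
  exact chainAct_chainsIn A g hV _ (AddSubgroup.mem_inf.1 hc).2

lemma chainAct_relBoundaries {U V : Set X} (g : G) (hU : ∀ x ∈ U, g • x ∈ U)
    (hV : ∀ x ∈ V, g • x ∈ V) (n : ℕ) {c : (singularChains A X).X n}
    (hc : c ∈ relBoundaries A U V n) : chainAct A G g n c ∈ relBoundaries A U V n := by
  obtain ⟨a, ha, b, ⟨e, he, rfl⟩, rfl⟩ := AddSubgroup.mem_sup.1 hc
  rw [map_add]
  refine AddSubgroup.add_mem _ (AddSubgroup.mem_sup_left (chainAct_chainsIn A g hV n ha)) ?_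
  have h : chainAct A G g n (bdry A (n + 1) e) = bdry A (n + 1) (chainAct A G g (n + 1) e) :=
    (chainAct_bdry A g (n + 1) e).symm
  rw [h]
  exact AddSubgroup.mem_sup_right (AddSubgroup.mem_map_of_mem _ (chainAct_chainsIn A g hU _ he))

/-- The action of `g` on the relative homology of a pair of invariant subspaces. -/
def relAct {U V : Set X} (g : G) (hU : ∀ x ∈ U, g • x ∈ U) (hV : ∀ x ∈ V, g • x ∈ V) (n : ℕ) :
    RelHomology A U V n →+ RelHomology A U V n :=
  QuotientAddGroup.map _ _
    (((chainAct A G g n).comp (relCycles A U V n).subtype).codRestrict (relCycles A U V n)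
      fun c => chainAct_relCycles A g hU hV n c.2)
    fun _ hc => chainAct_relBoundaries A g hU hV n hc

/-- The action of `G` on the relative homology of a pair of invariant subspaces. -/
def relRep {U V : Set X} (hU : ∀ (g : G), ∀ x ∈ U, g • x ∈ U) (hV : ∀ (g : G), ∀ x ∈ V, g • x ∈ V)
    (n : ℕ) : Representation ℤ G (RelHomology A U V n) where
  toFun g := (relAct A g (hU g) (hV g) n).toIntLinearMap
  map_one' := by
    refine LinearMap.ext fun x => ?_
    obtain ⟨⟨c, hc⟩, rfl⟩ := QuotientAddGroup.mk_surjective x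
    exact congrArg (QuotientAddGroup.mk (s := (relBoundaries A U V n).addSubgroupOf _))
      (Subtype.ext (chainAct_one A G n c))
  map_mul' g h := by
    refine LinearMap.ext fun x => ?_
    obtain ⟨⟨c, hc⟩, rfl⟩ := QuotientAddGroup.mk_surjective x
    exact congrArg (QuotientAddGroup.mk (s := (relBoundaries A U V n).addSubgroupOf _))
      (Subtype.ext (chainAct_mul A G g h n c))

variable (G)

/-- The complex `filtrationComplex A F` of a filtration by `G`-invariant subspaces, as a chain
complex of `ℤ[G]`-modules. -/
def filtrationRepComplex (hF : ∀ (n : ℕ) (g : G), ∀ x ∈ F n, g • x ∈ F n) :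
    ChainComplex (Rep.{0} ℤ G) ℕ :=
  ChainComplex.of (fun n => Rep.of (relRep A (hF (n + 1)) (hF n) n))
    (fun n => Rep.ofHom
      { toLinearMap := (cellularD A F n).toIntLinearMap
        isIntertwining' := fun g => by
          refine LinearMap.ext fun x => ?_
          obtain ⟨⟨c, hc⟩, rfl⟩ := QuotientAddGroup.mk_surjective x
          exact congrArg (QuotientAddGroup.mk
            (s := (relBoundaries A (F (n + 1)) (F n) n).addSubgroupOf _))
            (Subtype.ext (chainAct_bdry A g (n + 1) c)) })
    (fun n => by ext x; exact cellularD_comp A F n x)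

end Cellular

/-! ### G-CW complexes -/

section Space

variable (G : Type) [Group G] (X : Type) [TopologicalSpace X] [T2Space X] [MulAction G X]
  [ContinuousConstSMul G X] [CWComplex (Set.univ : Set X)]

/-- A CW complex `X` with an action of the discrete group `G` is a `G`-CW complex if `G` permutes
the open cells and an element of `G` mapping an open cell to itself fixes it pointwise. -/
class IsGCWComplex : Prop where
  exists_image_eq : ∀ (g : G) (n : ℕ) (e : RelCWComplex.cell (Set.univ : Set X) n),
    ∃ e' : RelCWComplex.cell (Set.univ : Set X) n,
      (fun x => g • x) '' (RelCWComplex.openCell n e : Set X) = RelCWComplex.openCell n e'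
  fixes : ∀ (g : G) (n : ℕ) (e : RelCWComplex.cell (Set.univ : Set X) n),
    (fun x => g • x) '' (RelCWComplex.openCell n e : Set X) = RelCWComplex.openCell n e →
      ∀ x ∈ (RelCWComplex.openCell n e : Set X), g • x = x

variable [IsGCWComplex G X]

variable {X} in
lemma smul_mem_skeletonLT (n : ℕ) (g : G) (x : X)
    (hx : x ∈ (RelCWComplex.skeletonLT (Set.univ : Set X) (n : ℕ∞) : Set X)) :
    g • x ∈ (RelCWComplex.skeletonLT (Set.univ : Set X) (n : ℕ∞) : Set X) := by
  rw [← CWComplex.iUnion_openCell_eq_skeletonLT] at hx ⊢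
  simp only [Set.mem_iUnion] at hx ⊢
  obtain ⟨m, hm, e, he⟩ := hx
  obtain ⟨e', h'⟩ := IsGCWComplex.exists_image_eq (X := X) g m e
  exact ⟨m, hm, e', h' ▸ ⟨x, he, rfl⟩⟩

/-- The fixed point set `X^G`, as a subcomplex of `X`. -/
def fixedSubcomplex : CWComplex.Subcomplex (Set.univ : Set X) where
  carrier := MulAction.fixedPoints G X
  I n := {e | (RelCWComplex.openCell n e : Set X) ⊆ MulAction.fixedPoints G X}
  closed' := by
    have : MulAction.fixedPoints G X = ⋂ g : G, {x : X | g • x = x} := by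
      ext x; simp [MulAction.mem_fixedPoints]
    rw [this]
    exact isClosed_iInter fun g => isClosed_eq (continuous_const_smul g) continuous_id
  union' := by
    rw [Set.empty_union]
    apply Set.Subset.antisymm
    · exact Set.iUnion_subset fun n => Set.iUnion_subset fun e => e.2
    · intro x hx
      have hu : x ∈ (Set.univ : Set X) := trivial
      rw [← CWComplex.iUnion_openCell_eq_complex (C := (Set.univ : Set X))] at hu
      simp only [Set.mem_iUnion] at hu
      obtain ⟨n, e, he⟩ := hu
      refine Set.mem_iUnion.2 ⟨n, Set.mem_iUnion.2 ⟨⟨e, fun y hy g => ?_⟩, he⟩⟩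
      obtain ⟨e', h'⟩ := IsGCWComplex.exists_image_eq (X := X) g n e
      have hee : e' = e := by
        by_contra hne
        have hd := CWComplex.disjoint_openCell_of_ne (C := (Set.univ : Set X))
          (i := e') (j := e) (n := n) (m := n) (by simpa using hne)
        refine Set.disjoint_left.1 hd ?_ he
        rw [← h']
        exact ⟨x, he, hx g⟩
      rw [hee] at h'
      exact IsGCWComplex.fixes g n e h' y hy

variable (A : Type) [AddCommGroup A]

/-- The cellular chain complex `C_•(X; A)` of a `G`-CW complex `X`, as a complex of
`ℤ[G]`-modules. -/
def cellularRepComplex : ChainComplex (Rep.{0} ℤ G) ℕ :=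
  filtrationRepComplex A
    (fun n : ℕ => (RelCWComplex.skeletonLT (Set.univ : Set X) (n : ℕ∞) : Set X)) G
    (smul_mem_skeletonLT G)

/-- `H_s(G, X; A)`, the homology of the complex of invariants `C_•(X; A)^G`. -/
abbrev invariantHomology (s : ℕ) : ModuleCat.{0} ℤ :=
  (((Rep.invariantsFunctor ℤ G).mapHomologicalComplex _).obj (cellularRepComplex G X A)).homology s

/-- `H_s(X^G; A)`, the cellular homology of the fixed point complex. -/
abbrev fixedHomology (s : ℕ) : ModuleCat.{0} ℤ :=
  (cellularComplex A (fixedSubcomplex G X : Set X)).homology s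

end Space

/-! ### The first spectral sequence of the double complex `Hom(P_{-t}, C_s)` -/

section SpectralSequence

variable {𝓐 : Type*} [Category* 𝓐] [Preadditive 𝓐] (P C : ChainComplex 𝓐 ℕ)

/-- The product of all `Hom(P_q, C_s)`. The factor with indices `s`, `q` is the term of the double
complex in bidegree `(s, t) = (s, -q)`. -/
abbrev Tot : Type _ := ∀ s q : ℕ, P.X q ⟶ C.X s

/-- The differential of the total complex, `∂_C + (-1)^s ∂_P`. (For `q = 0` the second summand
is zero, because `P.d 0 0 = 0`.) -/
def totD : Tot P C →+ Tot P C where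
  toFun f s q := f (s + 1) q ≫ C.d (s + 1) s + (-1 : ℤ) ^ s • (P.d q (q - 1) ≫ f s (q - 1))
  map_zero' := by
    funext s q
    simp
  map_add' f g := by
    funext s q
    simp only [Pi.add_apply, Preadditive.add_comp, Preadditive.comp_add, smul_add]
    abel

lemma totD_totD (f : Tot P C) : totD P C (totD P C f) = 0 := by
  funext s q
  have hP : P.d q (q - 1) ≫ P.d (q - 1) (q - 1 - 1) = 0 := P.d_comp_d _ _ _
  simp only [totD, AddMonoidHom.coe_mk, ZeroHom.coe_mk, Preadditive.add_comp, Preadditive.comp_add,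
    Category.assoc, HomologicalComplex.d_comp_d, Limits.comp_zero, zero_add, Preadditive.zsmul_comp,
    Preadditive.comp_zsmul, reassoc_of% hP, Limits.zero_comp, smul_zero, add_zero, Pi.zero_apply,
    pow_succ]
  simp

/-- Elements of total degree `n`: those supported in bidegrees `(s, t)` with `s + t = n`. When `C`
is bounded only finitely many of these terms are nonzero, so the product is also the sum. -/
def tot (n : ℤ) : AddSubgroup (Tot P C) where
  carrier := {f | ∀ s q : ℕ, (s : ℤ) - q ≠ n → f s q = 0}
  zero_mem' _ _ _ := rfl
  add_mem' {f g} hf hg s q h := by simp [hf s q h, hg s q h]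
  neg_mem' {f} hf s q h := by simp [hf s q h]

/-- The column filtration: elements of total degree `n` supported in the columns `s ≤ a`. -/
def fil (a n : ℤ) : AddSubgroup (Tot P C) where
  carrier := {f | ∀ s q : ℕ, ¬ ((s : ℤ) - q = n ∧ (s : ℤ) ≤ a) → f s q = 0}
  zero_mem' _ _ _ := rfl
  add_mem' {f g} hf hg s q h := by simp [hf s q h, hg s q h]
  neg_mem' {f} hf s q h := by simp [hf s q h]

/-- The group `S_n`, the `n`-th homology of the total complex. -/
def TotHomology (n : ℤ) : Type _ :=
  ↥(tot P C n ⊓ (totD P C).ker) ⧸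
    ((tot P C (n + 1)).map (totD P C)).addSubgroupOf (tot P C n ⊓ (totD P C).ker)

instance (n : ℤ) : AddCommGroup (TotHomology P C n) :=
  inferInstanceAs (AddCommGroup (↥(tot P C n ⊓ (totD P C).ker) ⧸
    ((tot P C (n + 1)).map (totD P C)).addSubgroupOf (tot P C n ⊓ (totD P C).ker)))

/-- The homology class of a cycle of the total complex. -/
def totMk (n : ℤ) : ↥(tot P C n ⊓ (totD P C).ker) →+ TotHomology P C n :=
  QuotientAddGroup.mk' _

/-- The filtration of `S_n`: classes that are represented by a cycle in the columns `s ≤ a`. -/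
def filHomology (a n : ℤ) : AddSubgroup (TotHomology P C n) :=
  ((fil P C a n).addSubgroupOf (tot P C n ⊓ (totD P C).ker)).map (totMk P C n)

/-- `Z^r_{s,t}`: elements of total degree `s + t` in filtration `s` whose differential lies in
filtration `s - r`. -/
def cyc (r s t : ℤ) : AddSubgroup (Tot P C) :=
  fil P C s (s + t) ⊓ (fil P C (s - r) (s + t - 1)).comap (totD P C)

/-- `Z^{r-1}_{s-1,t+1} + D(Z^{r-1}_{s+r-1,t-r+2})`. -/
def bdr (r s t : ℤ) : AddSubgroup (Tot P C) :=
  cyc P C (r - 1) (s - 1) (t + 1) ⊔ (cyc P C (r - 1) (s + r - 1) (t - r + 2)).map (totD P C)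

/-- The term `E^r_{s,t}` of the spectral sequence of the column filtration. -/
abbrev Page (r s t : ℤ) : Type _ := ↥(cyc P C r s t) ⧸ (bdr P C r s t).addSubgroupOf (cyc P C r s t)

variable {P C} in
lemma fil_mono {a a' n : ℤ} (h : a ≤ a') : fil P C a n ≤ fil P C a' n :=
  fun _ hf s q hn => hf s q fun h' => hn ⟨h'.1, h'.2.trans h⟩

/-- The differential `d^r : E^r_{s,t} → E^r_{s-r,t+r-1}`, induced by the total differential. -/
def pageD (r s t s' t' : ℤ) (hs : s' = s - r) (ht : t' = t + r - 1) :
    Page P C r s t →+ Page P C r s' t' :=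
  QuotientAddGroup.map _ _
    (((totD P C).comp (cyc P C r s t).subtype).codRestrict (cyc P C r s' t') (by
      rintro ⟨f, hf⟩
      subst hs ht
      refine AddSubgroup.mem_inf.2 ⟨?_, ?_⟩
      · have h := (AddSubgroup.mem_inf.1 hf).2
        change totD P C f ∈ fil P C (s - r) (s - r + (t + r - 1))
        rw [show s - r + (t + r - 1) = s + t - 1 by ring]
        exact h
      · change totD P C (totD P C f) ∈ fil P C _ _
        rw [totD_totD]
        exact AddSubgroup.zero_mem _))
    (by
      rintro ⟨f, hf⟩ h
      subst hs ht
      change totD P C f ∈ bdr P C r _ _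
      change f ∈ bdr P C r s t at h
      obtain ⟨a, ha, b, ⟨e, he, rfl⟩, rfl⟩ := AddSubgroup.mem_sup.1 h
      rw [map_add, totD_totD, add_zero]
      refine AddSubgroup.mem_sup_right (AddSubgroup.mem_map_of_mem _ ?_)
      rw [show s - r + r - 1 = s - 1 by ring, show t + r - 1 - r + 2 = t + 1 by ring]
      exact ha)

/-- `Z^∞_{s,t}`: the cycles of total degree `s + t` in filtration `s`. -/
def cycInf (s t : ℤ) : AddSubgroup (Tot P C) := fil P C s (s + t) ⊓ (totD P C).ker

/-- `Z^∞_{s-1,t+1} + B^∞_{s,t}`, where `B^∞_{s,t}` consists of the boundaries of total degree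
`s + t` in filtration `s`. -/
def bdrInf (s t : ℤ) : AddSubgroup (Tot P C) :=
  cycInf P C (s - 1) (t + 1) ⊔ (fil P C s (s + t) ⊓ (tot P C (s + t + 1)).map (totD P C))

/-- The term `E^∞_{s,t}`. -/
abbrev PageInf (s t : ℤ) : Type _ :=
  ↥(cycInf P C s t) ⧸ (bdrInf P C s t).addSubgroupOf (cycInf P C s t)

lemma cycInf_le_cyc (r s t : ℤ) : cycInf P C s t ≤ cyc P C r s t := fun f hf => by
  refine AddSubgroup.mem_inf.2 ⟨hf.1, ?_⟩
  change totD P C f ∈ fil P C _ _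
  rw [show totD P C f = 0 from hf.2]
  exact AddSubgroup.zero_mem _

lemma cycInf_le (s t : ℤ) : cycInf P C s t ≤ tot P C (s + t) ⊓ (totD P C).ker :=
  fun _ hf => ⟨fun i q h => hf.1 i q fun h' => h h'.1, hf.2⟩

/-- The class in `E^r_{s,t}` of a permanent cycle. -/
def pageMk (r s t : ℤ) : cycInf P C s t →+ Page P C r s t :=
  (QuotientAddGroup.mk' _).comp (AddSubgroup.inclusion (cycInf_le_cyc P C r s t))

/-- The class in `E^∞_{s,t}` of a permanent cycle. -/
def pageInfMk (s t : ℤ) : cycInf P C s t →+ PageInf P C s t := QuotientAddGroup.mk' _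

/-- The subquotient `F_s S_{s+t} / F_{s-1} S_{s+t}` of the homology of the total complex. -/
abbrev GrHomology (s t : ℤ) : Type _ :=
  ↥(filHomology P C s (s + t)) ⧸
    (filHomology P C (s - 1) (s + t)).addSubgroupOf (filHomology P C s (s + t))

/-- The class in `F_s S_{s+t} / F_{s-1} S_{s+t}` of a permanent cycle. -/
def grMk (s t : ℤ) : cycInf P C s t →+ GrHomology P C s t :=
  (QuotientAddGroup.mk' _).comp
    (((totMk P C (s + t)).comp (AddSubgroup.inclusion (cycInf_le P C s t))).codRestrict
      (filHomology P C s (s + t))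
      fun z => ⟨AddSubgroup.inclusion (cycInf_le P C s t) z, z.2.1, rfl⟩)

/-- The pages are those of a spectral sequence converging to the homology of the total complex: the
filtration of every `S_n` is finite, with uniform bounds, and `E^∞_{s,t}` is the subquotient
`F_s S_{s+t} / F_{s-1} S_{s+t}`. -/
def Converges : Prop :=
  (∀ n, filHomology P C (-1) n = ⊥) ∧ (∃ N : ℤ, ∀ n, filHomology P C N n = ⊤) ∧
    ∀ s t, ∃ e : PageInf P C s t ≃+ GrHomology P C s t,
      ∀ z, e (pageInfMk P C s t z) = grMk P C s t z

/-- `E^2 = E^∞`: all differentials `d^r` with `r ≥ 2` vanish, and `E^2_{s,t}` coincides with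
`E^∞_{s,t}`. -/
def DegeneratesAtE2 : Prop :=
  (∀ r s t s' t' : ℤ, 2 ≤ r → ∀ (hs : s' = s - r) (ht : t' = t + r - 1),
    pageD P C r s t s' t' hs ht = 0) ∧
  ∀ s t, ∃ e : Page P C 2 s t ≃+ PageInf P C s t,
    ∀ z, e (pageMk P C 2 s t z) = pageInfMk P C s t z

end SpectralSequence

end GCW

end

/-! Algebra. Since `p = |G|` is prime, every open cell is either fixed pointwise or has trivial
stabilizer. Hence the `ℤ[G]`-module `C_s(X; A)` is the direct sum of the trivial module `T_s =
C_s(X^G; A)` and an induced module, and the `T_s` form a subcomplex (`isSplit_cellular`,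
`isSplitComplex_cellular`). The induced summand has no cohomology in positive degrees, so for `q >
0` the group `H^q(G, C_s)` is `T_s / p` if `q` is even and the `p`-torsion of `T_s` if `q` is odd.
For `A = ℤ/p` both are `T_s`. For `A = ℤ` the group `T_s` is torsion-free, so the odd rows vanish
and the even ones consist of `T_s / p = C_s(X^G; ℤ/p)`. Taking homology gives the rows `t < 0` of
`E^2`. In the row `t = 0` the cocycles are the invariants.

Degeneration. The rows are described by explicit cochains. There are maps `u q : P_q ⟶ ℤ` with
coboundary `0` for even `q` and `p • u (q + 1)` for odd `q` (`exists_isCyclicClass`); on the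
periodic resolution of a cyclic group they are all the augmentation. For `q > 0`, every cocycle with
values in `C_s` is cohomologous to some `u q · t` with `t` in `T_s`. Suppose that `d^1` kills its
class. For `A = ℤ/p` this forces `∂t = 0`, so that `u q · t` is a cycle of the total complex. For `A
= ℤ` and `q` even it gives `∂t = p t'`; then `u q · p t'` is the coboundary of `u (q - 1) · t'`, and
`p ∂t' = ∂∂t = 0` implies `∂t' = 0`, so the zigzag stops after one correction. In all cases the
class is represented by a permanent cycle (`IsSplitComplex.cyc_two_le`), and as the filtration is
finite, this yields `E^2 = E^∞` (`degeneratesAtE2`).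

Topology. The cellular chains are relative singular homology groups of skeleta. No basis given by
the cells is constructed; two facts suffice. Relative homology of consecutive skeleta decomposes
along any partition of the cells into suitable unions (`exists_sum_isRelCycle`,
`isRelBoundary_of_sum`), which yields the splitting. It also vanishes outside the dimension of the
cells (`CellAttachment.acyclicPair`), and Bockstein arguments then show that `T_s` is torsion-free
with `T_s / p = C_s(X^G; ℤ/p)` when `A = ℤ`. Both facts come from barycentric subdivision together
with a homotopy that pushes the points of the cells radially towards the boundary. Subdivision,
prisms and their identities are built from cones on chains of affine simplices and then carried over
to singular chains. -/

noncomputable section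
namespace GCW

/-! ## Chains on a set of generators and affine simplices -/

section Lin

variable {A B S S' S'' : Type} [AddCommGroup A] [AddCommGroup B]

/-- The additive map of finitely supported functions with coefficients in `A` given by an integral
matrix, whose columns are the values of `Φ`. -/
def lin (A : Type) [AddCommGroup A] (Φ : S → (S' →₀ ℤ)) : (S →₀ A) →+ (S' →₀ A) :=
  Finsupp.liftAddHom fun s =>
    { toFun := fun a => (Φ s).mapRange (fun k => k • a) (zero_smul _ _)
      map_zero' := by ext; simp
      map_add' := fun a b => by ext; simp }

lemma lin_single (Φ : S → (S' →₀ ℤ)) (s : S) (a : A) :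
    lin A Φ (Finsupp.single s a) = (Φ s).mapRange (fun k => k • a) (zero_smul _ _) := by
  rw [lin, Finsupp.liftAddHom_apply_single]
  rfl

@[simp] lemma lin_single_one (Φ : S → (S' →₀ ℤ)) (s : S) :
    lin ℤ Φ (Finsupp.single s 1) = Φ s := by
  ext; simp [lin_single]

lemma lin_mapRange (Φ : S → (S' →₀ ℤ)) (θ : A →+ B) (x : S →₀ A) :
    lin B Φ (x.mapRange θ θ.map_zero) = (lin A Φ x).mapRange θ θ.map_zero := by
  have : (lin B Φ).comp (Finsupp.mapRange.addMonoidHom θ) =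
      (Finsupp.mapRange.addMonoidHom θ).comp (lin A Φ) := by
    ext s a t
    simp [lin_single]
  exact DFunLike.congr_fun this x

/-- An integral chain with coefficients multiplied by `a` is its image under the coefficient
homomorphism `k ↦ k • a`, with which integral matrices commute. So the composite may be computed
over `ℤ`, and identities between operators need to be checked only on integral generators. -/
lemma lin_lin (Φ : S → (S' →₀ ℤ)) (Ψ : S' → (S'' →₀ ℤ)) (x : S →₀ A) :
    lin A Ψ (lin A Φ x) = lin A (fun s => lin ℤ Ψ (Φ s)) x := by
  have : (lin A Ψ).comp (lin A Φ) = lin A (fun s => lin ℤ Ψ (Φ s)) := by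
    refine Finsupp.addHom_ext fun s a => ?_
    rw [AddMonoidHom.comp_apply, lin_single, lin_single]
    exact lin_mapRange Ψ (zmultiplesHom A a) (Φ s)
  exact DFunLike.congr_fun this x

lemma lin_hom_ext {f g : (S →₀ ℤ) →+ B} (h : ∀ s, f (Finsupp.single s 1) = g (Finsupp.single s 1)) :
    f = g := by
  ext s; simpa using h s

lemma lin_add (Φ Ψ : S → (S' →₀ ℤ)) (x : S →₀ A) :
    lin A (fun s => Φ s + Ψ s) x = lin A Φ x + lin A Ψ x := by
  have : lin A (fun s => Φ s + Ψ s) = lin A Φ + lin A Ψ := by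
    ext s a t; simp [lin_single, add_smul]
  exact DFunLike.congr_fun this x

lemma lin_sub (Φ Ψ : S → (S' →₀ ℤ)) (x : S →₀ A) :
    lin A (fun s => Φ s - Ψ s) x = lin A Φ x - lin A Ψ x := by
  have : lin A (fun s => Φ s - Ψ s) = lin A Φ - lin A Ψ := by
    ext s a t; simp [lin_single, sub_smul]
  exact DFunLike.congr_fun this x

lemma lin_id (x : S →₀ A) : lin A (fun s => Finsupp.single s 1) x = x := by
  have : lin A (fun s : S => Finsupp.single s 1) = AddMonoidHom.id _ := by
    ext s a t; simp [lin_single]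
  exact DFunLike.congr_fun this x

/-- The finitely supported functions with support in `P`. -/
def chainsOn (A : Type) [AddCommGroup A] (P : Set S) : AddSubgroup (S →₀ A) where
  carrier := {x | ∀ s, x s ≠ 0 → s ∈ P}
  zero_mem' s h := absurd rfl h
  add_mem' {x y} hx hy s h := by
    by_cases h' : x s = 0
    · exact hy s fun h'' => h (by simp [h', h''])
    · exact hx s h'
  neg_mem' {x} hx s h := hx s (by simpa using h)

lemma chainsOn_mono {P Q : Set S} (h : P ⊆ Q) : chainsOn A P ≤ chainsOn A Q :=
  fun _ hx s hs => h (hx s hs)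

lemma single_mem_chainsOn {P : Set S} {s : S} (hs : s ∈ P) (a : A) :
    Finsupp.single s a ∈ chainsOn A P := fun t ht => by
  by_cases h : s = t
  · exact h ▸ hs
  · exact absurd (Finsupp.single_eq_of_ne' h) ht

lemma mem_chainsOn_inter {P Q : Set S} {x : S →₀ A} (h : x ∈ chainsOn A P) (h' : x ∈ chainsOn A Q) :
    x ∈ chainsOn A (P ∩ Q) := fun s hs => ⟨h s hs, h' s hs⟩

lemma chainsOn_induction {P : Set S} {C : (S →₀ A) → Prop} (h0 : C 0)
    (hadd : ∀ x y, C x → C y → C (x + y)) (hs : ∀ s ∈ P, ∀ a, C (Finsupp.single s a))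
    {x : S →₀ A} (hx : x ∈ chainsOn A P) : C x := by
  classical
  rw [← Finsupp.sum_single x]
  exact Finset.sum_induction _ C hadd h0 fun s h => hs s (hx s (Finsupp.mem_support_iff.1 h)) _

lemma mapRange_mem_chainsOn {P : Set S} (θ : A →+ B) {x : S →₀ A} (hx : x ∈ chainsOn A P) :
    x.mapRange θ θ.map_zero ∈ chainsOn B P := fun s hs => hx s fun h => hs (by simp [h])

lemma lin_mem_chainsOn {P : Set S} {P' : Set S'} {Φ : S → (S' →₀ ℤ)}
    (h : ∀ s ∈ P, Φ s ∈ chainsOn ℤ P') {x : S →₀ A} (hx : x ∈ chainsOn A P) :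
    lin A Φ x ∈ chainsOn A P' := by
  refine chainsOn_induction (C := fun x => lin A Φ x ∈ chainsOn A P') ?_ ?_ ?_ hx
  · rw [map_zero]; exact zero_mem _
  · intro x y hx hy; rw [map_add]; exact add_mem hx hy
  · intro s hs a
    rw [lin_single]
    exact mapRange_mem_chainsOn (zmultiplesHom A a) (h s hs)

lemma exists_sum_of_mem_chainsOn_iUnion {ι : Type} [Fintype ι] {P : ι → Set S} {x : S →₀ A}
    (hx : x ∈ chainsOn A (⋃ i, P i)) :
    ∃ y : ι → (S →₀ A), (∀ i, y i ∈ chainsOn A (P i)) ∧ ∑ i, y i = x := by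
  classical
  refine chainsOn_induction (C := fun x => ∃ y : ι → (S →₀ A),
    (∀ i, y i ∈ chainsOn A (P i)) ∧ ∑ i, y i = x) ⟨0, fun i => zero_mem _, by simp⟩ ?_ ?_ hx
  · rintro _ _ ⟨y, hy, rfl⟩ ⟨z, hz, rfl⟩
    exact ⟨y + z, fun i => add_mem (hy i) (hz i), by simp [Finset.sum_add_distrib]⟩
  · intro s hs a
    obtain ⟨i, hi⟩ := Set.mem_iUnion.1 hs
    refine ⟨Pi.single i (Finsupp.single s a), fun j => ?_, by simp⟩
    by_cases h : j = i
    · subst h; simpa using single_mem_chainsOn hi a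
    · rw [Pi.single_eq_of_ne h]; exact zero_mem _

end Lin

/-! ### Chains of affine simplices -/

section Affine

variable {K K' : Type}

/-- Integral chains of ordered `n`-simplices with vertices in `K`. -/
abbrev AffChain (K : Type) (n : ℕ) : Type := (Fin (n + 1) → K) →₀ ℤ

/-- The boundary of an ordered simplex. -/
def affFaces {n : ℕ} (v : Fin (n + 2) → K) : AffChain K n :=
  ∑ i : Fin (n + 2), Finsupp.single (v ∘ i.succAbove) ((-1) ^ (i : ℕ))

/-- The boundary map on affine chains. -/
abbrev affD {n : ℕ} : AffChain K (n + 1) →+ AffChain K n := lin ℤ affFaces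

/-- The cone with apex `b` on an affine chain. -/
abbrev affCone (b : K) {n : ℕ} : AffChain K n →+ AffChain K (n + 1) :=
  lin ℤ fun v => Finsupp.single (Fin.cons b v : Fin (n + 2) → K) 1

/-- The map of affine chains induced by a map of the vertices. -/
abbrev affMap (f : K → K') {n : ℕ} : AffChain K n →+ AffChain K' n :=
  lin ℤ fun v => Finsupp.single (f ∘ v) 1

lemma smul_single_one {S : Type} (s : S) (k : ℤ) : Finsupp.single s k = k • Finsupp.single s (1 : ℤ) := by
  simp

lemma affFaces_eq {n : ℕ} (v : Fin (n + 2) → K) :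
    affFaces v = ∑ i : Fin (n + 2), (-1 : ℤ) ^ (i : ℕ) • Finsupp.single (v ∘ i.succAbove) (1 : ℤ) := by
  simp [affFaces]

lemma affMap_affD (f : K → K') {n : ℕ} (x : AffChain K (n + 1)) :
    affMap f (affD x) = affD (affMap f x) := by
  refine DFunLike.congr_fun (lin_hom_ext (f := (affMap f).comp affD) (g := affD.comp (affMap f))
    fun v => ?_) x
  simp only [AddMonoidHom.comp_apply, lin_single_one, affFaces_eq, map_sum, map_zsmul]
  rfl

lemma affMap_affCone (f : K → K') (b : K) {n : ℕ} (x : AffChain K n) :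
    affMap f (affCone b x) = affCone (f b) (affMap f x) := by
  refine DFunLike.congr_fun (lin_hom_ext (f := (affMap f).comp (affCone b))
    (g := (affCone (f b)).comp (affMap f)) fun v => ?_) x
  simp only [AddMonoidHom.comp_apply, lin_single_one]
  congr 1
  ext j
  refine Fin.cases ?_ (fun j => ?_) j <;> simp

/-- The face opposite to the apex is the base; every other face is the cone on a face of the base,
with its index raised by one and therefore the opposite sign. -/
lemma affD_affCone (b : K) {n : ℕ} (x : AffChain K (n + 1)) :
    affD (affCone b x) = x - affCone b (affD x) := by
  refine DFunLike.congr_fun (lin_hom_ext (f := affD.comp (affCone b))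
    (g := AddMonoidHom.id _ - (affCone b).comp affD) fun v => ?_) x
  simp only [AddMonoidHom.comp_apply, AddMonoidHom.sub_apply, AddMonoidHom.id_apply, lin_single_one]
  rw [affFaces_eq, Fin.sum_univ_succ, affFaces_eq, map_sum, sub_eq_add_neg, ← Finset.sum_neg_distrib]
  congr 1
  · simp
  · refine Finset.sum_congr rfl fun i _ => ?_
    rw [map_zsmul, lin_single_one, ← neg_smul, Fin.val_succ, pow_succ, mul_neg_one]
    congr 2
    ext j
    refine Fin.cases ?_ (fun j => ?_) j <;> simp

/-- The sum of the coefficients of an affine `0`-chain. -/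
abbrev affAug : AffChain K 0 →+ ℤ := Finsupp.liftAddHom fun _ => AddMonoidHom.id ℤ

/-- In degree zero the face of the base would be the empty simplex, so the augmentation takes the
place of the boundary. -/
lemma affD_affCone_zero (b : K) (x : AffChain K 0) :
    affD (affCone b x) = x - affAug x • Finsupp.single (fun _ => b) 1 := by
  refine Finsupp.induction_linear x (by simp) (fun x y hx hy => ?_) fun v k => ?_
  · simp only [map_add, hx, hy, add_smul]; abel
  · rw [smul_single_one, map_zsmul, map_zsmul, map_zsmul, lin_single_one, lin_single_one,
      affFaces_eq, Fin.sum_univ_two, smul_assoc, ← smul_sub]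
    congr 1
    simp only [affAug, Finsupp.liftAddHom_apply_single, AddMonoidHom.id_apply, one_smul]
    rw [sub_eq_add_neg]
    congr 1
    · simp
    · simp only [Fin.val_one, pow_one, neg_smul, one_smul, neg_inj]
      congr 1
      ext j; fin_cases j; simp

lemma affAug_affD (x : AffChain K 1) : affAug (affD x) = 0 := by
  refine DFunLike.congr_fun (lin_hom_ext (f := affAug.comp affD) (g := 0) fun v => ?_) x
  simp only [AddMonoidHom.comp_apply, lin_single_one, affFaces_eq, map_sum, map_zsmul]
  simp [Fin.sum_univ_two]

lemma affCone_tail {n : ℕ} (v : Fin (n + 2) → K) :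
    Finsupp.single v (1 : ℤ) = affCone (v 0) (Finsupp.single (Fin.tail v) 1) := by
  rw [lin_single_one, Fin.cons_self_tail]

/-- Every simplex is the cone from its first vertex on the remaining ones, so the cone formula and
induction give the result without simplicial identities. -/
lemma affD_affD {n : ℕ} (x : AffChain K (n + 2)) : affD (affD x) = 0 := by
  induction n with
  | zero =>
    refine DFunLike.congr_fun (lin_hom_ext (f := affD.comp affD) (g := 0) fun v => ?_) x
    rw [AddMonoidHom.comp_apply, affCone_tail, affD_affCone, map_sub, affD_affCone_zero,
      affAug_affD]
    simp
  | succ n ih =>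
    refine DFunLike.congr_fun (lin_hom_ext (f := affD.comp affD) (g := 0) fun v => ?_) x
    rw [AddMonoidHom.comp_apply, affCone_tail, affD_affCone, map_sub, affD_affCone, ih]
    simp

/-! ### Subdivision -/

variable (b : ∀ n : ℕ, (Fin (n + 1) → K) → K) (b' : ∀ n : ℕ, (Fin (n + 1) → K') → K')

/-- The subdivision of an ordered simplex, obtained by joining the subdivided faces to an interior
point. -/
def affSd : ∀ {n : ℕ}, (Fin (n + 1) → K) → AffChain K n
  | 0, v => Finsupp.single v 1
  | _ + 1, v => affCone (b _ v) (lin ℤ affSd (affFaces v))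

/-- The homotopy between subdivision and the identity. -/
def affT : ∀ {n : ℕ}, (Fin (n + 1) → K) → AffChain K (n + 1)
  | 0, _ => 0
  -- The chain under the cone is the one that the boundary has to produce. It is a cycle by the
  -- formula in lower degree, so the boundary of the cone is exactly this chain.
  | _ + 1, v => affCone (b _ v) (Finsupp.single v 1 - affSd b v - lin ℤ affT (affFaces v))

/-- The base of the cone is the subdivided boundary. It is a cycle by induction, or in the lowest
degree has augmentation zero, so only the base survives in the boundary of the cone. -/
lemma affD_affSd {n : ℕ} (x : AffChain K (n + 1)) :
    affD (lin ℤ (affSd b) x) = lin ℤ (affSd b) (affD x) := by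
  induction n with
  | zero =>
    refine DFunLike.congr_fun (lin_hom_ext (f := affD.comp (lin ℤ (affSd b)))
      (g := (lin ℤ (affSd b)).comp affD) fun v => ?_) x
    have h : ∀ y : AffChain K 0, lin ℤ (affSd b) y = y := fun y => lin_id y
    simp only [AddMonoidHom.comp_apply, lin_single_one]
    rw [affSd, affD_affCone_zero, h, ← lin_single_one affFaces, affAug_affD]
    simp
  | succ n ih =>
    refine DFunLike.congr_fun (lin_hom_ext (f := affD.comp (lin ℤ (affSd b)))
      (g := (lin ℤ (affSd b)).comp affD) fun v => ?_) x
    simp only [AddMonoidHom.comp_apply, lin_single_one]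
    rw [affSd, affD_affCone, ih, ← lin_single_one affFaces, affD_affD]
    simp

lemma affD_affT {n : ℕ} (x : AffChain K (n + 1)) :
    affD (lin ℤ (affT b) x) + lin ℤ (affT b) (affD x) = x - lin ℤ (affSd b) x := by
  induction n with
  | zero =>
    refine DFunLike.congr_fun (lin_hom_ext (f := affD.comp (lin ℤ (affT b)) +
      (lin ℤ (affT b)).comp affD) (g := AddMonoidHom.id _ - lin ℤ (affSd b)) fun v => ?_) x
    have h : ∀ y : AffChain K 0, lin ℤ (affT b) y = 0 := fun y =>
      DFunLike.congr_fun (lin_hom_ext (f := lin ℤ (affT b)) (g := 0) (by simp [affT])) y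
    have h' : ∀ y : AffChain K 0, lin ℤ (affSd b) y = y := fun y => lin_id y
    have e := affD_affSd b (Finsupp.single v 1)
    simp only [AddMonoidHom.comp_apply, AddMonoidHom.add_apply, AddMonoidHom.sub_apply,
      AddMonoidHom.id_apply, lin_single_one, h, h'] at e ⊢
    rw [affT, affD_affCone, h, sub_zero, map_sub, lin_single_one, e]
    simp
  | succ n ih =>
    refine DFunLike.congr_fun (lin_hom_ext (f := affD.comp (lin ℤ (affT b)) +
      (lin ℤ (affT b)).comp affD) (g := AddMonoidHom.id _ - lin ℤ (affSd b)) fun v => ?_) x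
    have e := affD_affSd b (Finsupp.single v 1)
    have e' := ih (affFaces v)
    rw [← lin_single_one affFaces, affD_affD, map_zero, add_zero] at e'
    simp only [AddMonoidHom.comp_apply, AddMonoidHom.add_apply, AddMonoidHom.sub_apply,
      AddMonoidHom.id_apply, lin_single_one] at e e' ⊢
    rw [affT, affD_affCone, map_sub, map_sub affD, e, e', lin_single_one]
    simp

-- Naturality under maps that preserve the interior points; this is what allows the construction to
-- be transported to singular simplices.
variable {b b'} in
lemma affMap_affSd {f : K → K'} (hf : ∀ (n : ℕ) (v : Fin (n + 1) → K), f (b n v) = b' n (f ∘ v)) {n : ℕ}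
    (x : AffChain K n) : affMap f (lin ℤ (affSd b) x) = lin ℤ (affSd b') (affMap f x) := by
  induction n with
  | zero =>
    rw [show lin ℤ (affSd b) x = x from lin_id x]
    exact (lin_id _).symm
  | succ n ih =>
    refine DFunLike.congr_fun (lin_hom_ext (f := (affMap f).comp (lin ℤ (affSd b)))
      (g := (lin ℤ (affSd b')).comp (affMap f)) fun v => ?_) x
    simp only [AddMonoidHom.comp_apply, lin_single_one]
    rw [affSd, affSd, affMap_affCone, ih, ← lin_single_one affFaces, affMap_affD, hf]
    simp

variable {b b'} in
lemma affMap_affT {f : K → K'} (hf : ∀ (n : ℕ) (v : Fin (n + 1) → K), f (b n v) = b' n (f ∘ v)) {n : ℕ}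
    (x : AffChain K n) : affMap f (lin ℤ (affT b) x) = lin ℤ (affT b') (affMap f x) := by
  induction n with
  | zero =>
    refine DFunLike.congr_fun (lin_hom_ext (f := (affMap f).comp (lin ℤ (affT b)))
      (g := (lin ℤ (affT b')).comp (affMap f)) fun v => ?_) x
    simp [affT]
  | succ n ih =>
    refine DFunLike.congr_fun (lin_hom_ext (f := (affMap f).comp (lin ℤ (affT b)))
      (g := (lin ℤ (affT b')).comp (affMap f)) fun v => ?_) x
    have e := affMap_affSd hf (Finsupp.single v 1)
    simp only [AddMonoidHom.comp_apply, lin_single_one] at e ⊢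
    rw [affT, affT, affMap_affCone, map_sub, map_sub (affMap f), ih, ← lin_single_one affFaces, affMap_affD, hf,
      e]
    simp

/-- The `k`-fold subdivision of affine chains. -/
def affSdIter (n : ℕ) : ℕ → (AffChain K n →+ AffChain K n)
  | 0 => AddMonoidHom.id _
  | k + 1 => (lin ℤ (affSd b)).comp (affSdIter n k)

/-- The homotopy between the `k`-fold subdivision and the identity. -/
def affTIter (n : ℕ) : ℕ → (AffChain K n →+ AffChain K (n + 1))
  | 0 => 0
  | k + 1 => affTIter n k + (lin ℤ (affT b)).comp (affSdIter b n k)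

lemma affD_affSdIter (k : ℕ) {n : ℕ} (x : AffChain K (n + 1)) :
    affD (affSdIter b _ k x) = affSdIter b _ k (affD x) := by
  induction k with
  | zero => rfl
  | succ k ih =>
    change affD (lin ℤ (affSd b) _) = lin ℤ (affSd b) _
    rw [affD_affSd, ih]

lemma affD_affTIter (k : ℕ) {n : ℕ} (x : AffChain K (n + 1)) :
    affD (affTIter b _ k x) + affTIter b _ k (affD x) = x - affSdIter b _ k x := by
  induction k with
  | zero =>
    change affD 0 + 0 = x - x
    simp
  | succ k ih =>
    change affD (affTIter b _ k x + lin ℤ (affT b) (affSdIter b _ k x)) +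
      (affTIter b _ k (affD x) + lin ℤ (affT b) (affSdIter b _ k (affD x))) =
      x - lin ℤ (affSd b) (affSdIter b _ k x)
    have e := affD_affT b (affSdIter b _ k x)
    rw [affD_affSdIter] at e
    rw [map_add, add_add_add_comm, ih, e]
    abel

lemma affTIter_zero (k : ℕ) (x : AffChain K 0) : affTIter b 0 k x = 0 := by
  induction k with
  | zero => rfl
  | succ k ih =>
    change affTIter b 0 k x + lin ℤ (affT b) (affSdIter b 0 k x) = 0
    rw [ih]
    refine (zero_add _).trans ?_
    exact DFunLike.congr_fun (lin_hom_ext (f := lin ℤ (affT b)) (g := 0) (by simp [affT])) _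

lemma affSdIter_zero (k : ℕ) (x : AffChain K 0) : affSdIter b 0 k x = x := by
  induction k with
  | zero => rfl
  | succ k ih =>
    change lin ℤ (affSd b) (affSdIter b 0 k x) = x
    rw [ih]
    exact lin_id x

variable {b b'} in
lemma affMap_affSdIter {f : K → K'} (hf : ∀ (n : ℕ) (v : Fin (n + 1) → K), f (b n v) = b' n (f ∘ v))
    (k : ℕ) {n : ℕ} (x : AffChain K n) :
    affMap f (affSdIter b n k x) = affSdIter b' n k (affMap f x) := by
  induction k with
  | zero => rfl
  | succ k ih =>
    change affMap f (lin ℤ (affSd b) _) = lin ℤ (affSd b') _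
    rw [affMap_affSd hf, ih]

variable {b b'} in
lemma affMap_affTIter {f : K → K'} (hf : ∀ (n : ℕ) (v : Fin (n + 1) → K), f (b n v) = b' n (f ∘ v))
    (k : ℕ) {n : ℕ} (x : AffChain K n) :
    affMap f (affTIter b n k x) = affTIter b' n k (affMap f x) := by
  induction k with
  | zero => exact map_zero _
  | succ k ih =>
    change affMap f (affTIter b n k x + lin ℤ (affT b) (affSdIter b n k x)) =
      affTIter b' n k (affMap f x) + lin ℤ (affT b') (affSdIter b' n k (affMap f x))
    rw [map_add, affMap_affT hf, ih, affMap_affSdIter hf]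

/-! ### Mesh of the subdivision -/

section Mesh

variable [PseudoMetricSpace K]

/-- The ordered `n`-simplices in the metric space `K` with vertices at distance at most `D`. -/
def meshLE (K : Type) [PseudoMetricSpace K] (n : ℕ) (D : ℝ) : Set (Fin (n + 1) → K) :=
  {v | ∀ i j, dist (v i) (v j) ≤ D}

lemma affSd_dist_le
    (hb' : ∀ (n : ℕ) (v : Fin (n + 1) → K) (x : K) (r : ℝ), (∀ i, dist x (v i) ≤ r) →
    dist x (b n v) ≤ r)
    {n : ℕ} (v : Fin (n + 1) → K) (x : K) (r : ℝ) (h : ∀ i, dist x (v i) ≤ r) :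
    affSd b v ∈ chainsOn ℤ {w | ∀ i, dist x (w i) ≤ r} := by
  induction n with
  | zero => exact single_mem_chainsOn (P := {w : Fin (0 + 1) → K | ∀ i, dist x (w i) ≤ r}) h _
  | succ n ih =>
    refine lin_mem_chainsOn (P := {w | ∀ i, dist x (w i) ≤ r}) (fun w hw => ?_) ?_
    · refine single_mem_chainsOn (fun i => ?_) _
      refine Fin.cases ?_ (fun i => ?_) i
      · exact hb' _ _ _ _ h
      · simpa using hw i
    · rw [affFaces_eq, map_sum]
      refine sum_mem fun i _ => ?_
      rw [map_zsmul, lin_single_one]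
      exact AddSubgroup.zsmul_mem _ (ih _ fun j => h _) _

/-- An edge of the subdivision either lies in the subdivision of a proper face, where induction
gives a smaller factor, or joins the interior point to a point of the simplex. Induction therefore
has to control both the mesh of the base of the cone and its distance from the apex. -/
lemma affSd_mem_meshLE
    (hb : ∀ (n : ℕ) (v : Fin (n + 1) → K) (D : ℝ), v ∈ meshLE K n D →
    ∀ i, dist (b n v) (v i) ≤ n / (n + 1) * D)
    (hb' : ∀ (n : ℕ) (v : Fin (n + 1) → K) (x : K) (r : ℝ), (∀ i, dist x (v i) ≤ r) →
    dist x (b n v) ≤ r)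
    {n : ℕ} (v : Fin (n + 1) → K) (D : ℝ) (hD : 0 ≤ D) (h : v ∈ meshLE K n D) :
    affSd b v ∈ chainsOn ℤ (meshLE K n (n / (n + 1) * D)) := by
  induction n with
  | zero =>
    refine single_mem_chainsOn (fun i j => ?_) _
    rw [show i = j from Subsingleton.elim (α := Fin 1) i j]
    simp
  | succ n ih =>
    have hle : (n : ℝ) / (n + 1) * D ≤ ((n + 1 : ℕ) : ℝ) / ((n + 1 : ℕ) + 1) * D := by
      refine mul_le_mul_of_nonneg_right ?_ hD
      push_cast
      rw [div_le_div_iff₀ (by positivity) (by positivity)]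
      nlinarith
    refine lin_mem_chainsOn (P := meshLE K n (n / (n + 1) * D) ∩
      {w | ∀ i, dist (b _ v) (w i) ≤ ((n + 1 : ℕ) : ℝ) / ((n + 1 : ℕ) + 1) * D})
      (fun w hw => ?_) ?_
    · refine single_mem_chainsOn (fun i j => ?_) _
      refine Fin.cases ?_ (fun i => ?_) i <;> refine Fin.cases ?_ (fun j => ?_) j
      · simp only [Fin.cons_zero, dist_self]; positivity
      · simpa using hw.2 j
      · simpa [dist_comm] using hw.2 i
      · simpa using (hw.1 i j).trans (by simpa using hle)
    · rw [affFaces_eq, map_sum]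
      refine sum_mem fun i _ => ?_
      rw [map_zsmul, lin_single_one]
      exact AddSubgroup.zsmul_mem _ (mem_chainsOn_inter (ih _ fun j k => h _ _)
        (affSd_dist_le b hb' _ _ _ fun j => hb _ v D h _)) _

lemma affSdIter_mem_meshLE
    (hb : ∀ (n : ℕ) (v : Fin (n + 1) → K) (D : ℝ), v ∈ meshLE K n D →
    ∀ i, dist (b n v) (v i) ≤ n / (n + 1) * D)
    (hb' : ∀ (n : ℕ) (v : Fin (n + 1) → K) (x : K) (r : ℝ), (∀ i, dist x (v i) ≤ r) →
    dist x (b n v) ≤ r)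
    {n : ℕ} (v : Fin (n + 1) → K) (D : ℝ) (hD : 0 ≤ D)
    (h : v ∈ meshLE K n D) (k : ℕ) :
    affSdIter b n k (Finsupp.single v 1) ∈ chainsOn ℤ (meshLE K n ((n / (n + 1)) ^ k * D)) := by
  induction k with
  | zero => exact single_mem_chainsOn (by simpa using h) _
  | succ k ih =>
    refine lin_mem_chainsOn (fun w hw => ?_) ih
    rw [pow_succ', mul_assoc]
    exact affSd_mem_meshLE b hb hb' w _ (by positivity) hw

end Mesh

/-! ### Prisms -/

variable {J : Type} (j₀ j₁ : J)

/-- The prism on an ordered simplex. -/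
def affPrism : ∀ {n : ℕ}, (Fin (n + 1) → K) → AffChain (K × J) (n + 1)
  | 0, v => affCone (v 0, j₀) (Finsupp.single (fun i => (v i, j₁)) 1)
  -- The same device as for `affT`: the chain top minus bottom minus the prism on the boundary is a
  -- cycle by the lower degrees, and its cone has it as boundary. The simplices that become
  -- degenerate do no harm.
  | _ + 1, v => affCone (v 0, j₀) (Finsupp.single (fun i => (v i, j₁)) 1 -
      Finsupp.single (fun i => (v i, j₀)) 1 - lin ℤ affPrism (affFaces v))

lemma affD_affPrism_zero (x : AffChain K 0) :
    affD (lin ℤ (affPrism j₀ j₁) x) = affMap (fun v => (v, j₁)) x - affMap (fun v => (v, j₀)) x := by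
  refine DFunLike.congr_fun (lin_hom_ext (f := affD.comp (lin ℤ (affPrism j₀ j₁)))
    (g := affMap (fun v => (v, j₁)) - affMap (fun v => (v, j₀))) fun v => ?_) x
  simp only [AddMonoidHom.comp_apply, AddMonoidHom.sub_apply, lin_single_one]
  rw [affPrism, affD_affCone_zero]
  simp only [affAug, Finsupp.liftAddHom_apply_single, AddMonoidHom.id_apply, one_smul]
  congr 2
  ext i : 1
  rw [show i = 0 from Subsingleton.elim (α := Fin 1) i 0]
  rfl

lemma affD_affPrism {n : ℕ} (x : AffChain K (n + 1)) :
    affD (lin ℤ (affPrism j₀ j₁) x) + lin ℤ (affPrism j₀ j₁) (affD x) =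
      affMap (fun v => (v, j₁)) x - affMap (fun v => (v, j₀)) x := by
  have key : ∀ (n : ℕ) (v : Fin (n + 2) → K), affD (lin ℤ (affPrism j₀ j₁) (affFaces v)) =
      affMap (fun v => (v, j₁)) (affFaces v) - affMap (fun v => (v, j₀)) (affFaces v) →
      affD (affPrism j₀ j₁ v) + lin ℤ (affPrism j₀ j₁) (affFaces v) =
        Finsupp.single (fun i => (v i, j₁)) 1 - Finsupp.single (fun i => (v i, j₀)) 1 := by
    intro n v h
    rw [affPrism, affD_affCone, map_sub affD, map_sub affD, h, ← lin_single_one affFaces,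
      affMap_affD, affMap_affD, lin_single_one, lin_single_one]
    change _ - affCone _ (_ - _ - (_ - _)) + _ = _
    simp [Function.comp_def]
  induction n with
  | zero =>
    refine DFunLike.congr_fun (lin_hom_ext (f := affD.comp (lin ℤ (affPrism j₀ j₁)) +
      (lin ℤ (affPrism j₀ j₁)).comp affD)
      (g := affMap (fun v => (v, j₁)) - affMap (fun v => (v, j₀))) fun v => ?_) x
    simp only [AddMonoidHom.comp_apply, AddMonoidHom.add_apply, AddMonoidHom.sub_apply,
      lin_single_one]
    exact key 0 v (affD_affPrism_zero _ _ _)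
  | succ n ih =>
    refine DFunLike.congr_fun (lin_hom_ext (f := affD.comp (lin ℤ (affPrism j₀ j₁)) +
      (lin ℤ (affPrism j₀ j₁)).comp affD)
      (g := affMap (fun v => (v, j₁)) - affMap (fun v => (v, j₀))) fun v => ?_) x
    simp only [AddMonoidHom.comp_apply, AddMonoidHom.add_apply, AddMonoidHom.sub_apply,
      lin_single_one]
    refine key _ v ?_
    rw [← ih, ← lin_single_one affFaces, affD_affD]
    simp

lemma affMap_affPrism (f : K → K') {n : ℕ} (x : AffChain K n) :
    affMap (Prod.map f id) (lin ℤ (affPrism j₀ j₁) x) = lin ℤ (affPrism j₀ j₁) (affMap f x) := by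
  induction n with
  | zero =>
    refine DFunLike.congr_fun (lin_hom_ext (f := (affMap (Prod.map f id)).comp
      (lin ℤ (affPrism j₀ j₁))) (g := (lin ℤ (affPrism j₀ j₁)).comp (affMap f)) fun v => ?_) x
    simp only [AddMonoidHom.comp_apply, lin_single_one]
    rw [affPrism, affPrism, affMap_affCone, lin_single_one]
    rfl
  | succ n ih =>
    refine DFunLike.congr_fun (lin_hom_ext (f := (affMap (Prod.map f id)).comp
      (lin ℤ (affPrism j₀ j₁))) (g := (lin ℤ (affPrism j₀ j₁)).comp (affMap f)) fun v => ?_) x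
    simp only [AddMonoidHom.comp_apply, lin_single_one]
    rw [affPrism, affPrism, affMap_affCone, map_sub (affMap _), map_sub (affMap _), ih,
      ← lin_single_one affFaces, affMap_affD, lin_single_one, lin_single_one, lin_single_one,
      lin_single_one]
    rfl

end Affine
end GCW

end

noncomputable section
namespace GCW

/-! ## Singular chains and barycentric subdivision -/

section Singular

/-- The topological standard simplex. -/
abbrev Simplex (n : ℕ) : Type := stdSimplex ℝ (Fin (n + 1))

/-- Singular simplices. -/
abbrev Simp (n : ℕ) (X : Type) [TopologicalSpace X] : Type := C(Simplex n, X)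

/-- Singular chains with coefficients in `A`. -/
abbrev SCh (A : Type) [AddCommGroup A] (n : ℕ) (X : Type) [TopologicalSpace X] : Type :=
  Simp n X →₀ A

/-! #### Affine maps from the standard simplex -/

variable {E : Type} [AddCommGroup E] [Module ℝ E] [TopologicalSpace E] [ContinuousAdd E]
  [ContinuousSMul ℝ E] {C : Set E}

/-- The affine simplex with given vertices in a convex set. -/
def affine (hC : Convex ℝ C) {m : ℕ} (v : Fin (m + 1) → C) : C(Simplex m, C) where
  toFun t := ⟨∑ i, t.1 i • (v i : E), hC.sum_mem (fun i _ => t.2.1 i) t.2.2 fun i _ => (v i).2⟩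
  continuous_toFun := Continuous.subtype_mk (continuous_finsetSum _ fun i _ =>
    ((continuous_apply i).comp continuous_subtype_val).smul continuous_const) _

lemma affine_apply (hC : Convex ℝ C) {m : ℕ} (v : Fin (m + 1) → C) (t : Simplex m) :
    (affine hC v t : E) = ∑ i, t.1 i • (v i : E) := rfl

/-- The vertices of the standard simplex. -/
abbrev vert (n : ℕ) : Fin (n + 1) → Simplex n := fun i => stdSimplex.vertex i

abbrev convS (n : ℕ) : Convex ℝ (stdSimplex ℝ (Fin (n + 1))) := convex_stdSimplex ℝ _

lemma affine_vert (hC : Convex ℝ C) {m : ℕ} (v : Fin (m + 1) → C) (i : Fin (m + 1)) :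
    affine hC v (vert m i) = v i := by
  apply Subtype.ext
  simp [affine_apply, Pi.single_apply, vert, ite_smul]

lemma affine_self (n : ℕ) (t : Simplex n) : affine (convS n) (vert n) t = t := by
  apply Subtype.ext
  ext j
  simp [affine_apply, Pi.single_apply]

lemma affine_affine (hC : Convex ℝ C) {m n : ℕ} (u : Fin (n + 1) → C) (v : Fin (m + 1) → Simplex n)
    (t : Simplex m) :
    affine hC u (affine (convS n) v t) = affine hC (affine hC u ∘ v) t := by
  apply Subtype.ext
  simp only [affine_apply, Function.comp, Finset.sum_apply, Pi.smul_apply, smul_eq_mul,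
    Finset.sum_smul, Finset.smul_sum, mul_smul]
  exact Finset.sum_comm

/-- The face maps of the standard simplices. -/
def faceMap {n : ℕ} (i : Fin (n + 2)) : C(Simplex n, Simplex (n + 1)) :=
  ⟨stdSimplex.map i.succAbove, stdSimplex.continuous_map _⟩

lemma affine_faceMap (hC : Convex ℝ C) {m : ℕ} (v : Fin (m + 2) → C) (i : Fin (m + 2)) :
    (affine hC v).comp (faceMap i) = affine hC (v ∘ i.succAbove) := by
  ext t : 1
  have h : faceMap i t = affine (convS (m + 1)) (vert (m + 1) ∘ i.succAbove) t := by
    apply Subtype.ext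
    ext j
    have ht : t.1 = ∑ k, t.1 k • Pi.single k (1 : ℝ) := by
      ext l; simp [Pi.single_apply]
    simp only [faceMap, ContinuousMap.coe_mk]
    change FunOnFinite.linearMap ℝ ℝ _ t.1 j = _
    rw [ht, map_sum]
    simp only [map_smul, FunOnFinite.linearMap_piSingle]
    simp [affine_apply, vert]
  rw [ContinuousMap.comp_apply, h, affine_affine]
  congr 1
  congr 1
  ext j : 1
  exact affine_vert ..

/-! #### Singular chains -/

variable {A : Type} [AddCommGroup A] {X Y : Type} [TopologicalSpace X] [TopologicalSpace Y]

/-- The boundary of a singular simplex. -/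
def faces {n : ℕ} (σ : Simp (n + 1) X) : SCh ℤ n X :=
  ∑ i : Fin (n + 2), (-1 : ℤ) ^ (i : ℕ) • Finsupp.single (σ.comp (faceMap i)) (1 : ℤ)

/-- The boundary map of singular chains, zero on `0`-chains. -/
def bd (A : Type) [AddCommGroup A] : ∀ n : ℕ, SCh A n X →+ SCh A (n - 1) X
  | 0 => 0
  | _ + 1 => lin A faces

/-- The map of singular chains induced by a continuous map. -/
abbrev chMap (A : Type) [AddCommGroup A] (f : C(X, Y)) {n : ℕ} : SCh A n X →+ SCh A n Y :=
  lin A fun σ => Finsupp.single (f.comp σ) 1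

lemma bd_chMap (f : C(X, Y)) {n : ℕ} (x : SCh A n X) :
    bd A n (chMap A f x) = chMap A f (bd A n x) := by
  cases n with
  | zero => simp [bd]
  | succ n =>
    change lin A faces _ = chMap A f (lin A faces x)
    rw [lin_lin, lin_lin]
    congr 2
    ext σ : 1
    rw [lin_single_one]
    simp only [faces, map_sum, map_zsmul, lin_single_one]
    rfl

/-- The singular chain obtained by applying a singular simplex to an affine chain. -/
abbrev push {N : ℕ} (σ : Simp N X) {m : ℕ} : AffChain (Simplex N) m →+ SCh ℤ m X :=
  lin ℤ fun v => Finsupp.single (σ.comp (affine (convS N) v)) 1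

lemma faces_push {N : ℕ} (σ : Simp N X) {m : ℕ} (x : AffChain (Simplex N) (m + 1)) :
    lin ℤ faces (push σ x) = push σ (affD x) := by
  refine DFunLike.congr_fun (lin_hom_ext (f := (lin ℤ faces).comp (push σ))
    (g := (push σ).comp affD) fun v => ?_) x
  simp only [AddMonoidHom.comp_apply, lin_single_one, faces, affFaces_eq, map_sum, map_zsmul,
    ContinuousMap.comp_assoc, affine_faceMap]

lemma push_vert {N : ℕ} (σ : Simp N X) : push σ (Finsupp.single (vert N) 1) = Finsupp.single σ 1 := by
  rw [lin_single_one]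
  congr 1
  ext t
  simp [affine_self]

/-- A family of operators on affine chains of the standard simplices is realized on singular
chains. -/
def realize {j : ℕ → ℕ} (F : ∀ N n, AffChain (Simplex N) n →+ AffChain (Simplex N) (j n)) {n : ℕ}
    (σ : Simp n X) : SCh ℤ (j n) X :=
  push σ (F n n (Finsupp.single (vert n) 1))

lemma push_comp_affine {N : ℕ} (σ : Simp N X) {n : ℕ} (v : Fin (n + 1) → Simplex N) {m : ℕ}
    (y : AffChain (Simplex n) m) :
    push (σ.comp (affine (convS N) v)) y = push σ (affMap (affine (convS N) v) y) := by
  rw [lin_lin]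
  refine DFunLike.congr_fun (lin_hom_ext fun w => ?_) y
  rw [lin_single_one, lin_single_one, lin_single_one]
  congr 1
  ext t
  exact congrArg σ (affine_affine _ _ _ _)

/-- An affine simplex is the image of the universal one under an affine map, and the operators
commute with such maps. Consequently identities between operators on affine chains carry over to the
realized operators. -/
lemma realize_push {j : ℕ → ℕ} (F : ∀ N n, AffChain (Simplex N) n →+ AffChain (Simplex N) (j n))
    (hF : ∀ (N N' n : ℕ) (u : Fin (N + 1) → Simplex N') (x : AffChain (Simplex N) n),
      affMap (affine (convS N') u) (F N n x) = F N' n (affMap (affine (convS N') u) x))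
    {N : ℕ} (σ : Simp N X) {n : ℕ} (x : AffChain (Simplex N) n) :
    lin ℤ (realize F) (push σ x) = push σ (F N n x) := by
  have h : ∀ v : Fin (n + 1) → Simplex N,
      realize F (σ.comp (affine (convS N) v)) = push σ (F N n (Finsupp.single v 1)) := by
    intro v
    rw [realize, push_comp_affine, hF]
    congr 2
    rw [lin_single_one]
    congr 1
    funext i
    exact affine_vert _ _ _
  rw [lin_lin]
  refine DFunLike.congr_fun (lin_hom_ext (f := lin ℤ _) (g := (push σ).comp (F N n)) fun v => ?_) x
  rw [AddMonoidHom.comp_apply, lin_single_one, lin_single_one]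
  exact h v

lemma bd_bd (n : ℕ) (x : SCh A (n + 1) X) : bd A n (bd A (n + 1) x) = 0 := by
  cases n with
  | zero => rfl
  | succ n =>
    change lin A faces (lin A faces x) = 0
    rw [lin_lin]
    have h : ∀ σ : Simp (n + 2) X, lin ℤ faces (faces σ) = 0 := fun σ => by
      rw [← lin_single_one faces, ← push_vert, faces_push, faces_push, affD_affD, map_zero]
    simp only [h]
    refine DFunLike.congr_fun (f := lin A _) (g := 0) ?_ x
    ext s a t
    simp [lin_single]

/-! #### Singular chains in subspaces -/

/-- The singular simplices with image in `U`. -/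
def simpIn (n : ℕ) (U : Set X) : Set (Simp n X) := {σ | ∀ t, σ t ∈ U}

lemma simpIn_mono {n : ℕ} {U V : Set X} (h : U ⊆ V) : simpIn n U ⊆ simpIn n V :=
  fun _ hσ t => h (hσ t)

lemma push_mem {N : ℕ} {σ : Simp N X} {U : Set X} (hσ : σ ∈ simpIn N U) {m : ℕ}
    (x : AffChain (Simplex N) m) : push σ x ∈ chainsOn ℤ (simpIn m U) :=
  lin_mem_chainsOn (P := Set.univ)
    (fun _ _ => single_mem_chainsOn (P := simpIn m U) (fun _ => hσ _) _) fun _ _ => trivial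

lemma faces_mem {n : ℕ} {σ : Simp (n + 1) X} {U : Set X} (hσ : σ ∈ simpIn (n + 1) U) :
    faces σ ∈ chainsOn ℤ (simpIn n U) :=
  sum_mem fun _ _ => AddSubgroup.zsmul_mem _
    (single_mem_chainsOn (P := simpIn n U) (fun _ => hσ _) _) _

lemma lin_mem_iUnion {κ : Type} {Y : Type} [TopologicalSpace Y] {m n : ℕ}
    {Φ : Simp n Y → SCh ℤ m X} {U : κ → Set X} {W : κ → Set Y}
    (h : ∀ k, ∀ σ ∈ simpIn n (W k), Φ σ ∈ chainsOn ℤ (simpIn m (U k))) {x : SCh A n Y}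
    (hx : x ∈ chainsOn A (⋃ k, simpIn n (W k))) : lin A Φ x ∈ chainsOn A (⋃ k, simpIn m (U k)) := by
  refine lin_mem_chainsOn (fun σ hσ => ?_) hx
  obtain ⟨k, hk⟩ := Set.mem_iUnion.1 hσ
  exact chainsOn_mono (Set.subset_iUnion_of_subset k subset_rfl) (h k σ hk)

lemma bd_mem {n : ℕ} {U : Set X} {x : SCh A n X} (hx : x ∈ chainsOn A (simpIn n U)) :
    bd A n x ∈ chainsOn A (simpIn (n - 1) U) := by
  cases n with
  | zero => exact zero_mem _
  | succ n => exact lin_mem_chainsOn (fun σ hσ => faces_mem hσ) hx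

/-! #### Barycentric subdivision of singular chains -/

/-- The barycenter of an affine simplex in a standard simplex. -/
def bary (N : ℕ) (n : ℕ) (v : Fin (n + 1) → Simplex N) : Simplex N :=
  affine (convS N) v stdSimplex.barycenter

lemma affine_bary {N N' : ℕ} (u : Fin (N + 1) → Simplex N') (n : ℕ) (v : Fin (n + 1) → Simplex N) :
    affine (convS N') u (bary N n v) = bary N' n (affine (convS N') u ∘ v) :=
  affine_affine _ _ _ _

/-- The `k`-fold barycentric subdivision of singular simplices. -/
def sd (k : ℕ) {n : ℕ} : Simp n X → SCh ℤ n X :=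
  realize (j := id) fun N n => affSdIter (bary N) n k

/-- The homotopy between `sd k` and the identity. -/
def sdT (k : ℕ) {n : ℕ} : Simp n X → SCh ℤ (n + 1) X :=
  realize (j := (· + 1)) fun N n => affTIter (bary N) n k

lemma bd_sdT_zero (k : ℕ) (x : SCh A 0 X) :
    lin A (sdT k) x = 0 ∧ lin A (sd k) x = x := by
  constructor
  · refine DFunLike.congr_fun (f := lin A _) (g := 0) ?_ x
    refine Finsupp.addHom_ext fun σ a => ?_
    rw [lin_single, sdT, realize, affTIter_zero, map_zero]
    simp
  · have h : sd (X := X) (n := 0) k = fun σ => Finsupp.single σ 1 := by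
      funext σ
      rw [sd, realize, affSdIter_zero]
      exact push_vert σ
    rw [h, lin_id]

lemma bd_sd (k : ℕ) {n : ℕ} (x : SCh A (n + 1) X) :
    bd A (n + 1) (lin A (sd k) x) = lin A (sd k) (bd A (n + 1) x) := by
  change lin A faces _ = lin A (sd k) (lin A faces x)
  rw [lin_lin, lin_lin]
  congr 2
  ext1 σ
  rw [sd, realize, faces_push, ← lin_single_one faces σ, ← push_vert, faces_push, sd,
    realize_push (fun N n => affSdIter (bary N) n k)
      fun N N' n u x => affMap_affSdIter (affine_bary u) k x]
  exact congrArg _ (affD_affSdIter (bary (n + 1)) k _)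

lemma bd_sdT (k : ℕ) {n : ℕ} (x : SCh A (n + 1) X) :
    lin A faces (lin A (sdT k) x) + lin A (sdT k) (lin A faces x) = x - lin A (sd k) x := by
  conv_rhs => rw [← lin_id x]
  rw [lin_lin, lin_lin, lin_lin, ← lin_add, ← lin_sub]
  congr 2
  ext1 σ
  rw [lin_single_one, sdT, realize, faces_push, ← lin_single_one faces σ, ← push_vert, faces_push,
    sdT, realize_push (fun N n => affTIter (bary N) n k)
      fun N N' n u x => affMap_affTIter (affine_bary u) k x]
  rw [sd, realize]
  refine (map_add (push σ) _ _).symm.trans (Eq.trans ?_ (map_sub (push σ) _ _))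
  rw [affD_affTIter]

lemma dist_affine_le {N m : ℕ} (v : Fin (m + 1) → Simplex N) (t : Simplex m) (x : Simplex N) (r : ℝ)
    (h : ∀ i, dist x (v i) ≤ r) : dist x (affine (convS N) v t) ≤ r := by
  rw [dist_comm, Subtype.dist_eq, ← Metric.mem_closedBall]
  exact (convex_closedBall x.1 r).sum_mem (fun i _ => t.2.1 i) t.2.2
    fun i _ => by rw [Metric.mem_closedBall, dist_comm]; exact h i

/-- The difference between the barycenter and a vertex is the average of the `n + 1` differences
between the vertices and this one, and one of them is zero. -/
lemma dist_bary_le {N n : ℕ} (v : Fin (n + 1) → Simplex N) (D : ℝ) (h : v ∈ meshLE _ n D)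
    (i : Fin (n + 1)) : dist (bary N n v) (v i) ≤ n / (n + 1) * D := by
  have hn : (0 : ℝ) < n + 1 := by positivity
  have e : (bary N n v).1 - (v i).1 =
      ∑ j, (n + 1 : ℝ)⁻¹ • ((v j).1 - (v i).1) := by
    simp only [smul_sub, Finset.sum_sub_distrib]
    rw [bary, affine_apply]
    congr 1
    · refine Finset.sum_congr rfl fun j _ => ?_
      congr 1
      simp [stdSimplex.barycenter]
    · rw [Finset.sum_const, Finset.card_univ, Fintype.card_fin, ← Nat.cast_smul_eq_nsmul ℝ, smul_smul]
      push_cast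
      rw [mul_inv_cancel₀ hn.ne', one_smul]
  rw [Subtype.dist_eq, dist_eq_norm, e]
  calc ‖∑ j, (n + 1 : ℝ)⁻¹ • ((v j).1 - (v i).1)‖
      ≤ ∑ j, (n + 1 : ℝ)⁻¹ * (if j = i then 0 else D) := by
        refine norm_sum_le_of_le _ fun j _ => ?_
        rw [norm_smul, Real.norm_of_nonneg (by positivity)]
        refine mul_le_mul_of_nonneg_left ?_ (by positivity)
        split_ifs with hj
        · simp [hj]
        · rw [← dist_eq_norm]; exact h j i
    _ = n / (n + 1) * D := by
        rw [← Finset.mul_sum, Finset.sum_ite, Finset.sum_const_zero, zero_add, Finset.sum_const,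
          Finset.filter_ne', Finset.card_erase_of_mem (Finset.mem_univ _), Finset.card_univ,
          Fintype.card_fin, Nat.add_sub_cancel, nsmul_eq_mul]
        field_simp

/-- A Lebesgue number of the pulled back cover of the compact simplex is eventually larger than the
mesh `(n / (n + 1)) ^ k`. Smallness for all large `k` is recorded so that finitely many simplices
can share one `k`. -/
lemma exists_sd_small {ι : Type} {O : ι → Set X} (hO : ∀ i, IsOpen (O i)) {n : ℕ} {σ : Simp n X}
    (hσ : σ ∈ simpIn n (⋃ i, O i)) :
    ∃ k₀, ∀ k ≥ k₀, sd k σ ∈ chainsOn ℤ (⋃ i, simpIn n (O i)) := by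
  obtain ⟨δ, hδ, h⟩ := lebesgue_number_lemma_of_metric (isCompact_univ (X := Simplex n))
    (fun i => (hO i).preimage σ.continuous) (fun t _ => by simpa using hσ t)
  obtain ⟨k₀, hk₀⟩ := exists_pow_lt_of_lt_one hδ
    (show (n : ℝ) / (n + 1) < 1 by rw [div_lt_one (by positivity)]; linarith)
  refine ⟨k₀, fun k hk => ?_⟩
  -- The standard simplex has diameter at most `1`, which is the initial mesh.
  have hv : vert n ∈ meshLE (Simplex n) n 1 := fun i j =>
    (Metric.dist_le_diam_of_mem (bounded_stdSimplex _) (vert n i).2 (vert n j).2).trans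
      diam_stdSimplex_le
  refine lin_mem_chainsOn (fun w hw => ?_) (affSdIter_mem_meshLE (bary n)
    (fun m v D hv i => dist_bary_le v D hv i) (fun m v x r hx => dist_affine_le v _ x r hx)
    _ 1 zero_le_one hv k)
  obtain ⟨i, hi⟩ := h (w 0) trivial
  have hmem : σ.comp (affine (convS n) w) ∈ simpIn n (O i) := by
    intro t
    refine hi (show affine (convS n) w t ∈ Metric.ball _ _ from ?_)
    rw [Metric.mem_ball, dist_comm]
    refine (dist_affine_le w t _ _ (hw 0)).trans_lt ?_
    rw [mul_one]
    exact (pow_le_pow_of_le_one (by positivity)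
      (by rw [div_le_one (by positivity)]; linarith) hk).trans_lt hk₀
  exact single_mem_chainsOn (Set.mem_iUnion.2 ⟨i, hmem⟩) _

lemma exists_lin_sd_small {ι : Type} {O : ι → Set X} (hO : ∀ i, IsOpen (O i)) {n : ℕ} {U : Set X}
    (hU : U ⊆ ⋃ i, O i) {x : SCh A n X} (hx : x ∈ chainsOn A (simpIn n U)) :
    ∃ k, lin A (sd k) x ∈ chainsOn A (⋃ i, simpIn n (O i ∩ U)) := by
  -- The eventual form is stable under sums, since the maximum of two thresholds serves both
  -- summands.
  suffices h : ∃ k₀, ∀ k ≥ k₀, lin A (sd k) x ∈ chainsOn A (⋃ i, simpIn n (O i ∩ U)) by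
    obtain ⟨k, hk⟩ := h
    exact ⟨k, hk k le_rfl⟩
  refine chainsOn_induction (C := fun x => ∃ k₀, ∀ k ≥ k₀,
    lin A (sd k) x ∈ chainsOn A (⋃ i, simpIn n (O i ∩ U))) ⟨0, fun k _ => ?_⟩ ?_ ?_ hx
  · rw [map_zero]; exact zero_mem _
  · rintro x y ⟨k, hk⟩ ⟨l, hl⟩
    refine ⟨max k l, fun m hm => ?_⟩
    rw [map_add]
    exact add_mem (hk m (le_of_max_le_left hm)) (hl m (le_of_max_le_right hm))
  · intro σ hσ a
    obtain ⟨k₀, hk₀⟩ := exists_sd_small hO (simpIn_mono hU hσ)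
    refine ⟨k₀, fun k hk => ?_⟩
    have h1 : sd k σ ∈ chainsOn ℤ (simpIn n U) := push_mem hσ _
    rw [lin_single]
    refine mapRange_mem_chainsOn (zmultiplesHom A a) (chainsOn_mono ?_ (mem_chainsOn_inter (hk₀ k hk) h1))
    rintro τ ⟨h, h'⟩
    obtain ⟨i, hi⟩ := Set.mem_iUnion.1 h
    exact Set.mem_iUnion.2 ⟨i, fun t => ⟨hi t, h' t⟩⟩

/-! #### Homotopies -/

/-- The singular chain in the target of a homotopy defined by a singular simplex and a chain of
affine simplices in the prism. -/
abbrev pushH (H : C(unitInterval × Y, X)) {N : ℕ} (σ : Simp N Y) {m : ℕ} :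
    AffChain (Simplex N × unitInterval) m →+ SCh ℤ m X :=
  lin ℤ fun v => Finsupp.single (H.comp ((affine (convex_Icc (0 : ℝ) 1) (Prod.snd ∘ v)).prodMk
    (σ.comp (affine (convS N) (Prod.fst ∘ v))))) 1

/-- The prism operator of a homotopy. -/
def prism (H : C(unitInterval × Y, X)) {n : ℕ} (σ : Simp n Y) : SCh ℤ (n + 1) X :=
  pushH H σ (affPrism 0 1 (vert n))

/-- The map at time `s` of a homotopy. -/
def timeMap (H : C(unitInterval × Y, X)) (s : unitInterval) : C(Y, X) :=
  H.comp ((ContinuousMap.const _ s).prodMk (ContinuousMap.id _))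

lemma faces_pushH (H : C(unitInterval × Y, X)) {N : ℕ} (σ : Simp N Y) {m : ℕ}
    (x : AffChain (Simplex N × unitInterval) (m + 1)) :
    lin ℤ faces (pushH H σ x) = pushH H σ (affD x) := by
  refine DFunLike.congr_fun (lin_hom_ext (f := (lin ℤ faces).comp (pushH H σ))
    (g := (pushH H σ).comp affD) fun v => ?_) x
  simp only [AddMonoidHom.comp_apply, lin_single_one, faces, affFaces_eq, map_sum, map_zsmul]
  refine Finset.sum_congr rfl fun i _ => ?_
  congr 2
  ext t
  change H (_, σ _) = H (_, σ _)
  congr 2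
  · exact DFunLike.congr_fun (affine_faceMap (convex_Icc (0 : ℝ) 1) (Prod.snd ∘ v) i) t
  · exact congrArg σ (DFunLike.congr_fun (affine_faceMap (convS N) (Prod.fst ∘ v) i) t)

lemma prism_push (H : C(unitInterval × Y, X)) {N : ℕ} (σ : Simp N Y) {n : ℕ}
    (x : AffChain (Simplex N) n) :
    lin ℤ (prism H) (push σ x) = pushH H σ (lin ℤ (affPrism 0 1) x) := by
  rw [lin_lin]
  refine DFunLike.congr_fun (lin_hom_ext (f := lin ℤ _)
    (g := (pushH H σ).comp (lin ℤ (affPrism 0 1))) fun v => ?_) x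
  rw [AddMonoidHom.comp_apply, lin_single_one, lin_single_one, lin_single_one, prism]
  have h := affMap_affPrism (0 : unitInterval) 1 (affine (convS N) v) (Finsupp.single (vert n) 1)
  rw [lin_single_one, lin_single_one,
    show affine (convS N) v ∘ vert n = v from funext fun i => affine_vert _ _ _, lin_single_one] at h
  rw [← h, lin_lin]
  refine DFunLike.congr_fun (lin_hom_ext fun w => ?_) _
  rw [lin_single_one, lin_single_one, lin_single_one]
  congr 1
  ext t
  change H (_, σ _) = H (_, σ _)
  congr 2
  exact congrArg σ (affine_affine _ _ _ _)

lemma affMap_vert (N : ℕ) (s : unitInterval) :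
    affMap (fun v => (v, s)) (Finsupp.single (vert N) 1) =
      Finsupp.single (fun i => (vert N i, s)) 1 := lin_single_one _ _

lemma pushH_const (H : C(unitInterval × Y, X)) {N : ℕ} (σ : Simp N Y) (s : unitInterval) :
    pushH H σ (Finsupp.single (fun i => (vert N i, s)) 1) =
      Finsupp.single ((timeMap H s).comp σ) 1 := by
  rw [lin_single_one]
  congr 1
  ext t
  change H (_, σ _) = H (_, σ _)
  congr 2
  · apply Subtype.ext
    rw [affine_apply]
    simp only [Function.comp_apply, ← Finset.sum_smul]
    rw [t.2.2, one_smul]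
    rfl
  · exact congrArg σ (affine_self _ _)

lemma bd_prism (H : C(unitInterval × Y, X)) {n : ℕ} (x : SCh A (n + 1) Y) :
    lin A faces (lin A (prism H) x) + lin A (prism H) (lin A faces x) =
      chMap A (timeMap H 1) x - chMap A (timeMap H 0) x := by
  rw [lin_lin, lin_lin, ← lin_add, ← lin_sub]
  congr 2
  ext1 σ
  rw [prism, faces_pushH, ← lin_single_one faces σ, ← push_vert, faces_push, prism_push,
    ← lin_single_one (affPrism 0 1), ← map_add, affD_affPrism, map_sub, affMap_vert, affMap_vert,
    pushH_const, pushH_const]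

lemma bd_prism_zero (H : C(unitInterval × Y, X)) (x : SCh A 0 Y) :
    lin A faces (lin A (prism H) x) = chMap A (timeMap H 1) x - chMap A (timeMap H 0) x := by
  rw [lin_lin, ← lin_sub]
  congr 2
  ext1 σ
  rw [prism, faces_pushH, ← lin_single_one (affPrism 0 1), affD_affPrism_zero, map_sub, affMap_vert, affMap_vert,
    pushH_const, pushH_const]

lemma prism_mem {H : C(unitInterval × Y, X)} {W : Set Y} {U : Set X}
    (h : ∀ s, ∀ y ∈ W, H (s, y) ∈ U) {n : ℕ} {σ : Simp n Y} (hσ : σ ∈ simpIn n W) :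
    prism H σ ∈ chainsOn ℤ (simpIn (n + 1) U) :=
  lin_mem_chainsOn (P := Set.univ)
    (fun _ _ => single_mem_chainsOn (P := simpIn _ U) (fun _ => h _ _ (hσ _)) _) fun _ _ => trivial

lemma chMap_mem {f : C(Y, X)} {W : Set Y} {U : Set X} (h : ∀ y ∈ W, f y ∈ U) {n : ℕ} {x : SCh A n Y}
    (hx : x ∈ chainsOn A (simpIn n W)) : chMap A f x ∈ chainsOn A (simpIn n U) :=
  lin_mem_chainsOn (P := simpIn n W)
    (fun _ hσ => single_mem_chainsOn (P := simpIn n U) (fun t => h _ (hσ t)) _) hx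

lemma exists_chMap_eq {U : Set X} {n : ℕ} {x : SCh A n X} (hx : x ∈ chainsOn A (simpIn n U)) :
    ∃ y : SCh A n U, chMap A ⟨Subtype.val, continuous_subtype_val⟩ y = x := by
  refine chainsOn_induction (C := fun x => ∃ y : SCh A n U,
    chMap A ⟨Subtype.val, continuous_subtype_val⟩ y = x) ⟨0, map_zero _⟩ ?_ ?_ hx
  · rintro _ _ ⟨y, rfl⟩ ⟨z, rfl⟩
    exact ⟨y + z, map_add _ _ _⟩
  · intro σ hσ a
    refine ⟨Finsupp.single ⟨fun t => ⟨σ t, hσ t⟩, by fun_prop⟩ a, ?_⟩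
    rw [lin_single, Finsupp.mapRange_single, one_smul]
    rfl

end Singular
end GCW

end

noncomputable section
namespace GCW

/-! ## Small chains and excision -/

section Excision

variable {A : Type} [AddCommGroup A] {X Y : Type} [TopologicalSpace X] [TopologicalSpace Y]

lemma chMap_eq_mapDomain (f : C(X, Y)) {n : ℕ} (x : SCh A n X) :
    chMap A f x = x.mapDomain f.comp := by
  refine DFunLike.congr_fun (f := chMap A f) (g := Finsupp.mapDomain.addMonoidHom f.comp) ?_ x
  refine Finsupp.addHom_ext fun σ a => ?_
  rw [lin_single, Finsupp.mapRange_single, one_smul]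
  simp

lemma chMap_comp {Z : Type} [TopologicalSpace Z] (f : C(X, Y)) (g : C(Y, Z)) {n : ℕ}
    (x : SCh A n X) : chMap A g (chMap A f x) = chMap A (g.comp f) x := by
  rw [lin_lin]
  congr 2
  ext1 σ
  rw [lin_single_one]
  rfl

/-- Composition with an injective map is injective on simplices, so no coefficients cancel and the
support can be read off from the image. -/
lemma mem_chainsOn_of_chMap_mem {f : C(X, Y)} (hf : Function.Injective f) {n : ℕ} {x : SCh A n X}
    {P : Set (Simp n Y)} (h : chMap A f x ∈ chainsOn A P) : x ∈ chainsOn A {σ | f.comp σ ∈ P} := by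
  intro σ hσ
  refine h _ ?_
  rw [chMap_eq_mapDomain, Finsupp.mapDomain_apply]
  · exact hσ
  · intro a b hab
    ext t
    exact hf (DFunLike.congr_fun hab t)

/-- The inclusion of a subspace. -/
abbrev incl (U : Set X) : C(U, X) := ⟨Subtype.val, continuous_subtype_val⟩

/-- Every singular cycle of `U` relative to the chains that are small with respect to the family
`W` is homologous in `U` to a small chain. -/
def AcyclicMod (A : Type) [AddCommGroup A] {κ : Type} (U : Set X) (W : κ → Set X) (m : ℕ) : Prop :=
  ∀ z ∈ chainsOn A (simpIn m U), bd A m z ∈ chainsOn A (⋃ k, simpIn (m - 1) (W k)) →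
    ∃ w ∈ chainsOn A (simpIn (m + 1) U), z - lin A faces w ∈ chainsOn A (⋃ k, simpIn m (W k))

/-- Subdivision makes the chain small with respect to the open cover `O`; the end of the homotopy
then carries it into the family `W`. Subdivision and prism operators both respect each `W k`, so the
boundary stays small throughout. The sets `W k` themselves need not be open. -/
lemma acyclicMod_of_homotopy {ι κ : Type} {U : Set X} {W : κ → Set X} {O : ι → Set X}
    (H : C(unitInterval × U, X)) (h0 : ∀ y, H (0, y) = y.1) (hU : ∀ s y, H (s, y) ∈ U)
    (hW : ∀ k s (y : U), y.1 ∈ W k → H (s, y) ∈ W k) (hO : ∀ i, IsOpen (O i)) (hUO : U ⊆ ⋃ i, O i)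
    (h1 : ∀ i, ∃ k, ∀ y : U, y.1 ∈ O i → H (1, y) ∈ W k) (m : ℕ) : AcyclicMod A U W m := by
  intro z hz hbz
  obtain ⟨k, hk⟩ := exists_lin_sd_small hO hUO hz
  have hsd : lin A (sd k) z ∈ chainsOn A (simpIn m U) :=
    lin_mem_chainsOn (fun σ hσ => push_mem hσ _) hz
  obtain ⟨y, hy⟩ := exists_chMap_eq hsd
  have hi : Function.Injective (incl U) := Subtype.val_injective
  have e0 : timeMap H 0 = incl U := by
    ext y; exact h0 y
  have hyO : chMap A (timeMap H 1) y ∈ chainsOn A (⋃ k, simpIn m (W k)) := by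
    rw [← hy] at hk
    refine lin_mem_chainsOn (fun σ hσ => ?_) (mem_chainsOn_of_chMap_mem hi hk)
    obtain ⟨i, hσi⟩ := Set.mem_iUnion.1 hσ
    obtain ⟨k, hk⟩ := h1 i
    exact single_mem_chainsOn (Set.mem_iUnion.2 ⟨k, show _ ∈ simpIn m (W k) from
      fun t => hk _ (hσi t).1⟩) _
  have hP : lin A (prism H) y ∈ chainsOn A (simpIn (m + 1) U) :=
    lin_mem_chainsOn (P := Set.univ)
      (fun σ _ => prism_mem (W := Set.univ) (fun s y _ => hU s y) fun _ => trivial)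
      fun _ _ => trivial
  cases m with
  | zero =>
    rw [(bd_sdT_zero k z).2] at hy
    refine ⟨- lin A (prism H) y, neg_mem hP, ?_⟩
    rw [map_neg, bd_prism_zero, e0, hy]
    simpa using hyO
  | succ m =>
    -- With `y` the subdivision of `z`, the two homotopy formulas turn `z - ∂w` into the end of the
    -- homotopy applied to `y` plus the two operators applied to `∂z` and `∂y`, and all three terms
    -- are small.
    refine ⟨lin A (sdT k) z - lin A (prism H) y,
      sub_mem (lin_mem_chainsOn (fun σ hσ => push_mem hσ _) hz) hP, ?_⟩
    have e1 := bd_sdT k z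
    have e2 := bd_prism H y
    rw [e0, hy] at e2
    have e3 : z - lin A faces (lin A (sdT k) z - lin A (prism H) y) =
        chMap A (timeMap H 1) y + lin A (sdT k) (lin A faces z) -
          lin A (prism H) (lin A faces y) := by
      rw [map_sub, eq_sub_of_add_eq e1, eq_sub_of_add_eq e2]
      abel
    rw [e3]
    have hby : lin A faces y ∈ chainsOn A (⋃ k, simpIn m (Subtype.val ⁻¹' W k : Set U)) := by
      have h := bd_chMap (A := A) (incl U) y
      rw [hy, bd_sd] at h
      have h' : chMap A (incl U) (bd A (m + 1) y) ∈ chainsOn A (⋃ k, simpIn m (W k)) := by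
        rw [← h]
        exact lin_mem_iUnion (fun k σ hσ => push_mem hσ _) hbz
      refine chainsOn_mono ?_ (mem_chainsOn_of_chMap_mem hi h')
      intro σ hσ
      obtain ⟨k, hk⟩ := Set.mem_iUnion.1 hσ
      exact Set.mem_iUnion.2 ⟨k, hk⟩
    refine sub_mem (add_mem hyO (lin_mem_iUnion (fun k σ hσ => push_mem hσ _) hbz)) ?_
    exact lin_mem_iUnion (fun k σ hσ => prism_mem (fun s y hy => hW k s y hy) hσ) hby

/-! #### Decomposition of relative homology -/

/-- The relative cycles of a pair. -/
def IsRelCycle (U V : Set X) {m : ℕ} (z : SCh A m X) : Prop :=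
  z ∈ chainsOn A (simpIn m U) ∧ bd A m z ∈ chainsOn A (simpIn (m - 1) V)

/-- The relative boundaries of a pair. -/
def IsRelBoundary (U V : Set X) {m : ℕ} (z : SCh A m X) : Prop :=
  ∃ w ∈ chainsOn A (simpIn (m + 1) U), z - lin A faces w ∈ chainsOn A (simpIn m V)

lemma bd_faces {n : ℕ} (w : SCh A (n + 1) X) : bd A n (lin A faces w) = 0 := bd_bd n w

/-- At a simplex in the support of `x k`, either another summand is also nonzero, so the simplex
lies in an intersection `P k ∩ P j`, or the sum has the same coefficient there and the simplex lies
in `Q`. -/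
lemma mem_chainsOn_of_sum_mem {κ S : Type} [Fintype κ] {P R : κ → Set S} {Q : Set S}
    (hQ : ∀ k, P k ∩ Q ⊆ R k) (hP : ∀ k j, j ≠ k → P k ∩ P j ⊆ R k) {x : κ → (S →₀ A)}
    (hx : ∀ k, x k ∈ chainsOn A (P k)) (hs : ∑ k, x k ∈ chainsOn A Q) (k : κ) :
    x k ∈ chainsOn A (R k) := by
  classical
  intro s hsk
  by_cases h : ∃ j, j ≠ k ∧ x j s ≠ 0
  · obtain ⟨j, hj, hjs⟩ := h
    exact hP k j hj ⟨hx k s hsk, hx j s hjs⟩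
  · push Not at h
    refine hQ k ⟨hx k s hsk, hs s ?_⟩
    rw [Finsupp.finsetSum_apply, Finset.sum_eq_single k (fun j _ hj => h j hj)
      fun h => absurd (Finset.mem_univ _) h]
    exact hsk

lemma simpIn_inter (n : ℕ) (U V : Set X) : simpIn n U ∩ simpIn n V = simpIn n (U ∩ V) := by
  ext σ
  exact ⟨fun h t => ⟨h.1 t, h.2 t⟩, fun h => ⟨fun t => (h t).1, fun t => (h t).2⟩⟩

/-- The family consisting of `V` and the members of the family `W`. -/
abbrev consFam {κ : Type} (V : Set X) (W : κ → Set X) : Option κ → Set X := fun o => o.elim V W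

section

variable {κ : Type} [Fintype κ] {U V : Set X} {W : κ → Set X}

lemma sum_bd_mem {m : ℕ} {a : κ → SCh A m X} (hd : ∀ i j, j ≠ i → W i ∩ W j ⊆ V)
    (ha : ∀ k, a k ∈ chainsOn A (simpIn m (W k))) (h : ∑ k, a k ∈ chainsOn A (simpIn m V)) (k : κ) :
    a k ∈ chainsOn A (simpIn m (W k ∩ V)) := by
  refine mem_chainsOn_of_sum_mem (P := fun k => simpIn m (W k))
    (R := fun k => simpIn m (W k ∩ V)) (fun k => ?_) (fun k j hj => ?_)
    ha h k
  · rw [simpIn_inter]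
  · rw [simpIn_inter]
    exact simpIn_mono fun x hx => ⟨hx.1, hd k j hj hx⟩

/-- Surjectivity of `⨁ H(W k, W k ∩ V) → H(U, V)`. A small representative splits into pieces; the
sum of their boundaries lies in `V`, and since the `W k` meet pairwise inside `V`, so does every
single boundary. -/
lemma exists_sum_isRelCycle {m : ℕ} (hd : ∀ i j, j ≠ i → W i ∩ W j ⊆ V) (h : AcyclicMod A U (consFam V W) m) {z : SCh A m X}
    (hz : IsRelCycle U V z) :
    ∃ a : κ → SCh A m X, (∀ k, IsRelCycle (W k) (W k ∩ V) (a k)) ∧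
      IsRelBoundary U V (z - ∑ k, a k) := by
  obtain ⟨w, hw, hw'⟩ := h z hz.1 (chainsOn_mono (Set.subset_iUnion_of_subset none subset_rfl) hz.2)
  obtain ⟨y, hy, hs⟩ := exists_sum_of_mem_chainsOn_iUnion hw'
  rw [Fintype.sum_option] at hs
  refine ⟨fun k => y (some k), fun k => ⟨hy (some k), ?_⟩, w, hw, ?_⟩
  · refine sum_bd_mem hd (a := fun k => bd A m (y (some k))) (fun k => bd_mem (hy (some k))) ?_ k
    rw [← map_sum, eq_sub_of_add_eq' hs, map_sub, map_sub, bd_faces, sub_zero]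
    exact sub_mem hz.2 (bd_mem (hy none))
  · rw [sub_right_comm, ← hs, add_sub_cancel_right]
    exact hy none

/-- Injectivity of the same map: a chain bounding the sum is replaced by a small one and then split
into pieces that bound the summands. -/
lemma isRelBoundary_of_sum {m : ℕ} (hd : ∀ i j, j ≠ i → W i ∩ W j ⊆ V) (h : AcyclicMod A U (consFam V W) (m + 1))
    {a : κ → SCh A m X} (ha : ∀ k, a k ∈ chainsOn A (simpIn m (W k)))
    (hs : IsRelBoundary U V (∑ k, a k)) (k : κ) : IsRelBoundary (W k) (W k ∩ V) (a k) := by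
  obtain ⟨y, hy, hyv⟩ := hs
  have hby : bd A (m + 1) y ∈ chainsOn A (⋃ k, simpIn m (consFam V W k)) := by
    have e : bd A (m + 1) y = ∑ k, a k - (∑ k, a k - lin A faces y) := by
      rw [sub_sub_cancel]; rfl
    rw [e]
    refine sub_mem (sum_mem fun k _ => ?_)
      (chainsOn_mono (Set.subset_iUnion_of_subset none subset_rfl) hyv)
    exact chainsOn_mono (Set.subset_iUnion_of_subset (some k) subset_rfl) (ha k)
  -- The bounding chain `y` is itself a cycle modulo small chains, one degree higher. Subtracting
  -- the boundary of `x` makes it small without changing its boundary.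
  obtain ⟨x, hx, hx'⟩ := h y hy hby
  obtain ⟨b, hb, hbs⟩ := exists_sum_of_mem_chainsOn_iUnion hx'
  rw [Fintype.sum_option] at hbs
  refine ⟨b (some k), hb (some k), ?_⟩
  refine sum_bd_mem hd (a := fun k => a k - lin A faces (b (some k)))
    (fun k => sub_mem (ha k) (bd_mem (hb (some k)))) ?_ k
  have e : lin A faces y = lin A faces (b none) + ∑ k, lin A faces (b (some k)) := by
    have := congrArg (lin A faces) hbs
    rw [map_add, map_sum, map_sub] at this
    rw [this, show lin A faces (lin A faces x) = 0 from bd_bd (m + 1) x, sub_zero]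
  rw [Finset.sum_sub_distrib]
  have e' : ∑ k, a k - ∑ k, lin A faces (b (some k)) =
      (∑ k, a k - lin A faces y) + lin A faces (b none) := by rw [e]; abel
  rw [e']
  exact add_mem hyv (bd_mem (hb none))

end

/-! #### Vanishing of relative homology -/

/-- The vanishing of the relative homology of a pair. -/
def AcyclicPair (A : Type) [AddCommGroup A] (U V : Set X) (m : ℕ) : Prop :=
  ∀ z : SCh A m X, IsRelCycle U V z → IsRelBoundary U V z

lemma AcyclicMod.acyclicPair {U V : Set X} {m : ℕ} (h : AcyclicMod A U (fun _ : Unit => V) m) :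
    AcyclicPair A U V m := by
  intro z hz
  obtain ⟨w, hw, hw'⟩ := h z hz.1 (chainsOn_mono (Set.subset_iUnion_of_subset () subset_rfl) hz.2)
  exact ⟨w, hw, chainsOn_mono (Set.iUnion_subset fun _ => subset_rfl) hw'⟩

/-- Only the composite `i ∘ r` has to be homotopic, through maps of pairs, to the inclusion: a cycle
is then homologous to its image under `i ∘ r`, which bounds because its image under `r` does. -/
lemma acyclicPair_of_homotopy {U V : Set X} (H : C(unitInterval × U, X)) (h0 : ∀ y, H (0, y) = y.1)
    (hU : ∀ s y, H (s, y) ∈ U) (hV : ∀ s (y : U), y.1 ∈ V → H (s, y) ∈ V) {V' : Set Y}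
    (r : C(U, Y)) (i : C(Y, X)) (hr : ∀ y : U, y.1 ∈ V → r y ∈ V') (hi : ∀ y, i y ∈ U)
    (hi' : ∀ y ∈ V', i y ∈ V) (h1 : ∀ y, H (1, y) = i (r y)) {m : ℕ}
    (h : AcyclicPair A (Set.univ : Set Y) V' m) : AcyclicPair A U V m := by
  intro z hz
  obtain ⟨y, hy⟩ := exists_chMap_eq hz.1
  have e0 : timeMap H 0 = incl U := by
    ext y; exact h0 y
  have e1 : timeMap H 1 = i.comp r := by
    ext y; exact h1 y
  have hby : bd A m y ∈ chainsOn A (simpIn (m - 1) (Subtype.val ⁻¹' V : Set U)) := by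
    have h' : chMap A (incl U) (bd A m y) ∈ chainsOn A (simpIn (m - 1) V) := by
      rw [← bd_chMap, hy]; exact hz.2
    exact mem_chainsOn_of_chMap_mem Subtype.val_injective h'
  obtain ⟨w, hw, hw'⟩ := h (chMap A r y) ⟨fun _ _ _ => trivial, by
    rw [bd_chMap]; exact chMap_mem hr hby⟩
  have hP : lin A (prism H) y ∈ chainsOn A (simpIn (m + 1) U) :=
    lin_mem_chainsOn (P := Set.univ)
      (fun σ _ => prism_mem (W := Set.univ) (fun s y _ => hU s y) fun _ => trivial)
      fun _ _ => trivial
  have hiw : chMap A i w ∈ chainsOn A (simpIn (m + 1) U) := chMap_mem (fun y _ => hi y) hw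
  have hiw' : chMap A (i.comp r) y - lin A faces (chMap A i w) ∈ chainsOn A (simpIn m V) := by
    have e : lin A faces (chMap A i w) = chMap A i (lin A faces w) := bd_chMap (n := m + 1) i w
    rw [e, ← chMap_comp, ← map_sub]
    exact chMap_mem hi' hw'
  refine ⟨chMap A i w - lin A (prism H) y, sub_mem hiw hP, ?_⟩
  cases m with
  | zero =>
    have e2 := bd_prism_zero H y
    rw [e0, e1, hy] at e2
    rw [map_sub, e2]
    convert hiw' using 1
    abel
  | succ m =>
    have e2 := bd_prism H y
    rw [e0, e1, hy] at e2
    have h3 : lin A (prism H) (lin A faces y) ∈ chainsOn A (simpIn (m + 1) V) :=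
      lin_mem_chainsOn (fun σ hσ => prism_mem (fun s y hy => hV s y hy) hσ) hby
    rw [map_sub, eq_sub_of_add_eq e2]
    convert sub_mem hiw' h3 using 1
    abel

lemma acyclicPair_of_maps {U V : Set X} {V' : Set Y} (r : C(U, Y)) (i : C(Y, X))
    (hr : ∀ y : U, y.1 ∈ V → r y ∈ V') (hi : ∀ y, i y ∈ U) (hi' : ∀ y ∈ V', i y ∈ V)
    (h1 : ∀ y : U, i (r y) = y) {m : ℕ} (h : AcyclicPair A (Set.univ : Set Y) V' m) :
    AcyclicPair A U V m :=
  acyclicPair_of_homotopy ((incl U).comp ContinuousMap.snd) (fun _ => rfl) (fun _ y => y.2)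
    (fun _ _ hy => hy) r i hr hi hi' (fun y => (h1 y).symm) h

end Excision
end GCW

end

noncomputable section
namespace GCW

/-! ## Local homology of Euclidean space -/

section Euclidean

variable {A : Type} [AddCommGroup A] {Y : Type} [TopologicalSpace Y]

lemma faces_of_unique [Unique Y] {m : ℕ} (σ : Simp (m + 1) Y) :
    faces σ = (if Even m then 0 else 1 : ℤ) • Finsupp.single (ContinuousMap.const _ default) (1 : ℤ) := by
  have h : ∀ i, σ.comp (faceMap i) = ContinuousMap.const _ default := fun i => by
    ext t; exact Subsingleton.elim _ _
  simp only [faces, h, ← Finset.sum_smul]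
  congr 1
  have := Fin.sum_neg_one_pow ℤ (m + 2)
  rw [this]
  simp [Nat.even_add_one, parity_simps]

lemma acyclicPair_of_unique [Unique Y] {m : ℕ} (hm : m ≠ 0) :
    AcyclicPair A (Set.univ : Set Y) ∅ m := by
  obtain ⟨m, rfl⟩ := Nat.exists_eq_succ_of_ne_zero hm
  have hc : ∀ {n : ℕ} (σ : Simp n Y), σ = ContinuousMap.const _ default := fun σ => by
    ext t; exact Subsingleton.elim _ _
  intro z hz
  obtain ⟨a, rfl⟩ : ∃ a, z = Finsupp.single (ContinuousMap.const _ default) a :=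
    ⟨z (ContinuousMap.const _ default), by
      ext σ; rw [hc σ, Finsupp.single_eq_same]⟩
  by_cases h : Even m
  · refine ⟨Finsupp.single (ContinuousMap.const _ default) a, fun _ _ _ => trivial, ?_⟩
    rw [lin_single, faces_of_unique, if_neg (by simpa [Nat.even_add_one] using h), one_smul,
      Finsupp.mapRange_single, one_smul, sub_self]
    exact zero_mem _
  · refine ⟨0, zero_mem _, ?_⟩
    have h2 := hz.2
    change lin A faces _ ∈ chainsOn A (simpIn m ∅) at h2
    rw [lin_single, faces_of_unique, if_neg h, one_smul,
      Finsupp.mapRange_single, one_smul] at h2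
    have ha : a = 0 := by
      by_contra ha
      exact h2 (ContinuousMap.const _ default) (by simpa using ha) (stdSimplex.vertex 0)
    rw [ha, Finsupp.single_zero, map_zero, sub_zero]
    exact zero_mem _

variable (Y) in
/-- Moving the first coordinate to `c`. -/
def slide (c : ℝ) : C(unitInterval × (ℝ × Y), ℝ × Y) :=
  ⟨fun x => ((1 - x.1.1) * x.2.1 + x.1.1 * c, x.2.2), by fun_prop⟩

/-- Suspension isomorphism for local homology. The complement of the point is `P ∪ Q`, the union of
the complements of the two closed half-lines over `y₀`. Sliding the first coordinate shows that `ℝ ×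
Y` has no homology relative to `Q` and that `(P, P ∩ Q)` has the homology of `Y` relative to the
complement of `y₀`; the degree drops by one in between. -/
lemma acyclicPair_prod [T1Space Y] (y₀ : Y) {m : ℕ}
    (h : ∀ k, k + 1 = m → AcyclicPair A (Set.univ : Set Y) {y₀}ᶜ k) :
    AcyclicPair A (Set.univ : Set (ℝ × Y)) {(0, y₀)}ᶜ m := by
  set P : Set (ℝ × Y) := {x | x.2 ≠ y₀ ∨ 0 < x.1} with hPdef
  set Q : Set (ℝ × Y) := {x | x.2 ≠ y₀ ∨ x.1 < 0} with hQdef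
  have hc : IsOpen {x : ℝ × Y | x.2 ≠ y₀} := isOpen_compl_singleton.preimage continuous_snd
  have hPo : IsOpen P := hc.union (isOpen_lt continuous_const continuous_fst)
  have hQo : IsOpen Q := hc.union (isOpen_lt continuous_fst continuous_const)
  have hPQ : ({(0, y₀)}ᶜ : Set (ℝ × Y)) = P ∪ Q := by
    ext ⟨t, y⟩
    simp only [Set.mem_compl_iff, Set.mem_singleton_iff, Prod.mk.injEq, Set.mem_union, hPdef, hQdef,
      Set.mem_ofPred_eq]
    have := lt_trichotomy t 0
    grind
  -- Sliding the first coordinate to `-1` preserves `Q` and ends inside `Q`.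
  have hEQ : ∀ n, AcyclicPair A (Set.univ : Set (ℝ × Y)) Q n := fun n => by
    refine (acyclicMod_of_homotopy (U := Set.univ) (W := fun _ : Unit => Q) (ι := Unit) (O := fun _ => Set.univ)
      ((slide Y (-1)).comp (ContinuousMap.prodMap (ContinuousMap.id _) (incl _)))
      (fun y => ?_) (fun _ _ => trivial) (fun _ s y hy => ?_) (fun _ => isOpen_univ)
      (fun _ _ => Set.mem_iUnion.2 ⟨(), trivial⟩) (fun _ => ⟨(), fun y _ => ?_⟩) n).acyclicPair
    · simp [slide]
    · rcases hy with hy | hy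
      · exact Or.inl hy
      · refine Or.inr ?_
        change (1 - s.1) * y.1.1 + s.1 * (-1) < 0
        rcases s.2.2.eq_or_lt with hs | hs
        · rw [hs]; norm_num
        · nlinarith [s.2.1, mul_neg_of_pos_of_neg (sub_pos.2 hs) hy]
    · refine Or.inr ?_
      simp [slide]
  intro z hz
  rw [hPQ] at hz ⊢
  cases m with
  | zero =>
    obtain ⟨w, hw, hw'⟩ := hEQ 0 z ⟨hz.1, zero_mem _⟩
    exact ⟨w, hw, chainsOn_mono (simpIn_mono Set.subset_union_right) hw'⟩
  | succ m =>
    -- Sliding to `1` preserves `P` and `P ∩ Q` and retracts them to the slice over `1`; a point of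
    -- both `P` and `Q` has second coordinate different from `y₀`.
    have hPacyc : AcyclicPair A P (P ∩ Q) m := by
      refine acyclicPair_of_homotopy
        ((slide Y 1).comp (ContinuousMap.prodMap (ContinuousMap.id _) (incl _)))
        (fun y => ?_) (fun s y => ?_) (fun s y hy => ?_) ⟨fun y => y.1.2, by fun_prop⟩
        ⟨fun y => (1, y), by fun_prop⟩ (V' := {y₀}ᶜ) (fun y hy => ?_) (fun y => ?_) (fun y hy => ?_)
        (fun y => ?_) (h m rfl)
      · simp [slide]
      · rcases y.2 with hy | hy
        · exact Or.inl hy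
        · refine Or.inr ?_
          change 0 < (1 - s.1) * y.1.1 + s.1 * 1
          rcases s.2.2.eq_or_lt with hs | hs
          · rw [hs]; norm_num
          · nlinarith [s.2.1, mul_pos (sub_pos.2 hs) hy]
      · have hy2 : y.1.2 ≠ y₀ := by
          rcases hy with ⟨h1 | h1, h2 | h2⟩
          · exact h1
          · exact h1
          · exact h2
          · exact absurd h1 (not_lt.2 (le_of_lt h2))
        exact ⟨Or.inl hy2, Or.inl hy2⟩
      · rcases hy with ⟨h1 | h1, h2 | h2⟩
        · exact h1
        · exact h1
        · exact h2
        · exact absurd h1 (not_lt.2 (le_of_lt h2))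
      · exact Or.inr one_pos
      · exact ⟨Or.inl hy, Or.inl hy⟩
      · simp [slide]
    have hcov : P ∪ Q ⊆ ⋃ i : Bool, cond i P Q := by
      rintro x (hx | hx)
      · exact Set.mem_iUnion.2 ⟨true, hx⟩
      · exact Set.mem_iUnion.2 ⟨false, hx⟩
    -- The subdivided boundary splits into parts in `P` and `Q`. Their sum is a cycle, so the part
    -- in `P` is a cycle relative to `P ∩ Q` and bounds there, up to a chain in `P ∩ Q`, some `e`.
    obtain ⟨k, hk⟩ := exists_lin_sd_small (O := fun i : Bool => cond i P Q)
      (fun i => by cases i; exacts [hQo, hPo]) hcov hz.2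
    obtain ⟨x, hx, hxs⟩ := exists_sum_of_mem_chainsOn_iUnion hk
    rw [Fintype.sum_bool] at hxs
    have hp : x true ∈ chainsOn A (simpIn m P) := chainsOn_mono (simpIn_mono Set.inter_subset_left) (hx true)
    have hq : x false ∈ chainsOn A (simpIn m Q) := chainsOn_mono (simpIn_mono Set.inter_subset_left) (hx false)
    have hbp : bd A m (x true) ∈ chainsOn A (simpIn (m - 1) (P ∩ Q)) := by
      rw [← simpIn_inter]
      refine mem_chainsOn_inter (bd_mem hp) ?_
      have e : bd A m (x true) = - bd A m (x false) := by
        rw [eq_neg_iff_add_eq_zero, ← map_add, hxs, ← bd_sd]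
        exact bd_bd m _
      rw [e]
      exact neg_mem (bd_mem hq)
    obtain ⟨e, he, her⟩ := hPacyc _ ⟨hp, hbp⟩
    -- After subtracting `e`, the boundary of the subdivided chain lies in `Q` alone, so the first
    -- vanishing statement applies.
    obtain ⟨w, hw, hwq⟩ := hEQ (m + 1) (lin A (sd k) z - e) ⟨fun _ _ _ => trivial, by
      rw [map_sub, bd_sd, ← hxs]
      refine (add_sub_right_comm (x true) (x false) (lin A faces e)).symm ▸ ?_
      exact add_mem (chainsOn_mono (simpIn_mono Set.inter_subset_right) her) hq⟩
    refine ⟨w + lin A (sdT k) z, fun _ _ _ => trivial, ?_⟩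
    have e1 := bd_sdT k z
    have e3 : z - lin A faces (w + lin A (sdT k) z) =
        (lin A (sd k) z - e - lin A faces w) + e + lin A (sdT k) (lin A faces z) := by
      rw [map_add, eq_sub_of_add_eq e1]
      abel
    rw [e3]
    refine add_mem (add_mem (chainsOn_mono (simpIn_mono Set.subset_union_right) hwq)
      (chainsOn_mono (simpIn_mono Set.subset_union_left) he)) ?_
    exact lin_mem_chainsOn (fun σ hσ => push_mem hσ _) hz.2

lemma acyclicPair_euclidean (n : ℕ) {m : ℕ} (hm : m ≠ n) :
    AcyclicPair A (Set.univ : Set (Fin n → ℝ)) {0}ᶜ m := by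
  induction n generalizing m with
  | zero =>
    rw [show ({0}ᶜ : Set (Fin 0 → ℝ)) = ∅ by ext x; simp [Subsingleton.elim x 0]]
    exact acyclicPair_of_unique hm
  | succ n ih =>
    have h := acyclicPair_prod (A := A) (0 : Fin n → ℝ) (m := m) fun k hk => ih (by omega)
    refine acyclicPair_of_maps (U := Set.univ) (V := {0}ᶜ) ⟨fun v : (Set.univ : Set (Fin (n + 1) → ℝ)) => (v.1 0, Fin.tail v.1), ?_⟩
      ⟨fun x => Fin.cons x.1 x.2, ?_⟩ (fun v hv => ?_) (fun _ => trivial) (fun x hx => ?_)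
      (fun v => Fin.cons_self_tail _) h
    · exact ((continuous_apply 0).comp continuous_subtype_val).prodMk
        (continuous_pi fun i => (continuous_apply i.succ).comp continuous_subtype_val)
    · fun_prop
    · refine fun h => hv ?_
      have h := Prod.mk.inj h
      rw [Set.mem_singleton_iff, ← Fin.cons_self_tail v.1, h.1, h.2]
      ext i
      refine Fin.cases ?_ (fun i => ?_) i <;> simp
    · intro h
      refine hx ?_
      have h : (Fin.cons x.1 x.2 : Fin (n + 1) → ℝ) = 0 := h
      refine Prod.ext ?_ ?_
      · exact congrFun h 0
      · funext i
        exact congrFun h i.succ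

end Euclidean
end GCW

end

noncomputable section
namespace GCW

/-! ## Attaching cells -/

section Cells

open Metric

/-- The radial map of the unit ball that pushes the points away from the origin. -/
def radial {n : ℕ} (c : ℝ) (v : Fin n → ℝ) : Fin n → ℝ := (c / max 1 (c * ‖v‖)) • v

lemma norm_radial {n : ℕ} {c : ℝ} (hc : 0 ≤ c) (v : Fin n → ℝ) :
    ‖radial c v‖ = (c * ‖v‖) / max 1 (c * ‖v‖) := by
  rw [radial, norm_smul, Real.norm_of_nonneg (by positivity)]
  ring

lemma radial_mem {n : ℕ} {c : ℝ} (hc : 0 ≤ c) (v : Fin n → ℝ) :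
    radial c v ∈ closedBall (0 : Fin n → ℝ) 1 := by
  rw [mem_closedBall_zero_iff, norm_radial hc, div_le_one (by positivity)]
  exact le_max_right _ _

lemma radial_of_norm_eq {n : ℕ} {c : ℝ} (hc : 1 ≤ c) {v : Fin n → ℝ} (hv : ‖v‖ = 1) :
    radial c v = v := by
  rw [radial, hv, mul_one, max_eq_right hc, div_self (by positivity), one_smul]

lemma radial_one {n : ℕ} {v : Fin n → ℝ} (hv : ‖v‖ ≤ 1) : radial 1 v = v := by
  rw [radial, one_mul, max_eq_left hv, div_one, one_smul]

lemma radial_mem_sphere {n : ℕ} {c : ℝ} (hc : 0 ≤ c) {v : Fin n → ℝ} (hv : 1 ≤ c * ‖v‖) :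
    radial c v ∈ sphere (0 : Fin n → ℝ) 1 := by
  rw [mem_sphere_zero_iff_norm, norm_radial hc, max_eq_right hv, div_self (by positivity)]

/-- The data by which finitely many `n`-cells are attached to a closed subspace `V`. -/
structure CellAttachment {X : Type} [TopologicalSpace X] (n : ℕ) (V : Set X) (ι : Type) where
  /-- the characteristic maps -/
  Φ : ι → (Fin n → ℝ) → X
  /-- the inverses of the characteristic maps on the open cells -/
  g : ι → X → (Fin n → ℝ)
  isClosed : IsClosed V
  cont : ∀ e, ContinuousOn (Φ e) (closedBall 0 1)
  cont_g : ∀ e, ContinuousOn (g e) (Φ e '' ball 0 1)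
  left_inv : ∀ e, ∀ v ∈ ball 0 1, g e (Φ e v) = v
  bdry : ∀ e, ∀ v ∈ sphere 0 1, Φ e v ∈ V
  disj : ∀ e e', e ≠ e' → Disjoint (Φ e '' ball 0 1) (Φ e' '' ball 0 1)
  disjV : ∀ e, Disjoint (Φ e '' ball 0 1) V

namespace CellAttachment

variable {X : Type} [TopologicalSpace X] {n : ℕ} {V : Set X} {ι : Type}
  (K : CellAttachment n V ι)

/-- The closed cells. -/
abbrev cl (e : ι) : Set X := K.Φ e '' closedBall 0 1

/-- The open cells. -/
abbrev op (e : ι) : Set X := K.Φ e '' ball 0 1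

/-- The union of the subspace and the cells. -/
def total : Set X := V ∪ ⋃ e, K.cl e

lemma cl_subset_total (e : ι) : K.cl e ⊆ K.total :=
  (Set.subset_iUnion K.cl e).trans Set.subset_union_right

lemma op_subset_cl (e : ι) : K.op e ⊆ K.cl e := Set.image_mono ball_subset_closedBall

lemma cl_subset (e : ι) : K.cl e ⊆ V ∪ K.op e := by
  rintro _ ⟨v, hv, rfl⟩
  rw [mem_closedBall] at hv
  rcases hv.lt_or_eq with h | h
  · exact Or.inr ⟨v, h, rfl⟩
  · exact Or.inl (K.bdry e v h)

lemma total_subset {x : X} (hx : x ∈ K.total) : x ∈ V ∨ ∃ e, x ∈ K.op e := by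
  rcases hx with hx | hx
  · exact Or.inl hx
  · obtain ⟨e, he⟩ := Set.mem_iUnion.1 hx
    exact (K.cl_subset e he).imp id fun h => ⟨e, h⟩

lemma isCompact_image {n : ℕ} {V : Set X} (K : CellAttachment n V ι) (e : ι) {r : ℝ} (hr : r ≤ 1) :
    IsCompact (K.Φ e '' closedBall 0 r) :=
  (isCompact_closedBall _ _).image_of_continuousOn
    ((K.cont e).mono (closedBall_subset_closedBall hr))

variable [T2Space X]

open Classical in
/-- Pushing the points of the open cells away from the centres. -/
def pushFun (c : ℝ) (x : X) : X :=
  if h : ∃ e, x ∈ K.op e then K.Φ h.choose (radial c (K.g h.choose x)) else x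

lemma pushFun_of_mem (c : ℝ) {x : X} (hx : x ∈ V) : K.pushFun c x = x := by
  rw [pushFun, dif_neg]
  rintro ⟨e, he⟩
  exact Set.disjoint_left.1 (K.disjV e) he hx

/-- The formula remains valid on the boundary sphere, where `pushFun` is the identity, because for
`c ≥ 1` the radial map fixes the unit sphere. This agreement is what makes the map continuous. -/
lemma pushFun_Φ {c : ℝ} (hc : 1 ≤ c) (e : ι) {v : Fin n → ℝ} (hv : v ∈ closedBall 0 1) :
    K.pushFun c (K.Φ e v) = K.Φ e (radial c v) := by
  rcases (mem_closedBall.1 hv).lt_or_eq with h | h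
  · have hm : K.Φ e v ∈ K.op e := ⟨v, h, rfl⟩
    have hex : ∃ e', K.Φ e v ∈ K.op e' := ⟨e, hm⟩
    rw [pushFun, dif_pos hex]
    have he : hex.choose = e := by
      by_contra hne
      exact Set.disjoint_left.1 (K.disj _ _ hne) hex.choose_spec hm
    rw [he, K.left_inv e v h]
  · rw [K.pushFun_of_mem c (K.bdry e v h), radial_of_norm_eq hc (by simpa using h)]

/-- The total space carries the quotient topology of `V` and finitely many closed balls. Concretely,
the preimage of a closed set is the union of its trace on `V` and the images of closed subsets of
the compact cylinders over the balls. -/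
lemma continuous_pushFun [Finite ι] (L : ℝ) (hL : 0 ≤ L) :
    Continuous fun x : unitInterval × K.total => K.pushFun (1 + L * x.1.1) x.2.1 := by
  have hc : ∀ s : unitInterval, 1 ≤ 1 + L * s.1 := fun s => by nlinarith [s.2.1, mul_nonneg hL s.2.1]
  let q : ∀ e, unitInterval × closedBall (0 : Fin n → ℝ) 1 → unitInterval × K.total :=
    fun e x => (x.1, ⟨K.Φ e x.2.1, K.cl_subset_total e ⟨_, x.2.2, rfl⟩⟩)
  have hΦ : ∀ e, Continuous fun v : closedBall (0 : Fin n → ℝ) 1 => K.Φ e v :=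
    fun e => (K.cont e).domRestrict
  have : CompactSpace (closedBall (0 : Fin n → ℝ) 1) :=
    isCompact_iff_compactSpace.1 (isCompact_closedBall _ _)
  have hq : ∀ e, Continuous (q e) := fun e =>
    continuous_fst.prodMk (Continuous.subtype_mk ((hΦ e).comp continuous_snd) _)
  have hg : ∀ e, Continuous fun x : unitInterval × closedBall (0 : Fin n → ℝ) 1 =>
      K.Φ e (radial (1 + L * x.1.1) x.2.1) := fun e => by
    have hr : Continuous fun x : unitInterval × closedBall (0 : Fin n → ℝ) 1 =>
        (⟨radial (1 + L * x.1.1) x.2.1, radial_mem (zero_le_one.trans (hc _)) _⟩ :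
          closedBall (0 : Fin n → ℝ) 1) := by
      refine Continuous.subtype_mk ?_ _
      have hd : Continuous fun x : unitInterval × closedBall (0 : Fin n → ℝ) 1 =>
          (1 + L * x.1.1) / max 1 ((1 + L * x.1.1) * ‖x.2.1‖) :=
        Continuous.div (by fun_prop) (by fun_prop) fun x => by positivity
      exact hd.smul (continuous_subtype_val.comp continuous_snd)
    exact (hΦ e).comp hr
  rw [continuous_iff_isClosed]
  intro C hC
  have hEq : (fun x : unitInterval × K.total => K.pushFun (1 + L * x.1.1) x.2.1) ⁻¹' C =
      (fun x : unitInterval × K.total => x.2.1) ⁻¹' (V ∩ C) ∪ ⋃ e, q e ''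
        ((fun x : unitInterval × closedBall (0 : Fin n → ℝ) 1 =>
          K.Φ e (radial (1 + L * x.1.1) x.2.1)) ⁻¹' C) := by
    ext ⟨s, x, hx⟩
    simp only [Set.mem_preimage, Set.mem_union, Set.mem_iUnion, Set.mem_image]
    constructor
    · intro h
      rcases hx with hx | hx
      · left
        rw [K.pushFun_of_mem _ hx] at h
        exact ⟨hx, h⟩
      · right
        obtain ⟨e, v, hv, rfl⟩ := Set.mem_iUnion.1 hx
        rw [K.pushFun_Φ (hc s) e hv] at h
        exact ⟨e, (s, ⟨v, hv⟩), h, rfl⟩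
    · rintro (⟨h, h'⟩ | ⟨e, ⟨s', v, hv⟩, h, h'⟩)
      · rw [K.pushFun_of_mem _ h]; exact h'
      · obtain ⟨rfl, h2⟩ := Prod.mk.inj h'
        have h2 : K.Φ e v = x := congrArg Subtype.val h2
        rw [← h2, K.pushFun_Φ (hc s') e hv]
        exact h
  rw [hEq]
  refine (IsClosed.preimage (by fun_prop) (K.isClosed.inter hC)).union
    (isClosed_iUnion_of_finite fun e => ?_)
  exact (hq e).isClosedMap _ (hC.preimage (hg e))

/-- The homotopy that pushes the points of the cells away from the centres. -/
def pushHomotopy [Finite ι] (L : ℝ) (hL : 0 ≤ L) : C(unitInterval × K.total, X) :=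
  ⟨_, K.continuous_pushFun L hL⟩

section

variable [Finite ι] {L : ℝ} (hL : 0 ≤ L)

lemma pushHomotopy_zero (y : K.total) : K.pushHomotopy L hL (0, y) = y := by
  change K.pushFun (1 + L * 0) y.1 = y
  rw [mul_zero, add_zero]
  rcases y with ⟨x, hx | hx⟩
  · exact K.pushFun_of_mem _ hx
  · obtain ⟨e, v, hv, rfl⟩ := Set.mem_iUnion.1 hx
    rw [K.pushFun_Φ le_rfl e hv, radial_one (by simpa using hv)]

lemma pushHomotopy_of_mem (s : unitInterval) (y : K.total) (hy : y.1 ∈ V) :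
    K.pushHomotopy L hL (s, y) = y := K.pushFun_of_mem _ hy

lemma one_le_scale {L : ℝ} (hL : 0 ≤ L) (s : unitInterval) : 1 ≤ 1 + L * s.1 := by
  nlinarith [s.2.1, mul_nonneg hL s.2.1]

lemma pushHomotopy_mem_cl (e : ι) (s : unitInterval) (y : K.total) (hy : y.1 ∈ K.cl e) :
    K.pushHomotopy L hL (s, y) ∈ K.cl e := by
  obtain ⟨v, hv, hvy⟩ := hy
  change K.pushFun _ y.1 ∈ _
  rw [← hvy, K.pushFun_Φ (one_le_scale hL s) e hv]
  exact ⟨_, radial_mem (zero_le_one.trans (one_le_scale hL s)) _, rfl⟩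

lemma pushHomotopy_one_mem (e : ι) (y : K.total) {v : Fin n → ℝ} (hv : v ∈ closedBall 0 1)
    (hvy : K.Φ e v = y) (h : 1 ≤ (1 + L) * ‖v‖) : K.pushHomotopy L hL (1, y) ∈ V := by
  change K.pushFun (1 + L * 1) y.1 ∈ _
  rw [← hvy, K.pushFun_Φ (by linarith) e hv, mul_one]
  exact K.bdry e _ (radial_mem_sphere (by linarith) h)

lemma pushHomotopy_mem_total (s : unitInterval) (y : K.total) :
    K.pushHomotopy L hL (s, y) ∈ K.total := by
  rcases K.total_subset y.2 with h | ⟨e, h⟩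
  · rw [K.pushHomotopy_of_mem hL s y h]; exact y.2
  · exact K.cl_subset_total e (K.pushHomotopy_mem_cl hL e s y (K.op_subset_cl e h))

end

/-- The open cells, as traces of open subsets of `X` on the total space. -/
def opNhd (e : ι) : Set X := (V ∪ ⋃ e' : {e' // e' ≠ e}, K.cl e')ᶜ

lemma isOpen_opNhd [Finite ι] (e : ι) : IsOpen (K.opNhd e) := by
  have h : IsClosed (⋃ e' : {e' // e' ≠ e}, K.cl e') :=
    isClosed_iUnion_of_finite fun e' => (K.isCompact_image e'.1 le_rfl).isClosed
  exact (K.isClosed.union h).isOpen_compl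

lemma op_subset_opNhd (e : ι) : K.op e ⊆ K.opNhd e := by
  rintro x hx (h | h)
  · exact Set.disjoint_left.1 (K.disjV e) hx h
  · obtain ⟨⟨e', he'⟩, h⟩ := Set.mem_iUnion.1 h
    rcases K.cl_subset e' h with h | h
    · exact Set.disjoint_left.1 (K.disjV e) hx h
    · exact Set.disjoint_left.1 (K.disj e e' he'.symm) hx h

lemma opNhd_inter (e : ι) : K.opNhd e ∩ K.total ⊆ K.op e := by
  rintro x ⟨hx, hx'⟩
  rcases K.total_subset hx' with h | ⟨e', h⟩
  · exact absurd (Or.inl h) hx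
  · by_cases he : e' = e
    · exact he ▸ h
    · exact absurd (Or.inr (Set.mem_iUnion.2 ⟨⟨e', he⟩, K.op_subset_cl e' h⟩)) hx

/-- The singular chains of the total space are carried, up to homotopy, by a family of subspaces
that consists of unions of cells and covers the total space. -/
lemma acyclicMod [Finite ι] (A : Type) [AddCommGroup A] {κ : Type} {W : κ → Set X}
    (hV : ∃ k, V ⊆ W k) (hcl : ∀ e, ∃ k, K.cl e ⊆ W k)
    (hW : ∀ k, ∀ x ∈ W k, x ∈ V ∨ ∃ e, x ∈ K.cl e ∧ K.cl e ⊆ W k) (m : ℕ) :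
    AcyclicMod A K.total W m := by
  -- The cover consists of the complement of the concentric half-size balls and of the open cells.
  -- With `L = 1`, points of norm at least `1 / 2` reach `V` at time `1`, whereas points of a cell
  -- stay in its closed cell.
  refine acyclicMod_of_homotopy (ι := Option ι)
    (O := fun o => o.elim (⋃ e, K.Φ e '' closedBall 0 (1 / 2))ᶜ K.opNhd)
    (K.pushHomotopy 1 zero_le_one) (K.pushHomotopy_zero _) (K.pushHomotopy_mem_total _) ?_ ?_ ?_ ?_ m
  · intro k s y hy
    rcases hW k y hy with h | ⟨e, he, h⟩
    · rwa [K.pushHomotopy_of_mem _ s y h]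
    · exact h (K.pushHomotopy_mem_cl _ e s y he)
  · rintro (_ | e)
    · exact (isClosed_iUnion_of_finite fun e =>
        (K.isCompact_image e (by norm_num)).isClosed).isOpen_compl
    · exact K.isOpen_opNhd e
  · intro x hx
    rcases K.total_subset hx with h | ⟨e, h⟩
    · refine Set.mem_iUnion.2 ⟨none, fun hx' => ?_⟩
      obtain ⟨e, v, hv, rfl⟩ := Set.mem_iUnion.1 hx'
      exact Set.disjoint_left.1 (K.disjV e)
        ⟨v, closedBall_subset_ball (by norm_num) hv, rfl⟩ h
    · exact Set.mem_iUnion.2 ⟨some e, K.op_subset_opNhd e h⟩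
  · rintro (_ | e)
    · obtain ⟨k, hk⟩ := hV
      refine ⟨k, fun y hy => hk ?_⟩
      rcases y.2 with h | h
      · rwa [K.pushHomotopy_of_mem _ 1 y h]
      · obtain ⟨e, v, hv, hvy⟩ := Set.mem_iUnion.1 h
        refine K.pushHomotopy_one_mem _ e y hv hvy ?_
        by_contra hlt
        refine hy (Set.mem_iUnion.2 ⟨e, v, ?_, hvy⟩)
        rw [mem_closedBall_zero_iff]
        linarith
    · obtain ⟨k, hk⟩ := hcl e
      exact ⟨k, fun y hy => hk (K.pushHomotopy_mem_cl _ e 1 y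
        (K.op_subset_cl e (K.opNhd_inter e ⟨hy, y.2⟩)))⟩

/-- The centre of a cell. -/
abbrev centre (e : ι) : X := K.Φ e 0

lemma centre_mem (e : ι) : K.centre e ∈ K.op e := ⟨0, by simp, rfl⟩

/-- The inverse of the characteristic map and the homeomorphism of the unit ball with Euclidean
space send the centre to the origin, so this is the local homology of Euclidean space. -/
lemma acyclicPair_op (A : Type) [AddCommGroup A] (e : ι) {m : ℕ} (hm : m ≠ n) :
    AcyclicPair A (K.op e) (K.op e \ {K.centre e}) m := by
  have hr : Continuous fun x : K.op e => K.g e x := (K.cont_g e).domRestrict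
  have hmem : ∀ x : K.op e, K.g e x ∈ ball (0 : Fin n → ℝ) 1 := by
    rintro ⟨_, v, hv, rfl⟩
    rw [K.left_inv e v hv]; exact hv
  have hΦ : ∀ x : K.op e, K.Φ e (K.g e x) = x := by
    rintro ⟨_, v, hv, rfl⟩
    rw [K.left_inv e v hv]
  have hΦc : Continuous fun v : ball (0 : Fin n → ℝ) 1 => K.Φ e v :=
    ((K.cont e).mono ball_subset_closedBall).domRestrict
  let u : (Fin n → ℝ) ≃ₜ ball (0 : Fin n → ℝ) 1 := Homeomorph.unitBall
  have hu : (u 0 : Fin n → ℝ) = 0 := Homeomorph.coe_unitBall_apply_zero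
  refine acyclicPair_of_maps (U := K.op e) (V := K.op e \ {K.centre e})
    ⟨fun x : K.op e => u.symm ⟨K.g e x, hmem x⟩, u.symm.continuous.comp (Continuous.subtype_mk hr _)⟩
    ⟨fun v => K.Φ e (u v), hΦc.comp u.continuous⟩ (V' := {0}ᶜ) (fun x hx h => hx.2 ?_)
    (fun v => ⟨_, (u v).2, rfl⟩) (fun v hv => ⟨⟨_, (u v).2, rfl⟩, fun h => hv ?_⟩)
    (fun x => ?_) (acyclicPair_euclidean n hm)
  · have h : u.symm ⟨K.g e x, hmem x⟩ = 0 := h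
    rw [Homeomorph.symm_apply_eq] at h
    have h2 := congrArg Subtype.val h
    rw [hu] at h2
    change K.g e x = 0 at h2
    rw [Set.mem_singleton_iff, ← hΦ x, h2]
  · have h : K.Φ e (u v) = K.Φ e 0 := h
    have h2 := congrArg (K.g e) h
    rw [K.left_inv e _ (u v).2, K.left_inv e 0 (by simp)] at h2
    exact u.injective (Subtype.ext (h2.trans hu.symm))
  · change K.Φ e (u (u.symm _)) = x
    rw [Homeomorph.apply_symm_apply]
    exact hΦ x

/-- The points of the total space at distance at least `δ` from the centres of the cells. -/
def away (δ : ℝ) : Set X := {x ∈ K.total | ∀ e, ∀ v ∈ closedBall 0 1, K.Φ e v = x → δ ≤ ‖v‖}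

/-- A chain involves finitely many simplices; their images are compact and miss the finitely many
centres, so they miss balls of a common radius. -/
lemma exists_away [Finite ι] {A : Type} [AddCommGroup A] {m : ℕ} {x : SCh A m X}
    (hx : x ∈ chainsOn A (simpIn m (K.total \ Set.range K.centre))) :
    ∃ δ > 0, x ∈ chainsOn A (simpIn m (K.away δ)) := by
  have hmono : ∀ {δ δ'}, δ ≤ δ' → K.away δ' ⊆ K.away δ := fun h x hx =>
    ⟨hx.1, fun e v hv hvx => h.trans (hx.2 e v hv hvx)⟩
  refine chainsOn_induction (C := fun x => ∃ δ > 0, x ∈ chainsOn A (simpIn m (K.away δ)))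
    ⟨1, one_pos, zero_mem _⟩ ?_ ?_ hx
  · rintro x y ⟨δ, hδ, hx⟩ ⟨δ', hδ', hy⟩
    exact ⟨min δ δ', lt_min hδ hδ', add_mem (chainsOn_mono (simpIn_mono (hmono (min_le_left _ _))) hx)
      (chainsOn_mono (simpIn_mono (hmono (min_le_right _ _))) hy)⟩
  · intro σ hσ a
    have hcpt : IsClosed (Set.range σ) := (isCompact_range σ.continuous).isClosed
    have h : ∀ e, ∃ δ > 0, ∀ v ∈ closedBall (0 : Fin n → ℝ) 1, K.Φ e v ∈ Set.range σ → δ ≤ ‖v‖ := by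
      intro e
      have h0 : K.Φ e 0 ∈ (Set.range σ)ᶜ := by
        rintro ⟨t, ht⟩
        exact (hσ t).2 ⟨e, ht.symm⟩
      have h1 := (K.cont e 0 (by simp)).preimage_mem_nhdsWithin (hcpt.isOpen_compl.mem_nhds h0)
      obtain ⟨δ, hδ, h2⟩ := Metric.mem_nhdsWithin_iff.1 h1
      refine ⟨δ, hδ, fun v hv hvσ => ?_⟩
      by_contra hlt
      exact h2 ⟨by simpa using hlt, hv⟩ hvσ
    choose δ hδ h using h
    have : ∃ δ₀ > 0, ∀ e, δ₀ ≤ δ e := by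
      cases isEmpty_or_nonempty ι
      · exact ⟨1, one_pos, fun e => isEmptyElim e⟩
      · obtain ⟨e₀, he₀⟩ := Finite.exists_min δ
        exact ⟨δ e₀, hδ e₀, he₀⟩
    obtain ⟨δ₀, hδ₀, hle⟩ := this
    exact ⟨δ₀, hδ₀, single_mem_chainsOn (P := simpIn m (K.away δ₀))
      (fun t => ⟨(hσ t).1, fun e v hv hvt => (hle e).trans (h e v hv ⟨t, hvt.symm⟩)⟩) a⟩

/-- If the chain has distance at least `δ` from the centres, the radial homotopy with `L = 1 / δ`
moves it into `V` while keeping `V` fixed. -/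
lemma isRelBoundary_of_avoids_centres [Finite ι] {A : Type} [AddCommGroup A] {m : ℕ} {x : SCh A m X}
    (hx : x ∈ chainsOn A (simpIn m (K.total \ Set.range K.centre)))
    (hbx : bd A m x ∈ chainsOn A (simpIn (m - 1) V)) : IsRelBoundary K.total V x := by
  obtain ⟨δ, hδ, hxδ⟩ := K.exists_away hx
  have hL : (0 : ℝ) ≤ 1 / δ := by positivity
  let H := K.pushHomotopy (1 / δ) hL
  obtain ⟨y, hy⟩ := exists_chMap_eq (U := K.total) (chainsOn_mono (simpIn_mono fun x hx => hx.1) hx)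
  have hi : Function.Injective (incl K.total) := Subtype.val_injective
  have e0 : timeMap H 0 = incl K.total := by
    ext y; exact K.pushHomotopy_zero hL y
  have hy1 : y ∈ chainsOn A (simpIn m (Subtype.val ⁻¹' K.away δ : Set K.total)) := by
    rw [← hy] at hxδ
    exact mem_chainsOn_of_chMap_mem hi hxδ
  have hby : bd A m y ∈ chainsOn A (simpIn (m - 1) (Subtype.val ⁻¹' V : Set K.total)) := by
    have h' : chMap A (incl K.total) (bd A m y) ∈ chainsOn A (simpIn (m - 1) V) := by
      rw [← bd_chMap, hy]; exact hbx
    exact mem_chainsOn_of_chMap_mem hi h'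
  have hH1 : chMap A (timeMap H 1) y ∈ chainsOn A (simpIn m V) := by
    refine chMap_mem (fun z hz => ?_) hy1
    change H (1, z) ∈ V
    rcases z.2 with h | h
    · rwa [show H (1, z) = z from K.pushHomotopy_of_mem hL 1 z h]
    · obtain ⟨e, v, hv, hvz⟩ := Set.mem_iUnion.1 h
      refine K.pushHomotopy_one_mem hL e z hv hvz ?_
      have := hz.2 e v hv hvz
      calc (1 : ℝ) = (1 / δ) * δ := by field_simp
        _ ≤ (1 + 1 / δ) * ‖v‖ := by gcongr; linarith
  have hP : lin A (prism H) y ∈ chainsOn A (simpIn (m + 1) K.total) :=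
    lin_mem_chainsOn (P := Set.univ)
      (fun σ _ => prism_mem (W := Set.univ) (fun s y _ => K.pushHomotopy_mem_total hL s y)
        fun _ => trivial) fun _ _ => trivial
  refine ⟨- lin A (prism H) y, neg_mem hP, ?_⟩
  cases m with
  | zero =>
    rw [map_neg, bd_prism_zero, e0, hy]
    simpa using hH1
  | succ m =>
    have e2 := bd_prism H y
    rw [e0, hy] at e2
    have h3 : lin A (prism H) (lin A faces y) ∈ chainsOn A (simpIn (m + 1) V) := by
      refine lin_mem_chainsOn (fun σ hσ => prism_mem (fun s y (hy : y.1 ∈ V) => ?_) hσ) hby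
      rw [show H (s, y) = y from K.pushHomotopy_of_mem hL s y hy]
      exact hy
    rw [map_neg, eq_sub_of_add_eq e2]
    convert sub_mem hH1 h3 using 1
    abel

/-- The relative homology of the total space vanishes except in the dimension of the cells. -/
lemma acyclicPair [Finite ι] (A : Type) [AddCommGroup A] {m : ℕ} (hm : m ≠ n) :
    AcyclicPair A K.total V m := by
  have := Fintype.ofFinite ι
  intro z hz
  -- The pieces are the complement of all centres and the open cells. An open cell meets every other
  -- piece only outside its own centre.
  let W : Option ι → Set X := fun o => o.elim (K.total \ Set.range K.centre) K.op
  have hinter : ∀ (e : ι) (o : Option ι), o ≠ some e → K.op e ∩ W o ⊆ K.op e \ {K.centre e} := by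
    rintro e (_ | e') ho x ⟨hx, hx'⟩
    · exact ⟨hx, fun h => hx'.2 ⟨e, h.symm⟩⟩
    · exact absurd hx' (Set.disjoint_left.1 (K.disj e e' fun h => ho (by rw [h])) hx)
  obtain ⟨k, hk⟩ := exists_lin_sd_small (ι := Option ι)
    (O := fun o => o.elim (Set.range K.centre)ᶜ K.opNhd) (fun o => by
      cases o with
      | none => exact (Set.finite_range _).isClosed.isOpen_compl
      | some e => exact K.isOpen_opNhd e) (fun x hx => by
      rcases K.total_subset hx with h | ⟨e, h⟩
      · refine Set.mem_iUnion.2 ⟨none, ?_⟩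
        rintro ⟨e, rfl⟩
        exact Set.disjoint_left.1 (K.disjV e) (K.centre_mem e) h
      · exact Set.mem_iUnion.2 ⟨some e, K.op_subset_opNhd e h⟩) hz.1
  obtain ⟨y, hy, hs⟩ := exists_sum_of_mem_chainsOn_iUnion hk
  have hyW : ∀ o, y o ∈ chainsOn A (simpIn m (W o)) := by
    rintro (_ | e)
    · have h : (Set.range K.centre)ᶜ ∩ K.total ⊆ K.total \ Set.range K.centre :=
        fun x hx => ⟨hx.2, hx.1⟩
      exact chainsOn_mono (simpIn_mono h) (hy none)
    · exact chainsOn_mono (simpIn_mono (K.opNhd_inter e)) (hy (some e))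
  have hbs : bd A m (lin A (sd k) z) ∈ chainsOn A (simpIn (m - 1) V) := by
    cases m with
    | zero => exact zero_mem _
    | succ m =>
      rw [bd_sd]
      exact lin_mem_chainsOn (fun σ hσ => push_mem hσ _) hz.2
  -- The total boundary lies in `V`, which is disjoint from the open cells. Every boundary simplex
  -- of the piece in a cell must therefore cancel against another piece, so it avoids the centre.
  have hby : ∀ e, bd A m (y (some e)) ∈ chainsOn A (simpIn (m - 1) (K.op e \ {K.centre e})) := by
    intro e
    refine mem_chainsOn_of_sum_mem (P := fun o => simpIn (m - 1) (W o)) (Q := simpIn (m - 1) V)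
      (R := fun o => o.elim Set.univ fun e => simpIn (m - 1) (K.op e \ {K.centre e})) ?_ ?_
      (x := fun o => bd A m (y o)) (fun o => bd_mem (hyW o)) ?_ (some e)
    · rintro (_ | e)
      · exact fun _ _ => trivial
      · rintro σ ⟨h, h'⟩
        exact absurd (h' (stdSimplex.vertex 0))
          (Set.disjoint_left.1 (K.disjV e) (h (stdSimplex.vertex 0)))
    · rintro (_ | e) o ho
      · exact fun _ _ => trivial
      · refine (simpIn_inter _ _ _).trans_subset (simpIn_mono (hinter e o ho))
    · rw [← map_sum, hs]
      exact hbs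
  -- Outside dimension `n` the local homology vanishes, so the piece in each cell can be moved off
  -- the centre.
  have hex : ∀ e, ∃ w ∈ chainsOn A (simpIn (m + 1) (K.op e)),
      y (some e) - lin A faces w ∈ chainsOn A (simpIn m (K.op e \ {K.centre e})) :=
    fun e => K.acyclicPair_op A e hm _ ⟨hyW (some e), hby e⟩
  choose w hw hw' using hex
  have hop : ∀ e, K.op e ⊆ K.total := fun e => (K.op_subset_cl e).trans (K.cl_subset_total e)
  have hsum : ∑ e, w e ∈ chainsOn A (simpIn (m + 1) K.total) :=
    sum_mem fun e _ => chainsOn_mono (simpIn_mono (hop e)) (hw e)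
  -- What remains avoids all centres and still has boundary in `V`.
  obtain ⟨v, hv, hv'⟩ := K.isRelBoundary_of_avoids_centres
    (x := lin A (sd k) z - lin A faces (∑ e, w e)) (by
      have hop' : ∀ e, K.op e \ {K.centre e} ⊆ K.total \ Set.range K.centre := by
        rintro e x ⟨hx, hx'⟩
        refine ⟨hop e hx, ?_⟩
        rintro ⟨e', rfl⟩
        by_cases he : e' = e
        · exact hx' (by rw [he]; rfl)
        · exact Set.disjoint_left.1 (K.disj e' e he) (K.centre_mem e') hx
      rw [← hs, Fintype.sum_option, map_sum, add_sub_assoc, ← Finset.sum_sub_distrib]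
      exact add_mem (hyW none) (sum_mem fun e _ => chainsOn_mono (simpIn_mono (hop' e)) (hw' e)))
    (by
      rw [map_sub, bd_faces, sub_zero]
      exact hbs)
  have hsdT : lin A (sdT k) z ∈ chainsOn A (simpIn (m + 1) K.total) :=
    lin_mem_chainsOn (fun σ hσ => push_mem hσ _) hz.1
  refine ⟨v + ∑ e, w e + lin A (sdT k) z, add_mem (add_mem hv hsum) hsdT, ?_⟩
  cases m with
  | zero =>
    rw [(bd_sdT_zero k z).1, add_zero]
    rw [(bd_sdT_zero k z).2] at hv'
    convert hv' using 1
    rw [map_add]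
    abel
  | succ m =>
    have e1 := bd_sdT k z
    have h3 : lin A (sdT k) (lin A faces z) ∈ chainsOn A (simpIn (m + 1) V) :=
      lin_mem_chainsOn (fun σ hσ => push_mem hσ _) hz.2
    convert add_mem hv' h3 using 1
    rw [map_add, map_add, eq_sub_of_add_eq e1]
    abel

end CellAttachment

end Cells
end GCW

end

noncomputable section
namespace GCW

/-! ## Comparison with the singular chain complex -/

section Comparison

open AlgebraicTopology Simplicial

variable (A : Type) [AddCommGroup A] {X Y : Type} [TopologicalSpace X] [TopologicalSpace Y]

/-- Mathlib's singular simplices are continuous maps from the standard simplex. -/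
def simpEquiv (n : ℕ) (X : Type) [TopologicalSpace X] :
    (TopCat.toSSet.obj (TopCat.of X)) _⦋n⦌ ≃ Simp n X :=
  TopCat.toSSetObjEquiv (TopCat.of X) (Opposite.op ⦋n⦌)

lemma simpEquiv_δ {n : ℕ} (x : (TopCat.toSSet.obj (TopCat.of X)) _⦋n + 1⦌) (i : Fin (n + 2)) :
    simpEquiv n X ((TopCat.toSSet.obj (TopCat.of X)).δ i x) =
      (simpEquiv (n + 1) X x).comp (faceMap i) := rfl

lemma simpEquiv_map {n : ℕ} (f : C(X, Y)) (x : (TopCat.toSSet.obj (TopCat.of X)) _⦋n⦌) :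
    simpEquiv n Y ((TopCat.toSSet.map (TopCat.ofHom f)).app _ x) = f.comp (simpEquiv n X x) := rfl

/-- The summand of the singular chains given by a singular simplex. -/
def simpι {n : ℕ} (σ : Simp n X) : A →+ (singularChains A X).X n :=
  ((TopCat.toSSet.obj (TopCat.of X)).ιChainComplex (R := ModuleCat.of ℤ A)
    ((simpEquiv n X).symm σ)).hom.toAddMonoidHom

/-- The comparison map from Mathlib's singular chains to finitely supported functions. -/
def toSCh (n : ℕ) : (singularChains A X).X n →+ SCh A n X :=
  ((SSet.isColimitChainComplexXCofan (TopCat.toSSet.obj (TopCat.of X)) (ModuleCat.of ℤ A) n).desc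
    (Limits.Cofan.mk (ModuleCat.of ℤ (SCh A n X)) fun x =>
      ModuleCat.ofHom (Finsupp.lsingle (R := ℤ) (simpEquiv n X x)))).hom.toAddMonoidHom

lemma toSCh_simpι {n : ℕ} (σ : Simp n X) (a : A) :
    toSCh A n (simpι A σ a) = Finsupp.single σ a := by
  have h := (SSet.isColimitChainComplexXCofan (TopCat.toSSet.obj (TopCat.of X))
    (ModuleCat.of ℤ A) n).fac (Limits.Cofan.mk (ModuleCat.of ℤ (SCh A n X)) fun x =>
      ModuleCat.ofHom (Finsupp.lsingle (R := ℤ) (simpEquiv n X x))) ⟨(simpEquiv n X).symm σ⟩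
  have h2 := congrArg (fun f => f.hom a) h
  refine Eq.trans h2 ?_
  change Finsupp.single (simpEquiv n X ((simpEquiv n X).symm σ)) a = _
  rw [Equiv.apply_symm_apply]

/-- The inverse of the comparison map. -/
def ofSCh (n : ℕ) : SCh A n X →+ (singularChains A X).X n := Finsupp.liftAddHom (simpι A)

lemma ofSCh_single {n : ℕ} (σ : Simp n X) (a : A) :
    ofSCh A n (Finsupp.single σ a) = simpι A σ a := Finsupp.liftAddHom_apply_single _ _ _

/-- Additive maps between modules over `ℤ` are linear. -/
def intLinear {M N : ModuleCat.{0} ℤ} (f : M →+ N) : M ⟶ N :=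
  ModuleCat.ofHom { f with map_smul' := fun k c => by simpa using map_intCast_smul f ℤ ℤ k c }

/-- The singular chains are a coproduct of copies of `A`; additive maps are regarded as `ℤ`-linear
so that its universal property applies. -/
lemma singularChains_hom_ext {n : ℕ} {B : Type} [AddCommGroup B]
    {f g : (singularChains A X).X n →+ B} (h : ∀ σ a, f (simpι A σ a) = g (simpι A σ a)) : f = g := by
  have h2 : intLinear (N := ModuleCat.of ℤ B) f = intLinear (N := ModuleCat.of ℤ B) g := by
    refine SSet.chainComplex_hom_ext fun x => ?_
    ext a
    have := h (simpEquiv n X x) a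
    rw [simpι, Equiv.symm_apply_apply] at this
    exact this
  ext c
  exact congrArg (fun f => f.hom c) h2

/-- Singular chains are finitely supported functions on the singular simplices. -/
def chainEquiv (n : ℕ) : (singularChains A X).X n ≃+ SCh A n X where
  __ := toSCh A n
  invFun := ofSCh A n
  left_inv c := by
    refine DFunLike.congr_fun (singularChains_hom_ext A (f := (ofSCh A n).comp (toSCh A n))
      (g := AddMonoidHom.id _) fun σ a => ?_) c
    rw [AddMonoidHom.comp_apply, toSCh_simpι, ofSCh_single]
    rfl
  right_inv x := by
    refine DFunLike.congr_fun (Finsupp.addHom_ext (f := (toSCh A n).comp (ofSCh A n))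
      (g := AddMonoidHom.id _) fun σ a => ?_) x
    rw [AddMonoidHom.comp_apply, ofSCh_single, toSCh_simpι]
    rfl

lemma chainEquiv_simpι {n : ℕ} (σ : Simp n X) (a : A) :
    chainEquiv A n (simpι A σ a) = Finsupp.single σ a := toSCh_simpι A σ a

lemma chainEquiv_bdry (n : ℕ) (c : (singularChains A X).X n) :
    chainEquiv A (n - 1) (bdry A n c) = bd A n (chainEquiv A n c) := by
  cases n with
  | zero =>
    have h : (singularChains A X).d 0 0 = 0 := (singularChains A X).shape 0 0 (by simp)
    have h2 : bdry A 0 c = 0 := by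
      have := congrArg (fun f => f.hom c) h
      exact this
    rw [h2, map_zero]
    rfl
  | succ n =>
    refine DFunLike.congr_fun (singularChains_hom_ext A
      (f := (chainEquiv A n).toAddMonoidHom.comp (bdry A (n + 1)))
      (g := (bd A (n + 1)).comp (chainEquiv A (n + 1)).toAddMonoidHom) fun σ a => ?_) c
    change chainEquiv A n (bdry A (n + 1) (simpι A σ a)) =
      lin A faces (chainEquiv A (n + 1) (simpι A σ a))
    have h := congrArg (fun f => f.hom a) (SSet.ιChainComplex_d (TopCat.toSSet.obj (TopCat.of X))
      (ModuleCat.of ℤ A) ((simpEquiv (n + 1) X).symm σ))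
    have h2 : bdry A (n + 1) (simpι A σ a) =
        ∑ i : Fin (n + 2), (-1 : ℤ) ^ (i : ℕ) • simpι A (σ.comp (faceMap i)) a := by
      refine Eq.trans h ?_
      simp only [ModuleCat.hom_sum, LinearMap.sum_apply]
      refine Finset.sum_congr rfl fun i _ => ?_
      have e : (TopCat.toSSet.obj (TopCat.of X)).δ i ((simpEquiv (n + 1) X).symm σ) =
          (simpEquiv n X).symm (σ.comp (faceMap i)) := by
        rw [Equiv.eq_symm_apply, simpEquiv_δ, Equiv.apply_symm_apply]
      rw [e]
      have hz {M : ModuleCat.{0} ℤ} (k : ℤ) (φ : ModuleCat.of ℤ A ⟶ M) :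
          (k • φ).hom a = k • φ.hom a := by
        rcases k.eq_nat_or_neg with ⟨m, rfl | rfl⟩ <;> simp
      exact (hz _ _).trans rfl
    rw [h2, map_sum, chainEquiv_simpι, lin_single]
    ext τ
    simp only [map_zsmul, chainEquiv_simpι, faces, Finsupp.finsetSum_apply, Finsupp.mapRange_apply,
      Finset.sum_smul]
    refine Finset.sum_congr rfl fun i _ => ?_
    classical
    rw [Finsupp.smul_apply, Finsupp.smul_apply, Finsupp.single_apply, Finsupp.single_apply]
    split_ifs <;> simp

lemma chainEquiv_map (f : C(X, Y)) (n : ℕ) (c : (singularChains A X).X n) :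
    chainEquiv A n (((singularMap A f).f n).hom c) = chMap A f (chainEquiv A n c) := by
  refine DFunLike.congr_fun (singularChains_hom_ext A
    (f := (chainEquiv A n).toAddMonoidHom.comp ((singularMap A f).f n).hom.toAddMonoidHom)
    (g := (chMap A f).comp (chainEquiv A n).toAddMonoidHom) fun σ a => ?_) c
  change chainEquiv A n (((singularMap A f).f n).hom (simpι A σ a)) =
    chMap A f (chainEquiv A n (simpι A σ a))
  have h := congrArg (fun k => k.hom a) (SSet.ι_chainComplexMap_f _ _
    (TopCat.toSSet.map (TopCat.ofHom f)) (ModuleCat.of ℤ A) ((simpEquiv n X).symm σ))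
  have h2 : ((singularMap A f).f n).hom (simpι A σ a) = simpι A (f.comp σ) a := by
    refine Eq.trans h ?_
    rw [simpι]
    have e : (TopCat.toSSet.map (TopCat.ofHom f)).app _ ((simpEquiv n X).symm σ) =
        (simpEquiv n Y).symm (f.comp σ) := by
      rw [Equiv.eq_symm_apply, simpEquiv_map, Equiv.apply_symm_apply]
    rw [e]
    rfl
  rw [h2, chainEquiv_simpι, chainEquiv_simpι, lin_single, Finsupp.mapRange_single, one_smul]

lemma mem_chainsIn_iff {U : Set X} {n : ℕ} {c : (singularChains A X).X n} :
    c ∈ chainsIn A U n ↔ chainEquiv A n c ∈ chainsOn A (simpIn n U) := by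
  constructor
  · rintro ⟨b, rfl⟩
    have h := chainEquiv_map A (incl U) n b
    refine (congrArg (· ∈ chainsOn A (simpIn n U)) h).mpr ?_
    exact chMap_mem (W := Set.univ) (fun y _ => y.2) fun _ _ _ => trivial
  · intro h
    obtain ⟨y, hy⟩ := exists_chMap_eq h
    refine ⟨(chainEquiv A n).symm y, (chainEquiv A n).injective ?_⟩
    rw [← hy]
    refine (chainEquiv_map A (incl U) n _).trans ?_
    rw [AddEquiv.apply_symm_apply]

lemma mem_relCycles_iff {U V : Set X} {n : ℕ} {c : (singularChains A X).X n} :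
    c ∈ relCycles A U V n ↔ IsRelCycle U V (chainEquiv A n c) := by
  rw [relCycles, AddSubgroup.mem_inf, mem_chainsIn_iff, AddSubgroup.mem_comap, mem_chainsIn_iff,
    chainEquiv_bdry]
  rfl

lemma mem_relBoundaries_iff {U V : Set X} {n : ℕ} {c : (singularChains A X).X n} :
    c ∈ relBoundaries A U V n ↔ IsRelBoundary U V (chainEquiv A n c) := by
  rw [relBoundaries, AddSubgroup.mem_sup]
  constructor
  · rintro ⟨v, hv, _, ⟨w, hw, rfl⟩, rfl⟩
    refine ⟨chainEquiv A (n + 1) w, (mem_chainsIn_iff A).1 hw, ?_⟩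
    have h := chainEquiv_bdry A (n + 1) w
    obtain ⟨b, hb⟩ : ∃ b : (singularChains A X).X n, b = bdry A (n + 1) w := ⟨_, rfl⟩
    have h2 : chainEquiv A n b = lin A faces (chainEquiv A (n + 1) w) := by rw [hb]; exact h
    rw [← hb, map_add, h2, add_sub_cancel_right]
    exact (mem_chainsIn_iff A).1 hv
  · rintro ⟨w, hw, hv⟩
    refine ⟨(chainEquiv A n).symm (chainEquiv A n c - lin A faces w), ?_, _,
      ⟨(chainEquiv A (n + 1)).symm w, ?_, rfl⟩, ?_⟩
    · rw [mem_chainsIn_iff, AddEquiv.apply_symm_apply]; exact hv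
    · exact (mem_chainsIn_iff A).2 (by rw [AddEquiv.apply_symm_apply]; exact hw)
    · apply (chainEquiv A n).injective
      rw [map_add, AddEquiv.apply_symm_apply]
      have h := chainEquiv_bdry A (n + 1) ((chainEquiv A (n + 1)).symm w)
      rw [AddEquiv.apply_symm_apply] at h
      exact (congrArg _ h).trans (sub_add_cancel _ _)

end Comparison

end GCW

end

noncomputable section
namespace GCW

/-! ## Relative homology classes and change of coefficients -/

section RelativeClasses

variable {A B : Type} [AddCommGroup A] [AddCommGroup B] {X Y : Type} [TopologicalSpace X]
  [TopologicalSpace Y]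

lemma chMap_smulMap {G : Type} [Group G] [MulAction G X] [ContinuousConstSMul G X] (g : G) (n : ℕ)
    (c : (singularChains A X).X n) :
    chainEquiv A n (chainAct A G g n c) = chMap A (smulMap G g) (chainEquiv A n c) :=
  chainEquiv_map A (smulMap G g) n c

lemma lin_faces_mem {U : Set X} {n : ℕ} {z : SCh A (n + 1) X}
    (hz : z ∈ chainsOn A (simpIn (n + 1) U)) : lin A faces z ∈ chainsOn A (simpIn n U) := bd_mem hz

variable (A) in
/-- The group of relative cycles of a pair. -/
def cycleGroup (U V : Set X) (n : ℕ) : AddSubgroup (SCh A n X) :=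
  chainsOn A (simpIn n U) ⊓ (chainsOn A (simpIn (n - 1) V)).comap (bd A n)

variable (A) in
/-- The relative homology class of a relative cycle. -/
def relClass (U V : Set X) (n : ℕ) : cycleGroup A U V n →+ RelHomology A U V n :=
  (QuotientAddGroup.mk' _).comp
    (((chainEquiv A n).symm.toAddMonoidHom.comp (cycleGroup A U V n).subtype).codRestrict
      (relCycles A U V n) fun z => (mem_relCycles_iff A).2 (by
        change IsRelCycle U V (chainEquiv A n ((chainEquiv A n).symm z.1))
        rw [AddEquiv.apply_symm_apply]; exact z.2))

lemma relClass_surjective (U V : Set X) (n : ℕ) : Function.Surjective (relClass A U V n) := by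
  intro x
  obtain ⟨⟨c, hc⟩, rfl⟩ := QuotientAddGroup.mk_surjective x
  refine ⟨⟨chainEquiv A n c, (mem_relCycles_iff A).1 hc⟩, ?_⟩
  exact congrArg (QuotientAddGroup.mk (s := (relBoundaries A U V n).addSubgroupOf _))
    (Subtype.ext ((chainEquiv A n).symm_apply_apply c))

lemma relClass_eq_zero_iff {U V : Set X} {n : ℕ} {z : cycleGroup A U V n} :
    relClass A U V n z = 0 ↔ IsRelBoundary U V z.1 := by
  refine (QuotientAddGroup.eq_zero_iff _).trans ?_
  refine AddSubgroup.mem_addSubgroupOf.trans ((mem_relBoundaries_iff A).trans ?_)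
  change IsRelBoundary U V (chainEquiv A n ((chainEquiv A n).symm z.1)) ↔ _
  rw [AddEquiv.apply_symm_apply]

lemma mk_eq_relClass {U V : Set X} {n : ℕ} {c : (singularChains A X).X n}
    (hc : c ∈ relCycles A U V n) {z : SCh A n X} (hz : z ∈ cycleGroup A U V n)
    (h : chainEquiv A n c = z) :
    (QuotientAddGroup.mk ⟨c, hc⟩ : RelHomology A U V n) = relClass A U V n ⟨z, hz⟩ := by
  subst h
  exact (congrArg (QuotientAddGroup.mk (s := (relBoundaries A U V n).addSubgroupOf _))
    (Subtype.ext ((chainEquiv A n).symm_apply_apply c))).symm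

lemma relClass_eq_iff {U V : Set X} {n : ℕ} {z w : cycleGroup A U V n} :
    relClass A U V n z = relClass A U V n w ↔ IsRelBoundary U V (z.1 - w.1) := by
  rw [← sub_eq_zero, ← map_sub, relClass_eq_zero_iff]
  rfl

lemma bd_mem_cycleGroup {U V W : Set X} {n : ℕ} {z : SCh A (n + 1) X}
    (hz : z ∈ cycleGroup A U V (n + 1)) : lin A faces z ∈ cycleGroup A V W n :=
  ⟨hz.2, by
    change bd A n (lin A faces z) ∈ chainsOn A (simpIn (n - 1) W)
    rw [bd_faces]; exact zero_mem _⟩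

lemma cellularD_relClass (F : ℕ → Set X) (n : ℕ)
    (z : cycleGroup A (F (n + 2)) (F (n + 1)) (n + 1)) :
    cellularD A F n (relClass A _ _ _ z) = relClass A _ _ _ ⟨lin A faces z.1, bd_mem_cycleGroup z.2⟩ := by
  refine mk_eq_relClass _ _ ?_
  have h := chainEquiv_bdry A (n + 1) ((chainEquiv A (n + 1)).symm z.1)
  rw [AddEquiv.apply_symm_apply] at h
  exact h

lemma chMap_mem_cycleGroup {U V : Set X} {U' V' : Set Y} {f : C(X, Y)} (hU : ∀ x ∈ U, f x ∈ U')
    (hV : ∀ x ∈ V, f x ∈ V') {n : ℕ} {z : SCh A n X} (hz : z ∈ cycleGroup A U V n) :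
    chMap A f z ∈ cycleGroup A U' V' n := by
  refine ⟨chMap_mem hU hz.1, ?_⟩
  change bd A n (chMap A f z) ∈ chainsOn A (simpIn (n - 1) V')
  rw [bd_chMap]
  exact chMap_mem hV hz.2

lemma relAct_relClass {G : Type} [Group G] [MulAction G X] [ContinuousConstSMul G X] {U V : Set X}
    (g : G) (hU : ∀ x ∈ U, g • x ∈ U) (hV : ∀ x ∈ V, g • x ∈ V) (n : ℕ) (z : cycleGroup A U V n) :
    relAct A g hU hV n (relClass A U V n z) = relClass A U V n
      ⟨chMap A (smulMap G g) z.1, chMap_mem_cycleGroup (f := smulMap G g) hU hV z.2⟩ := by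
  refine mk_eq_relClass _ _ ?_
  refine (chMap_smulMap g n _).trans ?_
  congr 1
  exact AddEquiv.apply_symm_apply _ _

/-- The map of relative homology groups given by a map of chain groups. -/
def relHom {U V : Set X} {U' V' : Set Y} {m n : ℕ} (φ : SCh A m X →+ SCh B n Y)
    (hc : ∀ z, IsRelCycle U V z → IsRelCycle U' V' (φ z))
    (hb : ∀ z, IsRelCycle U V z → IsRelBoundary U V z → IsRelBoundary U' V' (φ z)) :
    RelHomology A U V m →+ RelHomology B U' V' n :=
  QuotientAddGroup.lift _
    ((relClass B U' V' n).comp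
      ((((φ.comp (chainEquiv A m).toAddMonoidHom).comp (relCycles A U V m).subtype).codRestrict
      (cycleGroup B U' V' n)) fun z => hc _ ((mem_relCycles_iff A).1 z.2)))
    (by
      intro z hz
      exact relClass_eq_zero_iff.2 (hb _ ((mem_relCycles_iff A).1 z.2)
        ((mem_relBoundaries_iff A).1 hz)))

lemma relHom_relClass {U V : Set X} {U' V' : Set Y} {m n : ℕ} (φ : SCh A m X →+ SCh B n Y)
    (hc : ∀ z, IsRelCycle U V z → IsRelCycle U' V' (φ z))
    (hb : ∀ z, IsRelCycle U V z → IsRelBoundary U V z → IsRelBoundary U' V' (φ z))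
    (z : cycleGroup A U V m) :
    relHom φ hc hb (relClass A U V m z) = relClass B U' V' n ⟨φ z.1, hc _ z.2⟩ := by
  refine congrArg (relClass B U' V' n) (Subtype.ext ?_)
  exact congrArg φ (AddEquiv.apply_symm_apply _ _)

lemma IsRelCycle.mono {U V U' V' : Set X} (hU : U ⊆ U') (hV : V ⊆ V') {m : ℕ} {z : SCh A m X}
    (h : IsRelCycle U V z) : IsRelCycle U' V' z :=
  ⟨chainsOn_mono (simpIn_mono hU) h.1, chainsOn_mono (simpIn_mono hV) h.2⟩

lemma IsRelBoundary.mono {U V U' V' : Set X} (hU : U ⊆ U') (hV : V ⊆ V') {m : ℕ} {z : SCh A m X}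
    (h : IsRelBoundary U V z) : IsRelBoundary U' V' z := by
  obtain ⟨w, hw, hw'⟩ := h
  exact ⟨w, chainsOn_mono (simpIn_mono hU) hw, chainsOn_mono (simpIn_mono hV) hw'⟩

variable (A) in
/-- The map of relative homology groups induced by an inclusion of pairs. -/
def relIncl {U V U' V' : Set X} (hU : U ⊆ U') (hV : V ⊆ V') (m : ℕ) :
    RelHomology A U V m →+ RelHomology A U' V' m :=
  relHom (AddMonoidHom.id _) (fun _ => IsRelCycle.mono hU hV) (fun _ _ => IsRelBoundary.mono hU hV)

lemma relIncl_relClass {U V U' V' : Set X} (hU : U ⊆ U') (hV : V ⊆ V') (m : ℕ)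
    (z : cycleGroup A U V m) :
    relIncl A hU hV m (relClass A U V m z) =
      relClass A U' V' m ⟨z.1, IsRelCycle.mono (V := V) (V' := V') hU hV z.2⟩ :=
  relHom_relClass _ _ _ z

/-! #### Change of coefficients -/

variable (θ : A →+ B)

/-- The map of singular chains given by a homomorphism of coefficients. -/
abbrev coeffMap {m : ℕ} : SCh A m X →+ SCh B m X := Finsupp.mapRange.addMonoidHom θ

lemma bd_coeffMap {m : ℕ} (z : SCh A m X) : bd B m (coeffMap θ z) = coeffMap θ (bd A m z) := by
  cases m with
  | zero => exact (map_zero (coeffMap θ)).symm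
  | succ m => exact lin_mapRange faces θ z

lemma faces_coeffMap {m : ℕ} (z : SCh A (m + 1) X) :
    lin B faces (coeffMap θ z) = coeffMap θ (lin A faces z) := lin_mapRange faces θ z

variable {U V : Set X}

lemma IsRelCycle.coeffMap {m : ℕ} {z : SCh A m X} (h : IsRelCycle U V z) :
    IsRelCycle U V (coeffMap θ z) :=
  ⟨mapRange_mem_chainsOn θ h.1, by rw [bd_coeffMap]; exact mapRange_mem_chainsOn θ h.2⟩

lemma IsRelBoundary.coeffMap {m : ℕ} {z : SCh A m X} (h : IsRelBoundary U V z) :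
    IsRelBoundary U V (coeffMap θ z) := by
  obtain ⟨w, hw, hw'⟩ := h
  refine ⟨_, mapRange_mem_chainsOn θ hw, ?_⟩
  have := mapRange_mem_chainsOn θ hw'
  change GCW.coeffMap θ _ ∈ _ at this
  rw [map_sub, ← faces_coeffMap] at this
  exact this

variable (U V) in
/-- The change of coefficients in relative homology. -/
def relCoeff (m : ℕ) : RelHomology A U V m →+ RelHomology B U V m :=
  relHom (coeffMap θ) (fun _ => IsRelCycle.coeffMap θ) (fun _ _ => IsRelBoundary.coeffMap θ)

lemma relCoeff_relClass (m : ℕ) (z : cycleGroup A U V m) :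
    relCoeff θ U V m (relClass A U V m z) = relClass B U V m
      ⟨coeffMap θ z.1, IsRelCycle.coeffMap (V := V) θ z.2⟩ := relHom_relClass _ _ _ z

lemma cellularD_relCoeff (F : ℕ → Set X) (n : ℕ) (x : RelHomology A (F (n + 2)) (F (n + 1)) (n + 1)) :
    cellularD B F n (relCoeff θ _ _ _ x) = relCoeff θ _ _ _ (cellularD A F n x) := by
  obtain ⟨z, rfl⟩ := relClass_surjective _ _ _ x
  rw [relCoeff_relClass, cellularD_relClass, cellularD_relClass, relCoeff_relClass]
  congr 2
  exact faces_coeffMap θ _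

variable {θ}

lemma exists_coeffMap_eq (hθ : Function.Surjective θ) {m : ℕ} {z : SCh B m X} (hz : z ∈ chainsOn B (simpIn m U)) :
    ∃ y ∈ chainsOn A (simpIn m U), coeffMap θ y = z := by
  refine chainsOn_induction (C := fun z => ∃ y ∈ chainsOn A (simpIn m U), coeffMap θ y = z)
    ⟨0, zero_mem _, map_zero _⟩ ?_ ?_ hz
  · rintro _ _ ⟨y, hy, rfl⟩ ⟨w, hw, rfl⟩
    exact ⟨y + w, add_mem hy hw, map_add _ _ _⟩
  · intro σ hσ b
    obtain ⟨a, rfl⟩ := hθ b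
    exact ⟨Finsupp.single σ a, single_mem_chainsOn hσ a, Finsupp.mapRange_single (hf := θ.map_zero)⟩

/-- Off `V` the coefficients lie in the kernel of `θ` and are divisible by `p`; the coefficients on
`V` are left to `v`. -/
lemma exists_smul_eq {p : ℕ} (hk : ∀ a, θ a = 0 → ∃ b, p • b = a) {m : ℕ} {z : SCh A m X}
    (hz : z ∈ chainsOn A (simpIn m U)) (h : coeffMap θ z ∈ chainsOn B (simpIn m V)) :
    ∃ v ∈ chainsOn A (simpIn m V), ∃ y ∈ chainsOn A (simpIn m U), z = v + p • y := by
  classical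
  have hb : ∀ σ : Simp m X, σ ∉ simpIn m V → ∃ b, p • b = z σ := fun σ hσ =>
    hk _ (by by_contra h'; exact hσ (h σ (by simpa using h')))
  choose! b hb using hb
  let y : SCh A m X := Finsupp.onFinset z.support
    (fun σ => if z σ = 0 ∨ σ ∈ simpIn m V then 0 else b σ) fun σ hσ => by
      rw [Finsupp.mem_support_iff]
      exact fun h' => hσ (if_pos (Or.inl h'))
  have hy : ∀ σ, y σ = if z σ = 0 ∨ σ ∈ simpIn m V then 0 else b σ := fun σ => rfl
  refine ⟨z - p • y, fun σ hσ => ?_, y, fun σ hσ => ?_, by abel⟩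
  · by_contra hσV
    apply hσ
    rw [Finsupp.sub_apply, Finsupp.smul_apply, hy]
    by_cases h0 : z σ = 0
    · rw [if_pos (Or.inl h0), h0]; simp
    · rw [if_neg (by tauto), hb σ hσV, sub_self]
  · refine hz σ fun h0 => hσ ?_
    rw [hy, if_pos (Or.inl h0)]

lemma mem_of_smul_mem {p : ℕ} (hp : ∀ a : A, p • a = 0 → a = 0) {m : ℕ} {z : SCh A m X}
    (h : p • z ∈ chainsOn A (simpIn m V)) : z ∈ chainsOn A (simpIn m V) :=
  fun σ hσ => h σ fun h' => hσ (hp _ h')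

variable {p : ℕ}

/-- The obstruction to lifting a relative cycle is its Bockstein. A lift `y` of the chain has `∂y =
v + p x` with `v` in `V`. As `A` has no `p`-torsion, `x` is a relative cycle of degree `s - 1`,
hence bounds some `w` modulo `V`, and `y - p w` is a relative cycle with the same reduction. -/
lemma relCoeff_surjective (hθ : Function.Surjective θ) (hpB : ∀ b : B, p • b = 0) (hk : ∀ a, θ a = 0 → ∃ b, p • b = a)
    (hp : ∀ a : A, p • a = 0 → a = 0) {s : ℕ} (hs : ∀ m, m ≠ s → AcyclicPair A U V m) :
    Function.Surjective (relCoeff θ U V s) := by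
  intro x
  obtain ⟨⟨z, hz⟩, rfl⟩ := relClass_surjective _ _ _ x
  suffices h : ∃ y : SCh A s X, IsRelCycle U V y ∧ coeffMap θ y = z by
    obtain ⟨y, hy, rfl⟩ := h
    exact ⟨relClass A U V s ⟨y, hy⟩, relCoeff_relClass _ _ _⟩
  obtain ⟨y, hy, rfl⟩ := exists_coeffMap_eq hθ hz.1
  cases s with
  | zero => exact ⟨y, ⟨hy, zero_mem _⟩, rfl⟩
  | succ s =>
    have h2 : coeffMap θ (lin A faces y) ∈ chainsOn B (simpIn s V) := by
      rw [← faces_coeffMap]; exact hz.2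
    obtain ⟨v, hv, x, hx, hyx⟩ := exists_smul_eq hk (lin_faces_mem hy) h2
    have hxc : IsRelCycle U V x := by
      refine ⟨hx, mem_of_smul_mem hp ?_⟩
      have e : p • bd A s x = - bd A s v := by
        rw [eq_neg_iff_add_eq_zero, ← map_nsmul, ← map_add, add_comm, ← hyx]
        exact bd_faces y
      rw [e]
      exact neg_mem (bd_mem hv)
    obtain ⟨w, hw, hw'⟩ := hs s (by omega) x hxc
    refine ⟨y - p • w, ⟨sub_mem hy (nsmul_mem hw p), ?_⟩, ?_⟩
    · change lin A faces (y - p • w) ∈ _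
      have hyx' : lin A faces y = v + p • x := hyx
      rw [map_sub, map_nsmul, hyx', add_sub_assoc, ← smul_sub]
      exact add_mem hv (nsmul_mem hw' p)
    · rw [map_sub, map_nsmul, sub_eq_self]
      ext σ; exact hpB _

/-- Exactness in the middle of the coefficient sequence, which requires no vanishing: lift the
bounding chain and divide the difference by `p` outside `V`. -/
lemma exists_smul_of_relCoeff_eq_zero (hθ : Function.Surjective θ)
    (hk : ∀ a, θ a = 0 → ∃ b, p • b = a)
    (hp : ∀ a : A, p • a = 0 → a = 0) {s : ℕ} {x : RelHomology A U V s}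
    (hx : relCoeff θ U V s x = 0) : ∃ y, p • y = x := by
  obtain ⟨⟨z, hz⟩, rfl⟩ := relClass_surjective _ _ _ x
  rw [relCoeff_relClass, relClass_eq_zero_iff] at hx
  obtain ⟨w, hw, hw'⟩ := hx
  obtain ⟨w, hw2, rfl⟩ := exists_coeffMap_eq hθ hw
  have h2 : coeffMap θ (z - lin A faces w) ∈ chainsOn B (simpIn s V) := by
    rw [map_sub, ← faces_coeffMap]; exact hw'
  obtain ⟨v, hv, y, hy, hyx⟩ := exists_smul_eq hk (sub_mem hz.1 (lin_faces_mem hw2)) h2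
  have hyc : IsRelCycle U V y := by
    refine ⟨hy, mem_of_smul_mem hp ?_⟩
    have e : p • bd A s y = bd A s z - bd A s v := by
      rw [eq_sub_iff_add_eq, ← map_nsmul, ← map_add, add_comm, ← hyx, map_sub, bd_faces, sub_zero]
    rw [e]
    exact sub_mem hz.2 (bd_mem hv)
  refine ⟨relClass A U V s ⟨y, hyc⟩, ?_⟩
  rw [← map_nsmul, relClass_eq_iff]
  refine ⟨-w, neg_mem hw2, ?_⟩
  change p • y - z - lin A faces (-w) ∈ _
  have e : p • y - z - lin A faces (-w) = - v := by
    rw [map_neg, eq_neg_iff_add_eq_zero]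
    have : p • y = z - lin A faces w - v := by rw [hyx]; abel
    rw [this]; abel
  rw [e]
  exact neg_mem hv

/-- If `p z` is bounded by `w` modulo `V`, the reduction of `w` is a relative cycle of degree `s +
1`, hence a relative boundary. So, up to a boundary and a chain in `V`, `w` is `p y`, and dividing
by `p` shows that `y` bounds `z`. -/
lemma eq_zero_of_smul_eq_zero (hθ : Function.Surjective θ) (hk : ∀ a, θ a = 0 → ∃ b, p • b = a)
    (hpB : ∀ b : B, p • b = 0)
    (hp : ∀ a : A, p • a = 0 → a = 0) {s : ℕ} (hs : ∀ m, m ≠ s → AcyclicPair B U V m)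
    {x : RelHomology A U V s} (hx : p • x = 0) : x = 0 := by
  obtain ⟨⟨z, hz⟩, rfl⟩ := relClass_surjective _ _ _ x
  rw [← map_nsmul, relClass_eq_zero_iff] at hx
  obtain ⟨w, hw, hw'⟩ := hx
  change p • z - _ ∈ _ at hw'
  have hpc : ∀ {m : ℕ} (c : SCh A m X), coeffMap θ (p • c) = 0 := fun c => by
    rw [map_nsmul]; ext σ; exact hpB _
  have hwc : IsRelCycle U V (coeffMap θ w) := by
    refine ⟨mapRange_mem_chainsOn θ hw, ?_⟩
    rw [bd_coeffMap]
    have h3 := mapRange_mem_chainsOn θ hw'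
    change coeffMap θ _ ∈ _ at h3
    rw [map_sub, hpc, zero_sub, neg_mem_iff] at h3
    exact h3
  obtain ⟨u, hu, hu'⟩ := hs (s + 1) (by omega) _ hwc
  obtain ⟨u, hu2, rfl⟩ := exists_coeffMap_eq hθ hu
  have h2 : coeffMap θ (w - lin A faces u) ∈ chainsOn B (simpIn (s + 1) V) := by
    rw [map_sub, ← faces_coeffMap]; exact hu'
  obtain ⟨v, hv, y, hy, hyx⟩ := exists_smul_eq hk (sub_mem hw (lin_faces_mem hu2)) h2
  rw [relClass_eq_zero_iff]
  refine ⟨y, hy, mem_of_smul_mem hp ?_⟩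
  have e : lin A faces w = lin A faces v + p • lin A faces y := by
    have := congrArg (lin A faces) hyx
    rw [map_sub, map_add, map_nsmul, show lin A faces (lin A faces u) = 0 from bd_bd (s + 1) u,
      sub_zero] at this
    exact this
  rw [smul_sub]
  have e2 : p • z - p • lin A faces y = (p • z - lin A faces w) + lin A faces v := by
    rw [e]; abel
  rw [e2]
  exact add_mem hw' (lin_faces_mem hv)

end RelativeClasses

end GCW

end

noncomputable section
namespace GCW

/-! ## Skeleta of a CW complex and sheets of a G-CW complex -/

open Metric

section Skeleta

variable {X : Type} [TopologicalSpace X] [T2Space X] (K : Set X) [CWComplex K]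

/-- The union of the open cells of dimension less than `n`. -/
abbrev skel (n : ℕ) : Set X := (RelCWComplex.skeletonLT K (n : ℕ∞) : Set X)

lemma mem_skel {n : ℕ} {x : X} : x ∈ skel K n ↔
    ∃ m < n, ∃ e : RelCWComplex.cell K m, x ∈ RelCWComplex.openCell m e := by
  refine CWComplex.mem_skeletonLT_iff.trans ?_
  simp

lemma skel_mono {m n : ℕ} (h : m ≤ n) : skel K m ⊆ skel K n := fun x hx => by
  rw [mem_skel] at hx ⊢
  obtain ⟨k, hk, e, he⟩ := hx
  exact ⟨k, hk.trans_le h, e, he⟩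

lemma openCell_subset_skel {n : ℕ} (e : RelCWComplex.cell K n) :
    RelCWComplex.openCell n e ⊆ skel K (n + 1) := fun _ hx =>
  (mem_skel K).2 ⟨n, n.lt_succ_self, e, hx⟩

lemma eq_of_mem_openCell {n m : ℕ} {e : RelCWComplex.cell K n} {e' : RelCWComplex.cell K m} {x : X}
    (h : x ∈ RelCWComplex.openCell n e) (h' : x ∈ RelCWComplex.openCell m e') :
    (⟨n, e⟩ : Σ n, RelCWComplex.cell K n) = ⟨m, e'⟩ := by
  by_contra hne
  exact Set.disjoint_left.1 (RelCWComplex.disjoint_openCell_of_ne hne) h h'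

/-- The attachment of the `n`-cells of a CW complex. -/
def cwAttach (n : ℕ) : CellAttachment n (skel K n) (RelCWComplex.cell K n) where
  Φ e := RelCWComplex.map n e
  g e := (RelCWComplex.map n e).symm
  isClosed := (RelCWComplex.skeletonLT K (n : ℕ∞)).closed
  cont e := RelCWComplex.continuousOn n e
  cont_g e := by
    have h := (RelCWComplex.map n e).image_source_eq_target
    rw [RelCWComplex.source_eq] at h
    rw [h]
    exact RelCWComplex.continuousOn_symm n e
  left_inv e v hv := (RelCWComplex.map n e).left_inv (by rwa [RelCWComplex.source_eq])
  bdry e v hv := RelCWComplex.cellFrontier_subset_skeletonLT n e ⟨v, hv, rfl⟩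
  disj e e' h := RelCWComplex.disjoint_openCell_of_ne (by simpa using h)
  disjV _ := (RelCWComplex.disjoint_skeletonLT_openCell le_rfl).symm

lemma cwAttach_total (n : ℕ) : (cwAttach K n).total = skel K (n + 1) := by
  have h := RelCWComplex.skeletonLT_union_iUnion_closedCell_eq_skeletonLT_succ (C := K) n
  exact h

variable [CWComplex.Finite K]

lemma acyclicPair_skel (A : Type) [AddCommGroup A] {m n : ℕ} (h : m ≠ n) :
    AcyclicPair A (skel K (n + 1)) (skel K n) m := by
  have : Finite (RelCWComplex.cell K n) := RelCWComplex.FiniteType.finite_cell n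
  rw [← cwAttach_total]
  exact (cwAttach K n).acyclicPair A h

lemma exists_skel_eq : ∃ N, ∀ n, N ≤ n → skel K (n + 1) = skel K n := by
  obtain ⟨N, hN⟩ := Filter.eventually_atTop.1
    (RelCWComplex.FiniteDimensional.eventually_isEmpty_cell (C := K) (D := ∅))
  refine ⟨N, fun n hn => ?_⟩
  have := hN n hn
  rw [← cwAttach_total, CellAttachment.total, Set.iUnion_of_empty, Set.union_empty]

lemma relHomology_subsingleton (A : Type) [AddCommGroup A] {U V : Set X} (h : U = V) (n : ℕ) :
    Subsingleton (RelHomology A U V n) := by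
  refine ⟨fun x y => ?_⟩
  have h0 : ∀ x : RelHomology A U V n, x = 0 := fun x => by
    obtain ⟨z, rfl⟩ := relClass_surjective _ _ _ x
    rw [relClass_eq_zero_iff]
    subst h
    exact ⟨0, zero_mem _, by rw [map_zero, sub_zero]; exact z.2.1⟩
  rw [h0 x, h0 y]

end Skeleta

/-! ### The action on the cells, free orbits and sheets. -/

section GCells

variable (G : Type) [Group G] {X : Type} [TopologicalSpace X] [T2Space X] [MulAction G X]
  [ContinuousConstSMul G X] [CWComplex (Set.univ : Set X)] [IsGCWComplex G X]

variable (X) in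
/-- The `n`-cells of `X`. -/
abbrev Cells (n : ℕ) : Type := RelCWComplex.cell (Set.univ : Set X) n

/-- The open `n`-cell with the given index. -/
abbrev oCell {n : ℕ} (e : Cells X n) : Set X := RelCWComplex.openCell n e

lemma cells_ext {n : ℕ} {e e' : Cells X n} (h : oCell e = oCell e') : e = e' := by
  obtain ⟨x, hx⟩ := RelCWComplex.openCell_nonempty n e
  have := eq_of_mem_openCell Set.univ hx (h ▸ hx : x ∈ oCell e')
  simpa using this

/-- The action of `G` on the set of `n`-cells. -/
instance cellAction (n : ℕ) : MulAction G (Cells X n) where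
  smul g e := (IsGCWComplex.exists_image_eq (X := X) g n e).choose
  one_smul e := by
    refine cells_ext ((IsGCWComplex.exists_image_eq (X := X) (1 : G) n e).choose_spec.symm.trans ?_)
    simp
  mul_smul g h e := by
    have H := fun (g : G) (e : Cells X n) => (IsGCWComplex.exists_image_eq (X := X) g n e).choose_spec
    refine cells_ext ((H (g * h) e).symm.trans (Eq.trans ?_ (H g _)))
    rw [← H h e, Set.image_image]
    simp [mul_smul]

lemma image_oCell (g : G) {n : ℕ} (e : Cells X n) : (fun x => g • x) '' oCell e = oCell (g • e) :=
  (IsGCWComplex.exists_image_eq (X := X) g n e).choose_spec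

lemma smul_mem_oCell {g : G} {n : ℕ} {e : Cells X n} {x : X} (hx : x ∈ oCell e) :
    g • x ∈ oCell (g • e) := by
  rw [← image_oCell]; exact ⟨x, hx, rfl⟩

/-- The cells that are fixed pointwise. -/
def IsFixedCell {n : ℕ} (e : Cells X n) : Prop := oCell e ⊆ MulAction.fixedPoints G X

variable {G}

lemma smul_eq_of_smul_cell {g : G} {n : ℕ} {e : Cells X n} (h : g • e = e) {x : X}
    (hx : x ∈ oCell e) : g • x = x :=
  IsGCWComplex.fixes g n e (by rw [image_oCell, h]) x hx

lemma smul_cell_of_smul_eq {g : G} {n : ℕ} {e : Cells X n} {x : X}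
    (hx : x ∈ oCell e) (h : g • x = x) : g • e = e := by
  have h1 := smul_mem_oCell G (g := g) hx
  rw [h] at h1
  simpa using eq_of_mem_openCell Set.univ h1 hx

lemma isFixedCell_of_mem {n : ℕ} {e : Cells X n} {x : X} (hx : x ∈ oCell e)
    (h : x ∈ MulAction.fixedPoints G X) : IsFixedCell G e := fun _ hy g =>
  smul_eq_of_smul_cell (smul_cell_of_smul_eq hx (h g)) hy

lemma isFixedCell_smul {g : G} {n : ℕ} {e : Cells X n} (h : IsFixedCell G (g • e)) :
    IsFixedCell G e := by
  intro x hx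
  have h1 := h (smul_mem_oCell G (g := g) hx)
  intro k
  have h2 := h1 (g * k * g⁻¹)
  rw [mul_smul, inv_smul_smul, mul_smul] at h2
  exact smul_left_cancel g h2

/-- A subgroup of a group of prime order is trivial or everything. The stabilizer of each point of
the cell contains `g ≠ 1`, so it is `G`. -/
lemma isFixedCell_of_smul_eq {p : ℕ} [Fact p.Prime] (hG : Nat.card G = p) {g : G} (hg : g ≠ 1)
    {n : ℕ} {e : Cells X n} (h : g • e = e) : IsFixedCell G e := by
  intro x hx k
  have hst : MulAction.stabilizer G x = ⊤ := by
    have hp : (Nat.card G).Prime := hG ▸ Fact.out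
    have := Fact.mk hp
    rcases Subgroup.eq_bot_or_eq_top_of_prime_card (MulAction.stabilizer G x) with h' | h'
    · refine absurd ?_ hg
      rw [← Subgroup.mem_bot, ← h']
      exact smul_eq_of_smul_cell h hx
    · exact h'
  have : k ∈ MulAction.stabilizer G x := hst ▸ Subgroup.mem_top k
  exact this

variable (G X) in
/-- Representatives of the orbits of the cells that are not fixed. -/
def freeReps (n : ℕ) : Set (Cells X n) :=
  {e | ¬ IsFixedCell G e ∧ (Quotient.mk (MulAction.orbitRel G (Cells X n)) e).out = e}

lemma exists_freeReps {n : ℕ} {e : Cells X n} (h : ¬ IsFixedCell G e) :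
    ∃ g : G, ∃ r ∈ freeReps G X n, g • r = e := by
  set r := (Quotient.mk (MulAction.orbitRel G (Cells X n)) e).out with hr
  have h1 : Quotient.mk (MulAction.orbitRel G (Cells X n)) r =
    Quotient.mk (MulAction.orbitRel G (Cells X n)) e := Quotient.out_eq _
  obtain ⟨g, hg⟩ := Quotient.exact h1.symm
  refine ⟨g, r, ⟨fun h' => h ?_, by rw [h1]⟩, hg⟩
  have h2 : IsFixedCell G (g⁻¹ • e) := by
    rw [← hg]
    simpa using h'
  exact isFixedCell_smul h2

/-- Two translates of representatives that coincide belong to one orbit, so the representatives are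
equal; then the previous dichotomy shows that the action on cells that are not fixed is free. -/
lemma eq_of_smul_freeReps {p : ℕ} [Fact p.Prime] (hG : Nat.card G = p) {n : ℕ} {g g' : G}
    {r r' : Cells X n} (hr : r ∈ freeReps G X n) (hr' : r' ∈ freeReps G X n)
    (h : g • r = g' • r') : g = g' := by
  have h1 : Quotient.mk (MulAction.orbitRel G (Cells X n)) r =
      Quotient.mk (MulAction.orbitRel G (Cells X n)) r' := by
    refine Quotient.sound ⟨g⁻¹ * g', ?_⟩
    change (g⁻¹ * g') • r' = r
    rw [mul_smul, ← h, inv_smul_smul]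
  have h2 : r = r' := by rw [← hr.2, h1, hr'.2]
  subst h2
  by_contra hne
  refine hr.1 (isFixedCell_of_smul_eq hG (g := g'⁻¹ * g) ?_ ?_)
  · rwa [ne_eq, inv_mul_eq_one, eq_comm]
  · rw [mul_smul, h, inv_smul_smul]

variable (G X) in
/-- The skeleta of the fixed point set. -/
abbrev fixSkel (n : ℕ) : Set X := skel (fixedSubcomplex G X : Set X) n

lemma mem_fixSkel {n : ℕ} {x : X} : x ∈ fixSkel G X n ↔
    ∃ m < n, ∃ e : Cells X m, IsFixedCell G e ∧ x ∈ oCell e := by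
  rw [mem_skel]
  constructor
  · rintro ⟨m, hm, e, he⟩
    exact ⟨m, hm, e.1, e.2, he⟩
  · rintro ⟨m, hm, e, he, hx⟩
    exact ⟨m, hm, ⟨e, he⟩, hx⟩

lemma fixSkel_subset_skel (n : ℕ) : fixSkel G X n ⊆ skel (Set.univ : Set X) n := fun x hx => by
  obtain ⟨m, hm, e, _, he⟩ := mem_fixSkel.1 hx
  exact (mem_skel _).2 ⟨m, hm, e, he⟩

lemma smul_eq_of_mem_fixSkel {n : ℕ} {x : X} (hx : x ∈ fixSkel G X n) (g : G) : g • x = x := by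
  obtain ⟨m, hm, e, hf, he⟩ := mem_fixSkel.1 hx
  exact hf he g

lemma fixSkel_inter_skel {n : ℕ} :
    fixSkel G X (n + 1) ∩ skel (Set.univ : Set X) n = fixSkel G X n := by
  apply Set.Subset.antisymm
  · rintro x ⟨h, h'⟩
    obtain ⟨m, hm, e, hf, he⟩ := mem_fixSkel.1 h
    obtain ⟨m', hm', e', he'⟩ := (mem_skel _).1 h'
    have : m = m' := congrArg Sigma.fst (eq_of_mem_openCell Set.univ he he')
    exact mem_fixSkel.2 ⟨m, by omega, e, hf, he⟩
  · exact fun x hx => ⟨skel_mono _ n.le_succ hx, fixSkel_subset_skel n hx⟩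

variable (G X) in
/-- The union of the `n`-skeleton and the translates by `g` of the representing cells. -/
def sheet (n : ℕ) (g : G) : Set X :=
  skel (Set.univ : Set X) n ∪ ⋃ r : freeReps G X n, oCell (g • r.1)

variable (G X) in
/-- The decomposition of the skeleton into sheets and fixed points. -/
def sheets (n : ℕ) : Option G → Set X := fun o => o.elim (fixSkel G X (n + 1)) (sheet G X n)

lemma sheets_subset (n : ℕ) (k : Option G) : sheets G X n k ⊆ skel (Set.univ : Set X) (n + 1) := by
  cases k with
  | none => exact fixSkel_subset_skel _
  | some g =>
    exact Set.union_subset (skel_mono _ n.le_succ)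
      (Set.iUnion_subset fun r => openCell_subset_skel _ _)

lemma sheet_inter_skel (n : ℕ) (g : G) :
    sheet G X n g ∩ skel (Set.univ : Set X) n = skel (Set.univ : Set X) n :=
  Set.inter_eq_right.2 Set.subset_union_left

lemma smul_mem_sheet {n : ℕ} (g h : G) {x : X} (hx : x ∈ sheet G X n h) :
    g • x ∈ sheet G X n (g * h) := by
  rcases hx with hx | hx
  · exact Or.inl (smul_mem_skeletonLT G n g x hx)
  · obtain ⟨r, hr⟩ := Set.mem_iUnion.1 hx
    refine Or.inr (Set.mem_iUnion.2 ⟨r, ?_⟩)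
    rw [mul_smul]
    exact smul_mem_oCell G hr

/-- Distinct open cells are disjoint, and by freeness an `n`-cell belongs to exactly one of the
families: fixed cells, or translates of representatives by a given `g`. -/
lemma sheets_inter {p : ℕ} [Fact p.Prime] (hG : Nat.card G = p) (n : ℕ) (i j : Option G)
    (h : j ≠ i) : sheets G X n i ∩ sheets G X n j ⊆ skel (Set.univ : Set X) n := by
  have key : ∀ g : G, fixSkel G X (n + 1) ∩ sheet G X n g ⊆ skel (Set.univ : Set X) n := by
    rintro g x ⟨hx, hx' | hx'⟩
    · exact hx'
    · obtain ⟨r, hr⟩ := Set.mem_iUnion.1 hx'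
      exact absurd (isFixedCell_smul (isFixedCell_of_mem hr
        fun g => smul_eq_of_mem_fixSkel hx g)) r.2.1
  rcases i with _ | i <;> rcases j with _ | j
  · exact absurd rfl h
  · exact key j
  · rw [Set.inter_comm]; exact key i
  · rintro x ⟨hx | hx, hx' | hx'⟩
    · exact hx
    · exact hx
    · exact hx'
    · obtain ⟨r, hr⟩ := Set.mem_iUnion.1 hx
      obtain ⟨r', hr'⟩ := Set.mem_iUnion.1 hx'
      have := eq_of_mem_openCell Set.univ hr hr'
      have h2 : i • r.1 = j • r'.1 := by simpa using this
      exact absurd (congrArg some (eq_of_smul_freeReps hG r.2 r'.2 h2).symm) h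

/-- Every closed `n`-cell lies in one of the sets: the boundary of a fixed cell is fixed because the
fixed point set is a subcomplex, and each sheet contains the whole `n`-skeleton. -/
lemma acyclicMod_sheets [CWComplex.Finite (Set.univ : Set X)] (A : Type) [AddCommGroup A]
    (n m : ℕ) : AcyclicMod A (skel (Set.univ : Set X) (n + 1))
      (consFam (skel (Set.univ : Set X) n) (sheets G X n)) m := by
  have : Finite (Cells X n) := RelCWComplex.FiniteType.finite_cell n
  have hcl : ∀ e : Cells X n, IsFixedCell G e →
      (cwAttach (Set.univ : Set X) n).cl e ⊆ fixSkel G X (n + 1) := fun e he => by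
    let e' : RelCWComplex.cell (fixedSubcomplex G X : Set X) n := ⟨e, he⟩
    exact RelCWComplex.closedCell_subset_skeletonLT n e'
  have hcl' : ∀ (g : G) (r : freeReps G X n),
      (cwAttach (Set.univ : Set X) n).cl (g • r.1) ⊆ sheet G X n g := fun g r =>
    ((cwAttach (Set.univ : Set X) n).cl_subset _).trans
      (Set.union_subset_union_right _ (Set.subset_iUnion (fun r : freeReps G X n => oCell (g • r.1)) r))
  rw [← cwAttach_total]
  refine (cwAttach (Set.univ : Set X) n).acyclicMod A ⟨none, subset_rfl⟩ ?_ ?_ m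
  · intro e
    by_cases he : IsFixedCell G e
    · exact ⟨some none, hcl e he⟩
    · obtain ⟨g, r, hr, rfl⟩ := exists_freeReps he
      exact ⟨some (some g), hcl' g ⟨r, hr⟩⟩
  · rintro (_ | _ | g) x hx
    · exact Or.inl hx
    · obtain ⟨k, hk, e, hf, he⟩ := mem_fixSkel.1 hx
      rcases (Nat.lt_succ_iff.1 hk).lt_or_eq with hlt | rfl
      · exact Or.inl ((mem_skel _).2 ⟨k, hlt, e, he⟩)
      · exact Or.inr ⟨e, (cwAttach (Set.univ : Set X) k).op_subset_cl e he, hcl e hf⟩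
    · rcases hx with hx | hx
      · exact Or.inl hx
      · obtain ⟨r, hr⟩ := Set.mem_iUnion.1 hx
        exact Or.inr ⟨g • r.1, (cwAttach (Set.univ : Set X) n).op_subset_cl _ hr, hcl' g r⟩

end GCells

end GCW

end

noncomputable section
namespace GCW

/-! ## Splitting of the cellular chains -/

section Splitting

/-- A `ℤ[G]`-module `M` is the direct sum of the trivial module `T` and an induced module. -/
structure IsSplit {G : Type} [Group G] [Fintype G] (M : Rep.{0} ℤ G) {T : Type} [AddCommGroup T]
    (ι : T →+ M) (F : AddSubgroup M) : Prop where
  fix : ∀ g t, M.ρ g (ι t) = ι t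
  span : ∀ m, ∃ (t : T) (f : G → M), (∀ g, f g ∈ F) ∧ m = ι t + ∑ g, M.ρ g (f g)
  indep : ∀ (t : T) (f : G → M), (∀ g, f g ∈ F) → ι t + ∑ g, M.ρ g (f g) = 0 →
    t = 0 ∧ ∀ g, f g = 0

variable {G : Type} [Group G] {X : Type} [TopologicalSpace X] [T2Space X] [MulAction G X]
  [ContinuousConstSMul G X] [CWComplex (Set.univ : Set X)] [IsGCWComplex G X]
  (A : Type) [AddCommGroup A]

variable (G X) in
/-- The cellular chains of the fixed point set. -/
abbrev FixChains (s : ℕ) : Type := RelHomology A (fixSkel G X (s + 1)) (fixSkel G X s) s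

variable (X) in
/-- The cellular chains of `X`. -/
abbrev CellChains (s : ℕ) : Type :=
  RelHomology A (skel (Set.univ : Set X) (s + 1)) (skel (Set.univ : Set X) s) s

variable (G X) in
/-- The inclusion of the cellular chains of the fixed point set. -/
def fixIncl (s : ℕ) : FixChains G X A s →+ CellChains X A s :=
  relIncl A (fixSkel_subset_skel _) (fixSkel_subset_skel _) s

lemma cellularD_fixIncl (s : ℕ) (t : FixChains G X A (s + 1)) :
    cellularD A (skel (Set.univ : Set X)) s (fixIncl G X A (s + 1) t) =
      fixIncl G X A s (cellularD A (fixSkel G X) s t) := by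
  obtain ⟨z, rfl⟩ := relClass_surjective _ _ _ t
  rw [fixIncl, relIncl_relClass, cellularD_relClass, cellularD_relClass, fixIncl, relIncl_relClass]

/-- The action of `G` on the cellular chains. -/
abbrev cellAct (s : ℕ) (g : G) : CellChains X A s →+ CellChains X A s :=
  relAct A g (smul_mem_skeletonLT G (s + 1) g) (smul_mem_skeletonLT G s g) s

lemma chMap_of_fix {Y : Type} [TopologicalSpace Y] {f : C(Y, Y)} {U : Set Y} (h : ∀ x ∈ U, f x = x)
    {n : ℕ} {z : SCh A n Y} (hz : z ∈ chainsOn A (simpIn n U)) : chMap A f z = z := by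
  refine chainsOn_induction (C := fun z => chMap A f z = z) (map_zero _) ?_ ?_ hz
  · intro x y hx hy
    rw [map_add, hx, hy]
  · intro σ hσ a
    rw [lin_single, Finsupp.mapRange_single, one_smul]
    congr 1
    ext t : 1
    exact h _ (hσ t)

lemma cellAct_fixIncl (s : ℕ) (g : G) (t : FixChains G X A s) :
    cellAct A s g (fixIncl G X A s t) = fixIncl G X A s t := by
  obtain ⟨z, rfl⟩ := relClass_surjective _ _ _ t
  rw [fixIncl, relIncl_relClass, relAct_relClass]
  congr 2
  exact chMap_of_fix A (f := smulMap G g) (fun x hx => smul_eq_of_mem_fixSkel hx g) z.2.1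

variable (G X) in
/-- The chains carried by the representing cells. -/
def sheetChains (s : ℕ) : AddSubgroup (CellChains X A s) :=
  (relIncl A (sheets_subset (G := G) (X := X) s (some 1)) (subset_refl (skel (Set.univ : Set X) s))
    s).range

lemma isRelCycle_smul {s : ℕ} {g h : G} {z : SCh A s X}
    (hz : IsRelCycle (sheet G X s h) (skel (Set.univ : Set X) s) z) :
    IsRelCycle (sheet G X s (g * h)) (skel (Set.univ : Set X) s) (chMap A (smulMap G g) z) :=
  chMap_mem_cycleGroup (f := smulMap G g) (fun _ hx => smul_mem_sheet g h hx)
    (fun x hx => smul_mem_skeletonLT G s g x hx) hz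

variable [CWComplex.Finite (Set.univ : Set X)] [Fintype G]

/-- The component of a relative cycle in the sheet of `g` is the translate by `g` of a relative
cycle in the sheet of `1`. The component in the fixed part has its boundary in the fixed skeleton.
-/
lemma exists_split {p : ℕ} [Fact p.Prime] (hG : Nat.card G = p) (s : ℕ) (m : CellChains X A s) :
    ∃ (t : FixChains G X A s) (f : G → CellChains X A s), (∀ g, f g ∈ sheetChains G X A s) ∧
      m = fixIncl G X A s t + ∑ g, cellAct A s g (f g) := by
  obtain ⟨z, rfl⟩ := relClass_surjective _ _ _ m
  obtain ⟨a, ha, hb⟩ := exists_sum_isRelCycle (sheets_inter hG s) (acyclicMod_sheets A s s) z.2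
  have h0 : IsRelCycle (fixSkel G X (s + 1)) (fixSkel G X s) (a none) := by
    rw [← fixSkel_inter_skel (n := s)]; exact ha none
  have h1 : ∀ g : G, IsRelCycle (sheet G X s g) (skel (Set.univ : Set X) s) (a (some g)) := by
    intro g
    have := ha (some g)
    change IsRelCycle (sheet G X s g) (sheet G X s g ∩ _) _ at this
    rwa [sheet_inter_skel] at this
  have h2 : ∀ g : G, IsRelCycle (sheet G X s 1) (skel (Set.univ : Set X) s)
      (chMap A (smulMap G g⁻¹) (a (some g))) := fun g => by
    have := isRelCycle_smul A (g := g⁻¹) (h1 g)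
    rwa [inv_mul_cancel] at this
  refine ⟨relClass A _ _ s ⟨_, h0⟩, fun g => relIncl A (sheets_subset (G := G) (X := X) s (some 1))
    (subset_refl _) s (relClass A _ _ s ⟨_, h2 g⟩), fun g => ⟨_, rfl⟩, ?_⟩
  have e : ∀ g : G, cellAct A s g (relIncl A (sheets_subset (G := G) (X := X) s (some 1))
      (subset_refl _) s (relClass A _ _ s ⟨_, h2 g⟩)) = relClass A _ _ s ⟨a (some g),
        IsRelCycle.mono (V := skel (Set.univ : Set X) s) (sheets_subset s (some g)) subset_rfl (h1 g)⟩ := fun g => by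
    rw [relIncl_relClass, relAct_relClass]
    congr 2
    change chMap A (smulMap G g) (chMap A (smulMap G g⁻¹) (a (some g))) = _
    rw [chMap_comp]
    have : (smulMap G g : C(X, X)).comp (smulMap G g⁻¹) = ContinuousMap.id X := by
      ext x; exact smul_inv_smul g x
    rw [this]
    exact lin_id _
  simp only [e]
  rw [fixIncl, relIncl_relClass, ← map_sum, ← map_add, relClass_eq_iff]
  rw [Fintype.sum_option] at hb
  convert hb using 2
  simp

/-- The translated cycles lie in different sheets. If their sum bounds, so does each of them in its
own sheet. -/
lemma split_indep {p : ℕ} [Fact p.Prime] (hG : Nat.card G = p) (s : ℕ) (t : FixChains G X A s)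
    (f : G → CellChains X A s) (hf : ∀ g, f g ∈ sheetChains G X A s)
    (h : fixIncl G X A s t + ∑ g, cellAct A s g (f g) = 0) : t = 0 ∧ ∀ g, f g = 0 := by
  choose b hb using hf
  choose c hc using fun g => relClass_surjective _ _ _ (b g)
  obtain ⟨z, rfl⟩ := relClass_surjective _ _ _ t
  obtain rfl : f = fun g => relClass A _ _ s ⟨(c g).1, IsRelCycle.mono
      (V := skel (Set.univ : Set X) s) (sheets_subset s (some 1)) subset_rfl (c g).2⟩ := by
    funext g
    rw [← hb, ← hc, relIncl_relClass]
  simp only [relAct_relClass] at h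
  rw [fixIncl, relIncl_relClass, ← map_sum, ← map_add, relClass_eq_zero_iff] at h
  let a : Option G → SCh A s X := fun o => o.elim z.1 fun g => chMap A (smulMap G g) (c g).1
  have hac : ∀ g : G, IsRelCycle (sheet G X s g) (skel (Set.univ : Set X) s) (a (some g)) :=
    fun g => by
      have := isRelCycle_smul A (g := g) (c g).2
      rwa [mul_one] at this
  have ha : ∀ k, a k ∈ chainsOn A (simpIn s (sheets G X s k)) := by
    rintro (_ | g)
    · exact z.2.1
    · exact (hac g).1
  have hs : IsRelBoundary (skel (Set.univ : Set X) (s + 1)) (skel (Set.univ : Set X) s)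
      (∑ k, a k) := by
    rw [Fintype.sum_option]
    convert h using 2
    simp [a]
  have key := isRelBoundary_of_sum (sheets_inter hG s) (acyclicMod_sheets A s (s + 1)) ha hs
  constructor
  · rw [relClass_eq_zero_iff]
    have := key none
    change IsRelBoundary (fixSkel G X (s + 1)) (fixSkel G X (s + 1) ∩ _) z.1 at this
    rwa [fixSkel_inter_skel] at this
  · intro g
    -- Only the translate `g · f g` is known to vanish so far; applying `g⁻¹` removes the
    -- translation.
    have h1 : cellAct A s g (relClass A _ _ s ⟨(c g).1, IsRelCycle.mono
      (V := skel (Set.univ : Set X) s) (sheets_subset s (some 1)) subset_rfl (c g).2⟩) = 0 := by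
      rw [relAct_relClass, relClass_eq_zero_iff]
      exact (key (some g)).mono (sheets_subset s (some g)) Set.inter_subset_right
    have h2 := (relRep A (G := G) (smul_mem_skeletonLT (X := X) G (s + 1)) (smul_mem_skeletonLT G s) s).inv_self_apply
      g (relClass A _ _ s ⟨(c g).1, IsRelCycle.mono
      (V := skel (Set.univ : Set X) s) (sheets_subset s (some 1)) subset_rfl (c g).2⟩)
    exact h2.symm.trans ((congrArg _ h1).trans (map_zero _))

lemma isSplit_cellular {p : ℕ} [Fact p.Prime] (hG : Nat.card G = p) (s : ℕ) :
    IsSplit ((cellularRepComplex G X A).X s) (fixIncl G X A s) (sheetChains G X A s) where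
  fix := cellAct_fixIncl A s
  span := exists_split A hG s
  indep := split_indep A hG s

end Splitting

end GCW

end

noncomputable section
namespace GCW

/-! ## The spectral sequence of the column filtration -/

section QuotientEquiv

variable {Z Q R : Type*} [AddCommGroup Z] [AddCommGroup Q] [AddCommGroup R]

lemma exists_addEquiv_of_ker_eq (φ : Z →+ Q) (ψ : Z →+ R) (hφ : Function.Surjective φ)
    (hψ : Function.Surjective ψ) (h : ∀ z, φ z = 0 ↔ ψ z = 0) :
    ∃ e : Q ≃+ R, ∀ z, e (φ z) = ψ z := by
  have hk : φ.ker = ψ.ker := by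
    ext z; exact h z
  refine ⟨(QuotientAddGroup.quotientKerEquivOfSurjective φ hφ).symm.trans
    ((QuotientAddGroup.quotientAddEquivOfEq hk).trans
      (QuotientAddGroup.quotientKerEquivOfSurjective ψ hψ)), fun z => ?_⟩
  have : (QuotientAddGroup.quotientKerEquivOfSurjective φ hφ).symm (φ z) =
      QuotientAddGroup.mk z := by
    rw [AddEquiv.symm_apply_eq]; rfl
  rw [AddEquiv.trans_apply, this]
  rfl

lemma mk_addSubgroupOf_eq_zero {K N : AddSubgroup Z} {z : K} :
    (QuotientAddGroup.mk z : K ⧸ N.addSubgroupOf K) = 0 ↔ z.1 ∈ N :=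
  (QuotientAddGroup.eq_zero_iff _).trans AddSubgroup.mem_addSubgroupOf

end QuotientEquiv

section SpectralSequence

variable {𝓐 : Type*} [Category* 𝓐] [Preadditive 𝓐] {P C : ChainComplex 𝓐 ℕ}

lemma totD_apply (f : Tot P C) (s q : ℕ) : totD P C f s q =
    f (s + 1) q ≫ C.d (s + 1) s + (-1 : ℤ) ^ s • (P.d q (q - 1) ≫ f s (q - 1)) := rfl

/-- The filtration indices are free variables subject to equations, so rearranged expressions for
the same integers can be used without transport. -/
lemma mem_cyc {r s t a n b : ℤ} (ha : a = s) (hn : n = s + t) (hb : b = s - r) {f : Tot P C} :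
    f ∈ cyc P C r s t ↔ f ∈ fil P C a n ∧ totD P C f ∈ fil P C b (n - 1) := by
  subst ha hn hb
  exact Iff.rfl

lemma mem_cycInf {s t n : ℤ} (hn : n = s + t) {f : Tot P C} :
    f ∈ cycInf P C s t ↔ f ∈ fil P C s n ∧ totD P C f = 0 := by
  subst hn
  exact Iff.rfl

lemma totD_mem_fil {a n : ℤ} {f : Tot P C} (hf : f ∈ fil P C a n) :
    totD P C f ∈ fil P C a (n - 1) := by
  intro s q h
  rw [totD_apply, hf (s + 1) q fun h' => h (by push_cast at h'; omega), Limits.zero_comp, zero_add]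
  rcases q with _ | q
  · simp
  · rw [hf s (q + 1 - 1) fun h' => h (by rw [Nat.add_sub_cancel] at h'; push_cast; omega),
      Limits.comp_zero, smul_zero]

lemma eq_zero_of_mem_fil {a n : ℤ} {f : Tot P C} (h : a < 0 ∨ a < n) (hf : f ∈ fil P C a n) :
    f = 0 := by
  funext s q
  exact hf s q (by omega)

lemma fil_le_tot (a n : ℤ) : fil P C a n ≤ tot P C n := fun _ hf s q h =>
  hf s q fun h' => h h'.1

lemma page_subsingleton (r : ℤ) {s t : ℤ} (h : s < 0 ∨ 0 < t) : Subsingleton (Page P C r s t) := by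
  refine ⟨fun x y => ?_⟩
  have h0 : ∀ x : Page P C r s t, x = 0 := fun x => by
    obtain ⟨⟨f, hf⟩, rfl⟩ := QuotientAddGroup.mk_surjective x
    obtain rfl := eq_zero_of_mem_fil (by omega) hf.1
    exact mk_addSubgroupOf_eq_zero.2 (zero_mem _)
  rw [h0 x, h0 y]

/-! #### Convergence -/

lemma totMk_eq_zero {n : ℤ} {z : ↥(tot P C n ⊓ (totD P C).ker)} :
    totMk P C n z = 0 ↔ z.1 ∈ (tot P C (n + 1)).map (totD P C) := mk_addSubgroupOf_eq_zero

lemma filHomology_neg (n : ℤ) : filHomology P C (-1) n = ⊥ := by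
  rw [eq_bot_iff]
  rintro _ ⟨z, hz, rfl⟩
  have : z.1 = 0 := eq_zero_of_mem_fil (by omega) hz
  rw [AddSubgroup.mem_bot, totMk_eq_zero, this]
  exact zero_mem _

lemma tot_le_fil {N : ℕ} (hN : ∀ s, N < s → ∀ q (f : P.X q ⟶ C.X s), f = 0) {n : ℤ} :
    tot P C n ≤ fil P C N n := fun f hf s q h => by
  by_cases h1 : (s : ℤ) - q = n
  · exact hN s (by omega) q _
  · exact hf s q h1

lemma filHomology_eq_top {N : ℕ} (hN : ∀ s, N < s → ∀ q (f : P.X q ⟶ C.X s), f = 0) (n : ℤ) :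
    filHomology P C N n = ⊤ := by
  rw [eq_top_iff]
  intro x _
  obtain ⟨z, rfl⟩ := QuotientAddGroup.mk_surjective x
  exact ⟨z, tot_le_fil hN z.2.1, rfl⟩

lemma grMk_surjective (s t : ℤ) : Function.Surjective (grMk P C s t) := by
  intro x
  obtain ⟨⟨_, z, hz, rfl⟩, rfl⟩ := QuotientAddGroup.mk_surjective x
  exact ⟨⟨z.1, hz, z.2.2⟩, rfl⟩

lemma grMk_eq_zero {s t : ℤ} {z : cycInf P C s t} :
    grMk P C s t z = 0 ↔ z.1 ∈ bdrInf P C s t := by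
  refine mk_addSubgroupOf_eq_zero.trans ?_
  have hst : s - 1 + (t + 1) = s + t := by ring
  constructor
  · rintro ⟨w, hw, hwz⟩
    have h : totMk P C (s + t) w = totMk P C (s + t) (AddSubgroup.inclusion (cycInf_le P C s t) z) :=
      hwz
    rw [← sub_eq_zero, ← map_sub, totMk_eq_zero, ← neg_mem_iff] at h
    have e : z.1 = w.1 + -(w - AddSubgroup.inclusion (cycInf_le P C s t) z).1 := by
      change z.1 = w.1 + -(w.1 - z.1)
      abel
    have hw' : w.1 ∈ fil P C (s - 1) (s + t) := hw
    rw [e]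
    refine add_mem (AddSubgroup.mem_sup_left ⟨by rwa [hst], w.2.2⟩)
      (AddSubgroup.mem_sup_right ⟨?_, h⟩)
    have : -(w - AddSubgroup.inclusion (cycInf_le P C s t) z).1 = z.1 - w.1 := by
      change -(w.1 - z.1) = z.1 - w.1
      abel
    rw [this]
    exact (fil P C s (s + t)).sub_mem ((mem_cycInf rfl).1 z.2).1 (fil_mono (by omega) hw')
  · intro h
    obtain ⟨a, ha, b, hb, hab⟩ := AddSubgroup.mem_sup.1 h
    have ha1 : a ∈ fil P C (s - 1) (s + t) := by rw [← hst]; exact ha.1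
    refine ⟨⟨a, fil_le_tot _ _ ha1, ha.2⟩, ha1, ?_⟩
    change _ = totMk P C (s + t) (AddSubgroup.inclusion (cycInf_le P C s t) z)
    rw [← sub_eq_zero, ← map_sub, totMk_eq_zero]
    change a - z.1 ∈ _
    rw [← hab, ← neg_mem_iff]
    simpa using hb.2

lemma converges {N : ℕ} (hN : ∀ s, N < s → ∀ q (f : P.X q ⟶ C.X s), f = 0) : Converges P C :=
  ⟨filHomology_neg, ⟨N, filHomology_eq_top hN⟩, fun s t =>
    exists_addEquiv_of_ker_eq (pageInfMk P C s t) (grMk P C s t)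
      (QuotientAddGroup.mk'_surjective _) (grMk_surjective s t) fun _ =>
      mk_addSubgroupOf_eq_zero.trans grMk_eq_zero.symm⟩

/-! #### Degeneration -/

/-- The decomposition known for `Z^2` improves itself for `f` in `Z^r`: in `f = z + a + D c` the
elements `a` and `f` have the same differential, so `a` lies in `Z^{r-1}`, and `c`, being in
filtration `s + 1` with `D c` in filtration `s`, is also admissible for larger `r`. -/
lemma cyc_le_sup (h : ∀ s t, cyc P C 2 s t ≤ cycInf P C s t ⊔ bdr P C 2 s t) {r : ℤ} (hr : 2 ≤ r)
    {s t : ℤ} {f : Tot P C} (hf : f ∈ cyc P C r s t) :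
    ∃ z ∈ cycInf P C s t, ∃ a ∈ cyc P C (r - 1) (s - 1) (t + 1),
      ∃ c ∈ cyc P C (r - 1) (s + r - 1) (t - r + 2), f = z + (a + totD P C c) := by
  rw [mem_cyc rfl rfl rfl] at hf
  obtain ⟨z, hz, b, hb, rfl⟩ := AddSubgroup.mem_sup.1
    (h s t ((mem_cyc rfl rfl rfl).2 ⟨hf.1, fil_mono (by omega) hf.2⟩))
  obtain ⟨a, ha, _, ⟨c, hc, rfl⟩, rfl⟩ := AddSubgroup.mem_sup.1 hb
  have hc' := (mem_cyc rfl (n := s + t + 1) (by ring) (b := s) (by ring)).1 hc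
  have ha' := (mem_cyc rfl (n := s + t) (by ring) rfl).1 ha
  have hf2 := hf.2
  rw [map_add, map_add, totD_totD, ((mem_cycInf rfl).1 hz).2, zero_add, add_zero] at hf2
  refine ⟨z, hz, a, (mem_cyc rfl (n := s + t) (by ring) (b := s - r) (by ring)).2 ⟨ha'.1, hf2⟩, c,
    (mem_cyc rfl (n := s + t + 1) (by ring) (b := s) (by ring)).2
      ⟨fil_mono (by omega) hc'.1, hc'.2⟩, rfl⟩

lemma pageD_eq_zero (h : ∀ s t, cyc P C 2 s t ≤ cycInf P C s t ⊔ bdr P C 2 s t) {r : ℤ}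
    (hr : 2 ≤ r) (s t s' t' : ℤ) (hs : s' = s - r) (ht : t' = t + r - 1) :
    pageD P C r s t s' t' hs ht = 0 := by
  subst hs ht
  refine AddMonoidHom.ext fun x => ?_
  obtain ⟨⟨f, hf⟩, rfl⟩ := QuotientAddGroup.mk_surjective x
  refine mk_addSubgroupOf_eq_zero.2 ?_
  change totD P C f ∈ bdr P C r (s - r) (t + r - 1)
  obtain ⟨z, hz, a, ha, c, -, rfl⟩ := cyc_le_sup h hr hf
  rw [map_add, map_add, totD_totD, show totD P C z = 0 from hz.2, zero_add, add_zero]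
  refine AddSubgroup.mem_sup_right (AddSubgroup.mem_map_of_mem _ ?_)
  exact (mem_cyc (a := s - 1) (n := s + t) (b := s - r) (by ring) (by ring) (by ring)).2
    ((mem_cyc rfl (by ring) (by ring)).1 ha)

/-- If `D w` lies in filtration `s`, the decomposition of `w` allows a permanent cycle and a
boundary to be removed without changing `D w`. This lowers the filtration of `w` by one, and it
continues down to filtration `s + 1`. -/
lemma totD_mem_map_cyc (h : ∀ s t, cyc P C 2 s t ≤ cycInf P C s t ⊔ bdr P C 2 s t) {s t : ℤ}
    (k : ℕ) : ∀ w ∈ fil P C (s + 1 + k) (s + t + 1), totD P C w ∈ fil P C s (s + t) →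
      totD P C w ∈ (cyc P C 1 (s + 1) t).map (totD P C) := by
  induction k with
  | zero =>
    intro w hw hw'
    exact AddSubgroup.mem_map_of_mem _ ((mem_cyc (a := s + 1 + (0 : ℕ)) (n := s + t + 1) (b := s)
      (by simp) (by ring) (by ring)).2 ⟨hw, by rwa [add_sub_cancel_right]⟩)
  | succ k ih =>
    intro w hw hw'
    have hwc : w ∈ cyc P C (k + 2) (s + 1 + (k + 1 : ℕ)) (t - (k + 1 : ℕ)) :=
      (mem_cyc (n := s + t + 1) (b := s) rfl (by push_cast; ring) (by push_cast; ring)).2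
        ⟨hw, by rwa [add_sub_cancel_right]⟩
    obtain ⟨z, hz, a, ha, c, -, rfl⟩ := cyc_le_sup h (by omega) hwc
    rw [map_add, map_add, totD_totD, ((mem_cycInf rfl).1 hz).2, zero_add, add_zero] at hw' ⊢
    exact ih a ((mem_cyc (a := s + 1 + k) (n := s + t + 1) (by push_cast; ring) (by push_cast; ring)
      rfl).1 ha).1 hw'

/-- No boundary appears after `E^2`: since the columns are bounded, every `w` has finite filtration,
and the descent above replaces it by an element of filtration `s + 1`. -/
lemma mem_bdr_two_iff (h : ∀ s t, cyc P C 2 s t ≤ cycInf P C s t ⊔ bdr P C 2 s t) {N : ℕ}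
    (hN : ∀ s, N < s → ∀ q (f : P.X q ⟶ C.X s), f = 0) {s t : ℤ} {z : Tot P C}
    (hz : z ∈ cycInf P C s t) : z ∈ bdr P C 2 s t ↔ z ∈ bdrInf P C s t := by
  constructor
  · intro hb
    obtain ⟨a, ha, _, ⟨c, hc, rfl⟩, rfl⟩ := AddSubgroup.mem_sup.1 hb
    have hz2 := ((mem_cycInf rfl).1 hz).2
    rw [map_add, totD_totD, add_zero] at hz2
    have hc' := (mem_cyc rfl (n := s + t + 1) (by ring) (b := s) (by ring)).1 hc
    rw [add_sub_cancel_right] at hc'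
    exact add_mem (AddSubgroup.mem_sup_left ⟨ha.1, hz2⟩)
      (AddSubgroup.mem_sup_right ⟨hc'.2, AddSubgroup.mem_map_of_mem _ (fil_le_tot _ _ hc'.1)⟩)
  · intro hb
    obtain ⟨a, ha, _, ⟨hw, w, hwt, rfl⟩, rfl⟩ := AddSubgroup.mem_sup.1 hb
    refine add_mem (AddSubgroup.mem_sup_left (cycInf_le_cyc _ _ _ _ _ ha))
      (AddSubgroup.mem_sup_right ?_)
    have h1 := totD_mem_map_cyc h (s := s) (t := t) (N + s.natAbs) w
      (fil_mono (by omega) (tot_le_fil hN hwt)) hw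
    obtain ⟨c, hc, hcw⟩ := h1
    exact ⟨c, (mem_cyc rfl (n := s + t + 1) (b := s) (by ring) (by ring)).2
      ((mem_cyc (a := s + 2 - 1) (by ring) (by ring) (by ring)).1 hc), hcw⟩

lemma degeneratesAtE2 (h : ∀ s t, cyc P C 2 s t ≤ cycInf P C s t ⊔ bdr P C 2 s t) {N : ℕ}
    (hN : ∀ s, N < s → ∀ q (f : P.X q ⟶ C.X s), f = 0) : DegeneratesAtE2 P C := by
  refine ⟨fun r s t s' t' hr hs ht => pageD_eq_zero h hr s t s' t' hs ht, fun s t =>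
    exists_addEquiv_of_ker_eq (pageMk P C 2 s t) (pageInfMk P C s t) ?_
      (QuotientAddGroup.mk'_surjective _) fun z => ?_⟩
  · intro x
    obtain ⟨⟨f, hf⟩, rfl⟩ := QuotientAddGroup.mk_surjective x
    obtain ⟨z, hz, b, hb, rfl⟩ := AddSubgroup.mem_sup.1 (h s t hf)
    refine ⟨⟨z, hz⟩, ?_⟩
    rw [← sub_eq_zero]
    refine mk_addSubgroupOf_eq_zero.2 ?_
    change z - (z + b) ∈ bdr P C 2 s t
    simpa using hb
  · exact mk_addSubgroupOf_eq_zero.trans ((mem_bdr_two_iff h hN z.2).trans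
      mk_addSubgroupOf_eq_zero.symm)

/-! #### Leading terms -/

/-- The element of the total complex with a single component. -/
def single (s q : ℕ) (f : P.X q ⟶ C.X s) : Tot P C := Pi.single s (Pi.single q f)

lemma single_same (s q : ℕ) (f : P.X q ⟶ C.X s) : single s q f s q = f := by
  simp [single]

lemma single_of_ne {s q i j : ℕ} (f : P.X q ⟶ C.X s) (h : ¬ (i = s ∧ j = q)) :
    single s q f i j = 0 := by
  by_cases hi : i = s
  · subst hi
    rw [single, Pi.single_eq_same, Pi.single_eq_of_ne fun hj => h ⟨rfl, hj⟩]
  · rw [single, Pi.single_eq_of_ne hi]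
    rfl

lemma single_mem_fil {s q : ℕ} (f : P.X q ⟶ C.X s) {a n : ℤ} (ha : s ≤ a) (hn : (s : ℤ) - q = n) :
    single s q f ∈ fil P C a n := fun i j h =>
  single_of_ne f fun h' => h (by obtain ⟨rfl, rfl⟩ := h'; exact ⟨hn, ha⟩)

lemma mem_fil_pred {s q : ℕ} {n : ℤ} (hn : (s : ℤ) - q = n) {f : Tot P C} (hf : f ∈ fil P C s n)
    (h : f s q = 0) : f ∈ fil P C (s - 1) n := fun i j hij => by
  by_cases hs : i = s ∧ j = q
  · obtain ⟨rfl, rfl⟩ := hs; exact h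
  · exact hf i j (by omega)

lemma d_comp_lead {r : ℤ} (hr : 0 < r) {s q : ℕ} {f : Tot P C} (hf : f ∈ cyc P C r s (-q)) :
    P.d (q + 1) q ≫ f s q = 0 := by
  have h1 := hf.2 s (q + 1) (by omega)
  rw [totD_apply, hf.1 (s + 1) (q + 1) (by push_cast; omega), Limits.zero_comp, zero_add] at h1
  rcases neg_one_pow_eq_or ℤ s with h | h <;> rw [h] at h1 <;> simpa using h1

lemma neg_one_pow_smul_smul {B : Type*} [AddCommGroup B] (s : ℕ) (b : B) :
    (-1 : ℤ) ^ s • (-1 : ℤ) ^ s • b = b := by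
  rcases neg_one_pow_eq_or ℤ s with h | h <;> rw [h] <;> simp

lemma lead_comp_d {s q : ℕ} {f : Tot P C} (hf : f ∈ cyc P C 2 s (-q)) :
    ∃ e : P.X (q - 1) ⟶ C.X (s - 1), f s q ≫ C.d s (s - 1) = P.d q (q - 1) ≫ e := by
  rcases s with _ | s
  · exact ⟨0, by simp⟩
  · have h1 := hf.2 s q (by push_cast; omega)
    rw [totD_apply, add_eq_zero_iff_eq_neg] at h1
    exact ⟨-((-1 : ℤ) ^ s • f s (q - 1)), by
      rw [Preadditive.comp_neg, Preadditive.comp_zsmul]; exact h1⟩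

/-- The horizontal boundary of `f` is cancelled by the vertical coboundary of a correction in the
preceding column. For `s = 0` or `q = 0` there is no such column or row; there the truncated index
makes the differential in question zero. -/
lemma exists_cyc_lead {s q : ℕ} {f : P.X q ⟶ C.X s} (h : P.d (q + 1) q ≫ f = 0)
    {e : P.X (q - 1) ⟶ C.X (s - 1)} (he : f ≫ C.d s (s - 1) = P.d q (q - 1) ≫ e) :
    ∃ g ∈ cyc P C 2 s (-q), g s q = f := by
  have hf1 : single s q f ∈ fil P C s (s + -q) := single_mem_fil f le_rfl (by ring)
  have hd : ∀ j, P.d j (j - 1) ≫ single s q f s (j - 1) = 0 := fun j => by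
    by_cases hj : j - 1 = q
    · rcases j with _ | j
      · simp
      · obtain rfl : j = q := by omega
        exact (congrArg (P.d (j + 1) j ≫ ·) (single_same s j f)).trans h
    · rw [single_of_ne _ (by omega), Limits.comp_zero]
  rcases Nat.eq_zero_or_pos s with rfl | hs
  · refine ⟨_, (mem_cyc rfl rfl rfl).2 ⟨hf1, fun i j hij => ?_⟩, single_same 0 q f⟩
    by_cases hi : i = 0
    · subst hi
      rw [totD_apply, hd, single_of_ne _ (by omega)]; simp
    · rw [totD_apply, single_of_ne _ (by omega), single_of_ne _ (by omega)]; simp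
  rcases Nat.eq_zero_or_pos q with rfl | hq
  · refine ⟨_, (mem_cyc rfl rfl rfl).2 ⟨hf1, fun i j hij => ?_⟩, single_same s 0 f⟩
    by_cases hi : i = s
    · subst hi
      rw [totD_apply, hd, single_of_ne _ (by omega)]; simp
    · rw [totD_apply, single_of_ne (i := i) _ (by omega), Limits.comp_zero, smul_zero, add_zero]
      by_cases hij' : i + 1 = s ∧ j = 0
      · obtain ⟨rfl, rfl⟩ := hij'
        rw [single_same]
        exact he.trans (by simp)
      · rw [single_of_ne _ hij', Limits.zero_comp]
  obtain ⟨s, rfl⟩ : ∃ k, s = k + 1 := ⟨s - 1, by omega⟩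
  obtain ⟨q, rfl⟩ : ∃ k, q = k + 1 := ⟨q - 1, by omega⟩
  have he' : f ≫ C.d (s + 1) s = P.d (q + 1) q ≫ e := he
  -- The factor `(-1) ^ s` compensates the sign of the vertical differential in column `s`.
  refine ⟨single (s + 1) (q + 1) f - single s q ((-1 : ℤ) ^ s • e), (mem_cyc rfl rfl rfl).2
    ⟨sub_mem hf1 (single_mem_fil _ (by push_cast; omega) (by push_cast; ring)), fun i j hij => ?_⟩, ?_⟩
  · rw [map_sub, Pi.sub_apply, Pi.sub_apply, totD_apply, totD_apply]
    by_cases hi : i = s + 1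
    · subst hi
      rw [hd, single_of_ne _ (by omega), single_of_ne _ (by omega), single_of_ne _ (by omega)]
      simp
    rw [single_of_ne (i := i) (s := s + 1) _ (by omega), single_of_ne (i := i + 1) (s := s) _ (by omega)]
    by_cases hi' : i = s ∧ j = q + 1
    · obtain ⟨rfl, rfl⟩ := hi'
      rw [single_same, Limits.comp_zero, smul_zero, add_zero, Limits.zero_comp, zero_add, he']
      have : single i q ((-1 : ℤ) ^ i • e) i (q + 1 - 1) = (-1 : ℤ) ^ i • e := single_same _ _ _
      rw [this, Preadditive.comp_zsmul, neg_one_pow_smul_smul]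
      exact sub_self _
    · rw [single_of_ne _ (by omega), Limits.comp_zero, smul_zero, add_zero, Limits.zero_comp,
        zero_add, zero_sub, neg_eq_zero]
      by_cases hi2 : i = s ∧ j - 1 = q
      · obtain rfl : j = 0 := by omega
        simp
      · rw [single_of_ne _ hi2, Limits.comp_zero, smul_zero]
  · rw [Pi.sub_apply, Pi.sub_apply, single_same, single_of_ne _ (by omega), sub_zero]

/-- An element of `Z^2` whose leading term is a coboundary up to the boundary of a cocycle is zero
in `E^2`. -/
lemma mem_bdr_two_of_lead {s q : ℕ} {f : Tot P C} (hf : f ∈ cyc P C 2 s (-q))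
    {g : P.X q ⟶ C.X (s + 1)} (hg : P.d (q + 1) q ≫ g = 0) {e : P.X (q - 1) ⟶ C.X s}
    (h : f s q = g ≫ C.d (s + 1) s + P.d q (q - 1) ≫ e) : f ∈ bdr P C 2 s (-q) := by
  have hd : ∀ j, P.d j (j - 1) ≫ single (s + 1) q g (s + 1) (j - 1) = 0 := fun j => by
    by_cases hj : j - 1 = q
    · rcases j with _ | j
      · simp
      · obtain rfl : j = q := by omega
        exact (congrArg (P.d (j + 1) j ≫ ·) (single_same _ _ _)).trans hg
    · rw [single_of_ne _ (by omega), Limits.comp_zero]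
  -- The element `c` has `g` in column `s + 1` and `e`, up to sign, in column `s`. Its differential
  -- has the same leading term as `f`, so `f - D c` falls into column `s - 1`.
  have key : ∃ c ∈ cyc P C 1 (s + 1) (-q), totD P C c s q = f s q := by
    rcases Nat.eq_zero_or_pos q with rfl | hq
    · refine ⟨single (s + 1) 0 g, (mem_cyc (n := s + 1) (b := s) rfl (by simp) (by ring)).2
        ⟨single_mem_fil _ (by push_cast; rfl) (by push_cast; ring), fun i j hij => ?_⟩, ?_⟩
      · rw [totD_apply]
        by_cases hi : i = s + 1
        · subst hi
          rw [hd, single_of_ne _ (by omega)]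
          simp
        · rw [single_of_ne (i := i) _ (by omega), single_of_ne _ (by omega)]
          simp
      · rw [totD_apply, single_same, single_of_ne _ (by omega), h]
        simp
    · obtain ⟨q, rfl⟩ : ∃ k, q = k + 1 := ⟨q - 1, by omega⟩
      refine ⟨single (s + 1) (q + 1) g + single s q ((-1 : ℤ) ^ s • e),
        (mem_cyc (n := (s : ℤ) - q) (b := s) (a := s + 1) rfl (by push_cast; ring) (by ring)).2
        ⟨add_mem (single_mem_fil _ (by push_cast; rfl) (by push_cast; ring))
          (single_mem_fil _ (by omega) (by ring)), fun i j hij => ?_⟩, ?_⟩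
      · rw [map_add, Pi.add_apply, Pi.add_apply, totD_apply, totD_apply]
        by_cases hi : i = s + 1
        · subst hi
          rw [hd, single_of_ne _ (by omega), single_of_ne _ (by omega), single_of_ne _ (by omega)]
          simp
        · rw [single_of_ne (i := i) (s := s + 1) _ (by omega),
            single_of_ne (i := i + 1) (s := s + 1) _ (by omega),
            single_of_ne (i := i + 1) (s := s) _ (by omega)]
          by_cases hi2 : i = s ∧ j - 1 = q
          · obtain ⟨rfl, hj⟩ := hi2
            rcases j with _ | j
            · simp
            · omega
          · rw [single_of_ne _ hi2]
            simp
      · rw [map_add, Pi.add_apply, Pi.add_apply, totD_apply, totD_apply, single_same,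
          single_of_ne _ (by omega), single_of_ne _ (by omega)]
        have : single s q ((-1 : ℤ) ^ s • e) s (q + 1 - 1) = (-1 : ℤ) ^ s • e := single_same _ _ _
        rw [this, Preadditive.comp_zsmul, neg_one_pow_smul_smul, h]
        simp
  obtain ⟨c, hc, hcf⟩ := key
  have hc' := (mem_cyc rfl (n := (s : ℤ) + -q + 1) (b := s) (by ring) (by ring)).1 hc
  rw [add_sub_cancel_right] at hc'
  have hf' := (mem_cyc rfl rfl rfl).1 hf
  refine AddSubgroup.mem_sup.2 ⟨f - totD P C c, ?_, totD P C c, AddSubgroup.mem_map_of_mem _ ?_,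
    sub_add_cancel _ _⟩
  · refine (mem_cyc rfl (n := (s : ℤ) + -q) (b := s - 2) (by ring) (by ring)).2 ⟨?_, ?_⟩
    · refine mem_fil_pred (q := q) (by ring) (sub_mem hf'.1 hc'.2) ?_
      rw [Pi.sub_apply, Pi.sub_apply, hcf, sub_self]
    · rw [map_sub, totD_totD, sub_zero]
      exact hf'.2
  · exact (mem_cyc (a := s + 1) (n := s + -q + 1) (b := s) (by ring) (by ring) (by ring)).2
      ((mem_cyc rfl (by ring) (by ring)).1 hc)

/-- The leading term of a boundary of `Z^2`. -/
lemma exists_of_mem_bdr_two {s q : ℕ} {f : Tot P C} (hf : f ∈ bdr P C 2 s (-q)) :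
    ∃ g : P.X q ⟶ C.X (s + 1), P.d (q + 1) q ≫ g = 0 ∧
      ∃ e : P.X (q - 1) ⟶ C.X s, f s q = g ≫ C.d (s + 1) s + P.d q (q - 1) ≫ e := by
  obtain ⟨a, ha, _, ⟨c, hc, rfl⟩, rfl⟩ := AddSubgroup.mem_sup.1 hf
  have hc' : c ∈ cyc P C 1 (s + 1 : ℕ) (-q) :=
    (mem_cyc (a := s + 2 - 1) (n := s + -q + 1) (b := s) (by push_cast; ring) (by push_cast; ring)
      (by push_cast; ring)).2 ((mem_cyc rfl (by ring) (by ring)).1 hc)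
  refine ⟨c (s + 1) q, d_comp_lead one_pos hc', (-1 : ℤ) ^ s • c s (q - 1), ?_⟩
  have ha' := (mem_cyc rfl rfl rfl).1 ha
  rw [Pi.add_apply, Pi.add_apply, ha'.1 s q (by omega), zero_add, totD_apply,
    Preadditive.comp_zsmul]

/-- The leading term of an element of `D(Z^0)`. -/
lemma exists_of_mem_bdr_one {s q : ℕ} {f : Tot P C} (hf : f ∈ bdr P C 1 s (-q)) :
    ∃ e : P.X (q - 1) ⟶ C.X s, f s q = P.d q (q - 1) ≫ e := by
  obtain ⟨a, ha, _, ⟨c, hc, rfl⟩, rfl⟩ := AddSubgroup.mem_sup.1 hf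
  have hc' := ((mem_cyc (a := s) (by ring) rfl rfl).1 hc).1
  refine ⟨(-1 : ℤ) ^ s • c s (q - 1), ?_⟩
  have ha' := (mem_cyc rfl rfl rfl).1 ha
  rw [Pi.add_apply, Pi.add_apply, ha'.1 s q (by omega), zero_add, totD_apply,
    Preadditive.comp_zsmul, hc' (s + 1) q (by push_cast; omega), Limits.zero_comp, zero_add]

lemma mem_bdr_one_of_lead {s q : ℕ} {f : Tot P C} (hf : f ∈ cyc P C 1 s (-q))
    {e : P.X (q - 1) ⟶ C.X s} (h : f s q = P.d q (q - 1) ≫ e) : f ∈ bdr P C 1 s (-q) := by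
  have key : ∃ c ∈ fil P C s (s + -q + 1), totD P C c s q = f s q := by
    rcases Nat.eq_zero_or_pos q with rfl | hq
    · refine ⟨0, zero_mem _, ?_⟩
      rw [h]; simp
    · refine ⟨single s (q - 1) ((-1 : ℤ) ^ s • e), single_mem_fil _ le_rfl (by omega), ?_⟩
      rw [totD_apply, single_same, single_of_ne _ (by omega), h, Preadditive.comp_zsmul,
        neg_one_pow_smul_smul]
      simp
  obtain ⟨c, hc, hcf⟩ := key
  have hDc := totD_mem_fil hc
  rw [add_sub_cancel_right] at hDc
  have hf' := (mem_cyc rfl rfl rfl).1 hf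
  refine AddSubgroup.mem_sup.2 ⟨f - totD P C c, ?_, totD P C c, AddSubgroup.mem_map_of_mem _ ?_,
    sub_add_cancel _ _⟩
  · refine (mem_cyc rfl (n := (s : ℤ) + -q) (b := s - 1) (by ring) (by ring)).2 ⟨?_, ?_⟩
    · refine mem_fil_pred (q := q) (by ring) (sub_mem hf'.1 hDc) ?_
      rw [Pi.sub_apply, Pi.sub_apply, hcf, sub_self]
    · rw [map_sub, totD_totD, sub_zero]
      exact hf'.2
  · refine (mem_cyc (a := s) (n := s + -q + 1) (b := s) (by ring) (by ring) (by ring)).2 ⟨hc, ?_⟩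
    rwa [add_sub_cancel_right]

lemma single_mem_cyc_one {s q : ℕ} {f : P.X q ⟶ C.X s} (h : P.d (q + 1) q ≫ f = 0) :
    single s q f ∈ cyc P C 1 s (-q) := by
  refine (mem_cyc rfl rfl rfl).2 ⟨single_mem_fil f le_rfl (by ring), fun i j hij => ?_⟩
  rw [totD_apply]
  by_cases hi : i = s
  · subst hi
    rw [single_of_ne _ (by omega), Limits.zero_comp, zero_add]
    by_cases hj : j - 1 = q
    · rcases j with _ | j
      · simp
      · obtain rfl : j = q := by omega
        have := (congrArg (P.d (j + 1) j ≫ ·) (single_same i j f)).trans h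
        refine (congrArg _ this).trans (smul_zero _)
    · rw [single_of_ne _ (by omega), Limits.comp_zero, smul_zero]
  · rw [single_of_ne (i := i) _ (by omega), Limits.comp_zero, smul_zero, add_zero]
    rw [single_of_ne _ (by omega), Limits.zero_comp]

end SpectralSequence

end GCW

end

noncomputable section
namespace GCW

/-! ## Homology classes and the pages in terms of cocycles -/

section HomologyClasses

variable {R : Type} [Ring R] {κ : Type} {c : ComplexShape κ}
  (K L : HomologicalComplex (ModuleCat.{0} R) c) (j : κ)

/-- The group of cycles of a complex of abelian groups. -/
def cyclesGroup : AddSubgroup (K.X j) := (K.d j (c.next j)).hom.toAddMonoidHom.ker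

/-- The homology class of a cycle. -/
def homClass : cyclesGroup K j →+ K.homology j :=
  ((K.sc j).moduleCatCyclesIso.inv ≫ K.homologyπ j).hom.toAddMonoidHom.comp
    (AddMonoidHom.mk' (fun z => (⟨z.1, z.2⟩ : LinearMap.ker (K.sc j).g.hom)) fun _ _ => rfl)

lemma homClass_surjective : Function.Surjective (homClass K j) := by
  intro x
  obtain ⟨y, rfl⟩ := (ModuleCat.epi_iff_surjective (K.homologyπ j)).1 inferInstance x
  obtain ⟨z, rfl⟩ := (ModuleCat.epi_iff_surjective (K.sc j).moduleCatCyclesIso.inv).1 inferInstance y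
  exact ⟨⟨z.1, z.2⟩, rfl⟩

lemma homClass_eq_zero_iff {z : cyclesGroup K j} :
    homClass K j z = 0 ↔ ∃ w, (K.d (c.prev j) j).hom w = z.1 := by
  have h := congrArg (fun f => f.hom (⟨z.1, z.2⟩ : LinearMap.ker (K.sc j).g.hom))
    (K.sc j).moduleCatCyclesIso_inv_π
  have h1 : homClass K j z = (K.sc j).moduleCatHomologyIso.inv.hom
      ((K.sc j).moduleCatLeftHomologyData.π.hom ⟨z.1, z.2⟩) := h
  have h2 := (ModuleCat.mono_iff_injective (K.sc j).moduleCatHomologyIso.inv).1 inferInstance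
  rw [h1]
  constructor
  · intro h0
    have h3 := h2 (h0.trans (map_zero (K.sc j).moduleCatHomologyIso.inv.hom).symm)
    obtain ⟨w, hw⟩ := (Submodule.Quotient.mk_eq_zero _).1 h3
    exact ⟨w, congrArg Subtype.val hw⟩
  · rintro ⟨w, hw⟩
    have h3 : (K.sc j).moduleCatLeftHomologyData.π.hom ⟨z.1, z.2⟩ = 0 :=
      (Submodule.Quotient.mk_eq_zero _).2 ⟨w, Subtype.ext hw⟩
    exact (congrArg (fun x => (K.sc j).moduleCatHomologyIso.inv.hom x) h3).trans (map_zero _)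

variable {K L}

lemma map_mem_cyclesGroup (φ : K ⟶ L) (z : cyclesGroup K j) : (φ.f j).hom z.1 ∈ cyclesGroup L j := by
  have h := congrArg (fun f => f.hom z.1) (φ.comm j (c.next j))
  refine h.trans ?_
  exact (congrArg (fun x => (φ.f (c.next j)).hom x) z.2).trans (map_zero _)

lemma homClass_map (φ : K ⟶ L) (z : cyclesGroup K j) :
    (HomologicalComplex.homologyMap φ j).hom (homClass K j z) =
      homClass L j ⟨(φ.f j).hom z.1, map_mem_cyclesGroup j φ z⟩ := by
  have h1 := congrArg (fun f => f.hom ((K.sc j).moduleCatCyclesIso.inv.hom ⟨z.1, z.2⟩))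
    (HomologicalComplex.homologyπ_naturality φ j)
  refine h1.trans ?_
  refine congrArg (fun x => (L.homologyπ j).hom x) ?_
  apply (ModuleCat.mono_iff_injective (L.iCycles j)).1 inferInstance
  have h2 := congrArg (fun f => f.hom ((K.sc j).moduleCatCyclesIso.inv.hom ⟨z.1, z.2⟩))
    (HomologicalComplex.cyclesMap_i φ j)
  refine h2.trans ?_
  have h3 := congrArg (fun f => f.hom (⟨z.1, z.2⟩ : LinearMap.ker (K.sc j).g.hom))
    (K.sc j).moduleCatCyclesIso_inv_iCycles
  have h4 := congrArg (fun f => f.hom (⟨_, map_mem_cyclesGroup j φ z⟩ : LinearMap.ker (L.sc j).g.hom))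
    (L.sc j).moduleCatCyclesIso_inv_iCycles
  exact (congrArg (fun x => (φ.f j).hom x) h3).trans h4.symm

end HomologyClasses

/-! ### The pages as groups of cocycles. -/

section Cocycles

variable {𝓐 : Type*} [Category* 𝓐] [Preadditive 𝓐] (P : ChainComplex 𝓐 ℕ) (M : 𝓐) (q : ℕ)

/-- The cocycles of the complex `Hom(P, M)`. -/
def cocyc : AddSubgroup (P.X q ⟶ M) where
  carrier := {f | P.d (q + 1) q ≫ f = 0}
  zero_mem' := Limits.comp_zero
  add_mem' {f g} hf hg := by
    change P.d (q + 1) q ≫ (f + g) = 0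
    rw [Preadditive.comp_add, show P.d (q + 1) q ≫ f = 0 from hf,
      show P.d (q + 1) q ≫ g = 0 from hg, add_zero]
  neg_mem' {f} hf := by
    change P.d (q + 1) q ≫ (-f) = 0
    rw [Preadditive.comp_neg, show P.d (q + 1) q ≫ f = 0 from hf, neg_zero]

variable {P M q}

lemma mem_cocyc {f : P.X q ⟶ M} : f ∈ cocyc P M q ↔ P.d (q + 1) q ≫ f = 0 := Iff.rfl

lemma comp_mem_cocyc {N : 𝓐} {f : P.X q ⟶ M} (hf : f ∈ cocyc P M q) (φ : M ⟶ N) :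
    f ≫ φ ∈ cocyc P N q := by
  rw [mem_cocyc, ← Category.assoc, mem_cocyc.1 hf, Limits.zero_comp]

lemma pull_mem_cocyc {P' : ChainComplex 𝓐 ℕ} (α : P' ⟶ P) {f : P.X q ⟶ M} (hf : f ∈ cocyc P M q) :
    α.f q ≫ f ∈ cocyc P' M q := by
  rw [mem_cocyc, ← α.comm_assoc, mem_cocyc.1 hf, Limits.comp_zero]

lemma exists_of_homotopy {φ : P ⟶ P} (h : Homotopy φ (𝟙 P)) {f : P.X q ⟶ M}
    (hf : f ∈ cocyc P M q) : ∃ e : P.X (q - 1) ⟶ M, φ.f q ≫ f = f + P.d q (q - 1) ≫ e := by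
  have h1 := h.comm q
  have h2 : prevD q h.hom = h.hom q (q + 1) ≫ P.d (q + 1) q := Homotopy.prevD_chainComplex _ _
  rcases q with _ | q
  · refine ⟨0, ?_⟩
    have h3 : dNext 0 h.hom = 0 := Homotopy.dNext_zero_chainComplex _
    rw [h1, h2, h3, zero_add, Preadditive.add_comp, Category.assoc, mem_cocyc.1 hf]
    simp
  · have h3 : dNext (q + 1) h.hom = P.d (q + 1) q ≫ h.hom q (q + 1) :=
      Homotopy.dNext_succ_chainComplex _ _
    refine ⟨h.hom q (q + 1) ≫ f, ?_⟩
    rw [h1, h2, h3, Preadditive.add_comp, Preadditive.add_comp, Category.assoc, Category.assoc,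
      mem_cocyc.1 hf, HomologicalComplex.id_f, Category.id_comp, Limits.comp_zero, add_zero]
    exact add_comm _ _

variable {C : ChainComplex 𝓐 ℕ} {s : ℕ}

/-- The class in `E^1` depends only on the leading term, any cocycle occurs as a leading term, and
the class is zero exactly when this cocycle is a coboundary. -/
lemma exists_pageOneEquiv {H : Type*} [AddCommGroup H] (h : cocyc P (C.X s) q →+ H)
    (hs : Function.Surjective h) (h0 : ∀ f, h f = 0 ↔ ∃ e : P.X (q - 1) ⟶ C.X s,
      f.1 = P.d q (q - 1) ≫ e) :
    ∃ φ : Page P C 1 s (-q) ≃+ H, ∀ (f : cyc P C 1 s (-q)),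
      φ (QuotientAddGroup.mk f) = h ⟨f.1 s q, d_comp_lead one_pos f.2⟩ := by
  let lead : cyc P C 1 s (-q) →+ cocyc P (C.X s) q :=
    AddMonoidHom.mk' (fun f => ⟨f.1 s q, d_comp_lead one_pos f.2⟩) fun _ _ => rfl
  have hl : Function.Surjective lead := fun f =>
    ⟨⟨single s q f.1, single_mem_cyc_one f.2⟩, Subtype.ext (single_same s q f.1)⟩
  obtain ⟨φ, hφ⟩ := exists_addEquiv_of_ker_eq
    (QuotientAddGroup.mk' ((bdr P C 1 s (-q)).addSubgroupOf (cyc P C 1 s (-q)))) (h.comp lead)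
    (QuotientAddGroup.mk'_surjective _) (hs.comp hl) fun f => by
      refine mk_addSubgroupOf_eq_zero.trans ((Iff.trans ?_ (h0 (lead f)).symm))
      exact ⟨exists_of_mem_bdr_one, fun ⟨e, he⟩ => mem_bdr_one_of_lead f.2 he⟩
  exact ⟨φ, hφ⟩

/-- The vertical cocycles `f` such that the class of `∂ f` is zero, the cycles of `E^1`. -/
def cocycTwo (P C : ChainComplex 𝓐 ℕ) (s q : ℕ) : AddSubgroup (P.X q ⟶ C.X s) where
  carrier := {f | f ∈ cocyc P (C.X s) q ∧
    ∃ e : P.X (q - 1) ⟶ C.X (s - 1), f ≫ C.d s (s - 1) = P.d q (q - 1) ≫ e}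
  zero_mem' := ⟨zero_mem _, 0, by simp⟩
  add_mem' := by
    rintro f g ⟨hf, e, he⟩ ⟨hg, e', he'⟩
    exact ⟨add_mem hf hg, e + e', by rw [Preadditive.add_comp, Preadditive.comp_add, he, he']⟩
  neg_mem' := by
    rintro f ⟨hf, e, he⟩
    exact ⟨neg_mem hf, -e, by rw [Preadditive.neg_comp, Preadditive.comp_neg, he]⟩

/-- Taking leading terms identifies `E^2` with a quotient of `cocycTwo`. The group `T` parametrizes
enough representatives to surject onto this quotient, and `η` has the same kernel as that
surjection. -/
lemma exists_pageTwoEquiv {T H : Type*} [AddCommGroup T] [AddCommGroup H]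
    (κ : T →+ cocycTwo P C s q) (η : T →+ H) (hη : Function.Surjective η)
    (h1 : ∀ f ∈ cocycTwo P C s q, ∃ (t : T) (e : P.X (q - 1) ⟶ C.X s),
      f = (κ t).1 + P.d q (q - 1) ≫ e)
    (h0 : ∀ t, η t = 0 ↔ ∃ g ∈ cocyc P (C.X (s + 1)) q, ∃ e : P.X (q - 1) ⟶ C.X s,
      (κ t).1 = g ≫ C.d (s + 1) s + P.d q (q - 1) ≫ e) :
    Nonempty (Page P C 2 s (-q) ≃+ H) := by
  let lead : cyc P C 2 s (-q) →+ cocycTwo P C s q :=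
    AddMonoidHom.mk' (fun f => ⟨f.1 s q, d_comp_lead two_pos f.2, lead_comp_d f.2⟩) fun _ _ => rfl
  have hl : Function.Surjective lead := fun f => by
    obtain ⟨g, hg, hgf⟩ := exists_cyc_lead f.2.1 f.2.2.choose_spec
    exact ⟨⟨g, hg⟩, Subtype.ext hgf⟩
  let B : AddSubgroup (cocycTwo P C s q) :=
    { carrier := {f | ∃ g ∈ cocyc P (C.X (s + 1)) q, ∃ e : P.X (q - 1) ⟶ C.X s,
        f.1 = g ≫ C.d (s + 1) s + P.d q (q - 1) ≫ e}
      zero_mem' := ⟨0, zero_mem _, 0, by simp⟩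
      add_mem' := by
        rintro f g ⟨a, ha, e, he⟩ ⟨a', ha', e', he'⟩
        refine ⟨a + a', add_mem ha ha', e + e', ?_⟩
        rw [AddSubgroup.coe_add, he, he', Preadditive.add_comp, Preadditive.comp_add]
        abel
      neg_mem' := by
        rintro f ⟨a, ha, e, he⟩
        refine ⟨-a, neg_mem ha, -e, ?_⟩
        rw [AddSubgroup.coe_neg, he, Preadditive.neg_comp, Preadditive.comp_neg]
        abel }
  obtain ⟨φ, -⟩ := exists_addEquiv_of_ker_eq
    (QuotientAddGroup.mk' ((bdr P C 2 s (-q)).addSubgroupOf (cyc P C 2 s (-q))))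
    ((QuotientAddGroup.mk' B).comp lead)
    (QuotientAddGroup.mk'_surjective _) ((QuotientAddGroup.mk'_surjective _).comp hl) fun f => by
      refine mk_addSubgroupOf_eq_zero.trans
        (Iff.trans ?_ (QuotientAddGroup.eq_zero_iff (lead f)).symm)
      exact ⟨exists_of_mem_bdr_two, fun ⟨g, hg, e, he⟩ => mem_bdr_two_of_lead f.2 hg he⟩
  obtain ⟨ψ, -⟩ := exists_addEquiv_of_ker_eq ((QuotientAddGroup.mk' B).comp κ) η (fun x => by
    obtain ⟨f, rfl⟩ := QuotientAddGroup.mk_surjective x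
    obtain ⟨t, e, he⟩ := h1 f.1 f.2
    refine ⟨t, ?_⟩
    refine (sub_eq_zero.1 ?_ : (QuotientAddGroup.mk' B) (κ t) = QuotientAddGroup.mk' B f)
    rw [← map_sub]
    refine (QuotientAddGroup.eq_zero_iff _).2 ⟨0, zero_mem _, -e, ?_⟩
    rw [AddSubgroup.coe_sub, he, Preadditive.comp_neg]
    simp) hη fun t => (QuotientAddGroup.eq_zero_iff (κ t)).trans (h0 t).symm
  exact ⟨φ.trans ψ⟩

/-- If all cocycles are coboundaries, then the row of `E^2` vanishes. -/
lemma pageTwo_subsingleton (h : ∀ f ∈ cocyc P (C.X s) q, ∃ e : P.X (q - 1) ⟶ C.X s,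
    f = P.d q (q - 1) ≫ e) : Subsingleton (Page P C 2 s (-q)) := by
  refine ⟨fun x y => ?_⟩
  have h0 : ∀ x : Page P C 2 s (-q), x = 0 := fun x => by
    obtain ⟨f, rfl⟩ := QuotientAddGroup.mk_surjective x
    refine mk_addSubgroupOf_eq_zero.2 ?_
    obtain ⟨e, he⟩ := h _ (d_comp_lead two_pos f.2)
    exact mem_bdr_two_of_lead f.2 (g := 0) (e := e) Limits.comp_zero (by rw [he]; simp)
  rw [h0 x, h0 y]

/-- The identification of a row of `E^2` with the homology of a complex. -/
lemma exists_pageTwoEquiv_homology (D : ChainComplex (ModuleCat.{0} ℤ) ℕ) (T : ℕ → Type)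
    [∀ i, AddCommGroup (T i)] (κ : ∀ i, T i →+ cocyc P (C.X i) q) (γ : ∀ i, T i →+ D.X i)
    (hγ : ∀ i, Function.Surjective (γ i))
    (h1 : ∀ i, ∀ f ∈ cocyc P (C.X i) q, ∃ t, ∃ e : P.X (q - 1) ⟶ C.X i,
      f = (κ i t).1 + P.d q (q - 1) ≫ e)
    (h2 : ∀ i t, γ i t = 0 ↔ ∃ e : P.X (q - 1) ⟶ C.X i, (κ i t).1 = P.d q (q - 1) ≫ e)
    (h3 : ∀ i j t, ∃ t', γ j t' = (D.d i j).hom (γ i t) ∧ (κ i t).1 ≫ C.d i j = (κ j t').1) (s : ℕ) :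
    Nonempty (Page P C 2 s (-q) ≃+ D.homology s) := by
  have hn : (ComplexShape.down ℕ).next s = s - 1 := by
    rcases s with _ | s
    · simp
    · simp
  have hp : (ComplexShape.down ℕ).prev s = s + 1 := by simp
  -- The cycles of `D` correspond to the parameters whose cocycle is killed by `d^1`.
  have h4 : ∀ t : T s, γ s t ∈ cyclesGroup D s ↔ ∃ e : P.X (q - 1) ⟶ C.X (s - 1),
      (κ s t).1 ≫ C.d s (s - 1) = P.d q (q - 1) ≫ e := fun t => by
    obtain ⟨t', ht', he⟩ := h3 s (s - 1) t
    change (D.d s ((ComplexShape.down ℕ).next s)).hom (γ s t) = 0 ↔ _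
    rw [hn, ← ht', he, h2]
  let T' : AddSubgroup (T s) := (cyclesGroup D s).comap (γ s)
  let κ' : T' →+ cocycTwo P C s q :=
    AddMonoidHom.mk' (fun t => ⟨(κ s t.1).1, (κ s t.1).2, (h4 t.1).1 t.2⟩) fun a b =>
      Subtype.ext (congrArg (fun x : cocyc P (C.X s) q => x.1) (map_add (κ s) a.1 b.1))
  let η : T' →+ D.homology s := (homClass D s).comp
    (AddMonoidHom.mk' (fun t => ⟨γ s t.1, t.2⟩) fun a b => Subtype.ext (map_add (γ s) a.1 b.1))
  refine exists_pageTwoEquiv κ' η ?_ ?_ ?_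
  · intro x
    obtain ⟨⟨z, hz⟩, rfl⟩ := homClass_surjective D s x
    obtain ⟨t, rfl⟩ := hγ s z
    exact ⟨⟨t, hz⟩, rfl⟩
  · rintro f ⟨hf, e, he⟩
    obtain ⟨t, e', rfl⟩ := h1 s f hf
    refine ⟨⟨t, (h4 t).2 ⟨e - e' ≫ C.d s (s - 1), ?_⟩⟩, e', rfl⟩
    rw [Preadditive.add_comp, ← eq_sub_iff_add_eq] at he
    rw [he, Preadditive.comp_sub, Category.assoc]
  · rintro ⟨t, ht⟩
    refine (homClass_eq_zero_iff D s).trans ?_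
    change (∃ w, (D.d ((ComplexShape.down ℕ).prev s) s).hom w = γ s t) ↔ _
    rw [hp]
    constructor
    · rintro ⟨w, hw⟩
      obtain ⟨t2, rfl⟩ := hγ (s + 1) w
      obtain ⟨t', ht', he⟩ := h3 (s + 1) s t2
      obtain ⟨e, he'⟩ := (h2 s (t - t')).1 (by rw [map_sub, ht', hw, sub_self])
      refine ⟨(κ (s + 1) t2).1, (κ (s + 1) t2).2, e, ?_⟩
      rw [he, ← he', map_sub]
      change (κ s t).1 = (κ s t').1 + ((κ s t).1 - (κ s t').1)
      abel
    · rintro ⟨g, hg, e, he⟩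
      obtain ⟨t2, e2, rfl⟩ := h1 (s + 1) g hg
      obtain ⟨t', ht', he'⟩ := h3 (s + 1) s t2
      refine ⟨γ (s + 1) t2, ?_⟩
      rw [← ht', ← sub_eq_zero, ← map_sub, h2]
      refine ⟨-(e2 ≫ C.d (s + 1) s + e), ?_⟩
      have he3 : (κ s t).1 = _ := he
      rw [map_sub]
      change (κ s t').1 - (κ s t).1 = _
      rw [he3, Preadditive.add_comp, he', Category.assoc, Preadditive.comp_neg,
        Preadditive.comp_add]
      abel

/-- A criterion for `E^2 = E^∞`: every cocycle on which `d^1` vanishes is, up to a coboundary, the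
leading term of a permanent cycle. -/
lemma cyc_two_le_of_lead (h : ∀ s q : ℕ, 0 < q → ∀ f ∈ cocycTwo P C s q, ∃ z ∈ cycInf P C s (-q),
    ∃ e : P.X (q - 1) ⟶ C.X s, f = z s q + P.d q (q - 1) ≫ e) (s t : ℤ) :
    cyc P C 2 s t ≤ cycInf P C s t ⊔ bdr P C 2 s t := by
  intro f hf
  have hf' := (mem_cyc rfl rfl rfl).1 hf
  by_cases h0 : s < 0 ∨ s < s + t
  · rw [eq_zero_of_mem_fil h0 hf'.1]; exact zero_mem _
  obtain ⟨s, rfl⟩ : ∃ k : ℕ, s = k := ⟨s.toNat, by omega⟩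
  obtain ⟨q, rfl⟩ : ∃ k : ℕ, t = -k := ⟨t.natAbs, by omega⟩
  rcases Nat.eq_zero_or_pos q with rfl | hq
  -- In the row `t = 0` an element of `Z^2` is already a cycle: total degree `s - 1` in a column at
  -- most `s - 2` would require `q < 0`.
  · refine AddSubgroup.mem_sup_left ((mem_cycInf rfl).2 ⟨hf'.1, ?_⟩)
    funext i j
    by_cases hij : (i : ℤ) - j = s + -(0 : ℕ) - 1 ∧ (i : ℤ) ≤ s - 2
    · rw [totD_apply, hf'.1 (i + 1) j (by push_cast; omega), Limits.zero_comp, zero_add,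
        hf'.1 i (j - 1) (by omega), Limits.comp_zero, smul_zero]
      rfl
    · exact hf'.2 i j hij
  · obtain ⟨z, hz, e, he⟩ := h s q hq (f s q) ⟨d_comp_lead two_pos hf, lead_comp_d hf⟩
    refine AddSubgroup.mem_sup.2 ⟨z, hz, f - z, ?_, add_sub_cancel _ _⟩
    refine mem_bdr_two_of_lead (g := 0) (e := e) (sub_mem hf (cycInf_le_cyc _ _ _ _ _ hz))
      Limits.comp_zero ?_
    rw [Pi.sub_apply, Pi.sub_apply, he]
    simp

end Cocycles

end GCW

end

noncomputable section
namespace GCW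

/-! ## The first page and group cohomology -/

section Transport

variable {𝓐 : Type*} [Category* 𝓐] [Preadditive 𝓐] {P Q : ChainComplex 𝓐 ℕ} {M : 𝓐} {q : ℕ}

lemma pull_d_comp (α : Q ⟶ P) (e : P.X (q - 1) ⟶ M) :
    α.f q ≫ P.d q (q - 1) ≫ e = Q.d q (q - 1) ≫ α.f (q - 1) ≫ e := by
  rw [← Category.assoc, ← Category.assoc, α.comm]

lemma exists_pull_pull (E : HomotopyEquiv P Q) {f : P.X q ⟶ M} (hf : f ∈ cocyc P M q) :
    ∃ e : P.X (q - 1) ⟶ M, f = E.hom.f q ≫ E.inv.f q ≫ f + P.d q (q - 1) ≫ e := by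
  obtain ⟨e, he⟩ := exists_of_homotopy E.homotopyHomInvId hf
  refine ⟨-e, ?_⟩
  rw [HomologicalComplex.comp_f, Category.assoc] at he
  rw [he, Preadditive.comp_neg, add_neg_cancel_right]

lemma exists_coboundary_of_pull (E : HomotopyEquiv P Q) {f : P.X q ⟶ M} (hf : f ∈ cocyc P M q)
    (h : ∃ e : Q.X (q - 1) ⟶ M, E.inv.f q ≫ f = Q.d q (q - 1) ≫ e) :
    ∃ e : P.X (q - 1) ⟶ M, f = P.d q (q - 1) ≫ e := by
  obtain ⟨e, he⟩ := h
  obtain ⟨e', he'⟩ := exists_pull_pull E hf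
  rw [he, pull_d_comp, ← Preadditive.comp_add] at he'
  exact ⟨_, he'⟩

end Transport

/-! ### Comparison with the bar resolution. -/

section GroupCohomology

variable {G : Type} [Group G]

lemma inhomogeneousCochains_prev (q : ℕ) : (ComplexShape.up ℕ).prev q = q - 1 := by
  rcases q with _ | q <;> simp

/-- The inhomogeneous cochain of a homomorphism on the bar resolution. -/
def barEval (M : Rep.{0} ℤ G) (q : ℕ) :
    ((Rep.barComplex ℤ G).X q ⟶ M) →+ (groupCohomology.inhomogeneousCochains M).X q :=
  ((groupCohomology.inhomogeneousCochainsIso M).inv.f q).hom.toAddMonoidHom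

lemma barEval_injective (M : Rep.{0} ℤ G) (q : ℕ) : Function.Injective (barEval M q) :=
  (ModuleCat.mono_iff_injective ((groupCohomology.inhomogeneousCochainsIso M).inv.f q)).1
    inferInstance

lemma barEval_surjective (M : Rep.{0} ℤ G) (q : ℕ) : Function.Surjective (barEval M q) :=
  (ModuleCat.epi_iff_surjective ((groupCohomology.inhomogeneousCochainsIso M).inv.f q)).1
    inferInstance

lemma d_barEval (M : Rep.{0} ℤ G) (i j : ℕ) (f : (Rep.barComplex ℤ G).X i ⟶ M) :
    ((groupCohomology.inhomogeneousCochains M).d i j).hom (barEval M i f) =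
      barEval M j ((Rep.barComplex ℤ G).d j i ≫ f) :=
  congrArg (fun φ => φ.hom f) ((groupCohomology.inhomogeneousCochainsIso M).inv.comm i j)

lemma barEval_comp {M N : Rep.{0} ℤ G} (φ : M ⟶ N) (q : ℕ) (f : (Rep.barComplex ℤ G).X q ⟶ M) :
    ((groupCohomology.cochainsMap (MonoidHom.id G) φ).f q).hom (barEval M q f) =
      barEval N q (f ≫ φ) := rfl

lemma barEval_mem_cyclesGroup {M : Rep.{0} ℤ G} {q : ℕ} {f : (Rep.barComplex ℤ G).X q ⟶ M} :
    barEval M q f ∈ cyclesGroup (groupCohomology.inhomogeneousCochains M) q ↔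
      f ∈ cocyc (Rep.barComplex ℤ G) M q := by
  change ((groupCohomology.inhomogeneousCochains M).d q ((ComplexShape.up ℕ).next q)).hom
    (barEval M q f) = 0 ↔ _
  rw [CochainComplex.next, d_barEval, map_eq_zero_iff _ (barEval_injective M (q + 1)), mem_cocyc]

variable (P : ProjectiveResolution (Rep.trivial ℤ G ℤ))

/-- The homotopy equivalence between a projective resolution and the bar resolution. -/
def toBar : HomotopyEquiv P.complex (Rep.barComplex ℤ G) := P.homotopyEquiv (Rep.barResolution ℤ G)

/-- The class in group cohomology of a cocycle on a projective resolution. -/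
def cohomClass (M : Rep.{0} ℤ G) (q : ℕ) : cocyc P.complex M q →+ groupCohomology M q :=
  (homClass (groupCohomology.inhomogeneousCochains M) q).comp
    (AddMonoidHom.mk' (fun f => ⟨barEval M q ((toBar P).inv.f q ≫ f.1),
      barEval_mem_cyclesGroup.2 (pull_mem_cocyc _ f.2)⟩) fun a b => Subtype.ext
        ((congrArg (barEval M q) (Preadditive.comp_add _ _ _ _ a.1 b.1)).trans (map_add _ _ _)))

lemma cohomClass_eq_zero_iff (M : Rep.{0} ℤ G) (q : ℕ) (f : cocyc P.complex M q) :
    cohomClass P M q f = 0 ↔ ∃ e : P.complex.X (q - 1) ⟶ M, f.1 = P.complex.d q (q - 1) ≫ e := by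
  refine (homClass_eq_zero_iff _ q).trans ?_
  rw [inhomogeneousCochains_prev]
  change (∃ w, _ = barEval M q _) ↔ _
  constructor
  · rintro ⟨w, hw⟩
    obtain ⟨e, rfl⟩ := barEval_surjective M _ w
    rw [d_barEval] at hw
    exact exists_coboundary_of_pull _ f.2 ⟨e, (barEval_injective M q hw).symm⟩
  · rintro ⟨e, he⟩
    refine ⟨barEval M _ ((toBar P).inv.f (q - 1) ≫ e), ?_⟩
    rw [d_barEval, he]
    exact congrArg _ (pull_d_comp (toBar P).inv e).symm

lemma cohomClass_surjective (M : Rep.{0} ℤ G) (q : ℕ) : Function.Surjective (cohomClass P M q) := by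
  intro x
  obtain ⟨⟨z, hz⟩, rfl⟩ := homClass_surjective _ q x
  obtain ⟨g, rfl⟩ := barEval_surjective M q z
  have hg := barEval_mem_cyclesGroup.1 hz
  obtain ⟨e, he⟩ := exists_pull_pull (toBar P).symm hg
  refine ⟨⟨_, pull_mem_cocyc (toBar P).hom hg⟩, ?_⟩
  refine sub_eq_zero.1 ?_
  refine (map_sub (homClass (groupCohomology.inhomogeneousCochains M) q) _ _).symm.trans
    ((homClass_eq_zero_iff _ q).2 ?_)
  rw [inhomogeneousCochains_prev]
  refine ⟨barEval M _ (-e), ?_⟩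
  rw [d_barEval]
  refine Eq.trans ?_ (map_sub (barEval M q) _ _)
  congr 1
  rw [Preadditive.comp_neg, eq_comm, sub_eq_iff_eq_add]
  refine Eq.symm (neg_add_eq_of_eq_add ?_)
  rw [add_comm]
  exact he

lemma cohomClass_comp {M N : Rep.{0} ℤ G} (φ : M ⟶ N) (q : ℕ) (f : cocyc P.complex M q) :
    cohomClass P N q ⟨f.1 ≫ φ, comp_mem_cocyc f.2 φ⟩ =
      ((groupCohomology.functor ℤ G q).map φ).hom (cohomClass P M q f) := by
  refine Eq.trans ?_ (homClass_map q (groupCohomology.cochainsMap (MonoidHom.id G) φ) _).symm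
  refine congrArg (homClass (groupCohomology.inhomogeneousCochains N) q) (Subtype.ext ?_)
  change barEval N q _ = ((groupCohomology.cochainsMap (MonoidHom.id G) φ).f q).hom (barEval M q _)
  rw [barEval_comp, Category.assoc]

/-- The first page consists of the cohomology groups of `G` with coefficients in the terms of the
complex, and its differential is induced by the boundary map. -/
lemma exists_pageOneEquiv_groupCohomology (C : ChainComplex (Rep.{0} ℤ G) ℕ) :
    ∃ φ : ∀ s q : ℕ, Page P.complex C 1 s (-q) ≃+ groupCohomology (C.X s) q,
      ∀ (s q : ℕ) (hs : (s : ℤ) = ((s + 1 : ℕ) : ℤ) - 1) (ht : -(q : ℤ) = -(q : ℤ) + 1 - 1)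
        (x : Page P.complex C 1 ((s + 1 : ℕ) : ℤ) (-q)),
        φ s q (pageD P.complex C 1 _ _ _ _ hs ht x) =
          ((groupCohomology.functor ℤ G q).map (C.d (s + 1) s)).hom (φ (s + 1) q x) := by
  choose φ hφ using fun s q : ℕ => exists_pageOneEquiv (P := P.complex) (C := C) (s := s)
    (cohomClass P (C.X s) q) (cohomClass_surjective P _ q) (cohomClass_eq_zero_iff P _ q)
  refine ⟨φ, fun s q hs ht x => ?_⟩
  obtain ⟨f, rfl⟩ := QuotientAddGroup.mk_surjective x
  rw [hφ, ← cohomClass_comp]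
  refine (hφ s q _).trans ?_
  rw [← sub_eq_zero, ← map_sub, cohomClass_eq_zero_iff]
  -- The leading term of `D f` is the image of the leading term of `f` under the boundary map plus a
  -- vertical coboundary, whose class is zero.
  refine ⟨(-1 : ℤ) ^ s • f.1 s (q - 1), ?_⟩
  change totD P.complex C f.1 s q - f.1 (s + 1) q ≫ C.d (s + 1) s = _
  rw [totD_apply, add_sub_cancel_left, Preadditive.comp_zsmul]

end GroupCohomology

end GCW

end

noncomputable section
namespace GCW

/-! ## Split modules and the left regular representation -/

section Splitting

variable {G : Type} [Group G] [Fintype G] {M : Rep.{0} ℤ G}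

lemma rho_mul (g h : G) (m : M) : M.ρ (g * h) m = M.ρ g (M.ρ h m) :=
  congrArg (fun φ => φ m) (map_mul M.ρ g h)

lemma sum_rho_shift (k : G) (f : G → M) :
    M.ρ k (∑ g, M.ρ g (f g)) = ∑ g, M.ρ g (f (k⁻¹ * g)) := by
  rw [map_sum]
  refine (Fintype.sum_equiv (Equiv.mulLeft k) _ _ fun g => ?_)
  rw [Equiv.coe_mulLeft, inv_mul_cancel_left, rho_mul]

lemma sum_rho_sum_rho (f : G → M) :
    ∑ k, M.ρ k (∑ g, M.ρ g (f g)) = ∑ k, M.ρ k (∑ g, f g) := by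
  simp_rw [map_sum, ← rho_mul]
  rw [Finset.sum_comm, Finset.sum_comm (f := fun k g => M.ρ k (f g))]
  refine Finset.sum_congr rfl fun g _ => ?_
  exact Fintype.sum_equiv (Equiv.mulRight g) _ _ fun k => rfl

namespace IsSplit

variable {T : Type} [AddCommGroup T] {ι : T →+ M} {F : AddSubgroup M}

lemma ext_iff (h : IsSplit M ι F) {t t' : T} {f f' : G → M} (hf : ∀ g, f g ∈ F)
    (hf' : ∀ g, f' g ∈ F)
    (e : ι t + ∑ g, M.ρ g (f g) = ι t' + ∑ g, M.ρ g (f' g)) : t = t' ∧ ∀ g, f g = f' g := by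
  have := h.indep (t - t') (fun g => f g - f' g) (fun g => sub_mem (hf g) (hf' g)) (by
    simp only [map_sub, Finset.sum_sub_distrib]
    rw [← sub_eq_zero] at e
    rw [← e]
    abel)
  exact ⟨sub_eq_zero.1 this.1, fun g => sub_eq_zero.1 (this.2 g)⟩

lemma sum_rho_incl (h : IsSplit M ι F) (t : T) : ∑ k, M.ρ k (ι t) = ι (Fintype.card G • t) := by
  simp only [h.fix, Finset.sum_const, Finset.card_univ, map_nsmul]

/-- Translation permutes the components of the induced part, so uniqueness makes all components of
an invariant element equal, and the induced part is a norm. -/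
lemma exists_of_invariant (h : IsSplit M ι F) {m : M} (hm : ∀ k, M.ρ k m = m) :
    ∃ t c, m = ι t + ∑ k, M.ρ k c := by
  obtain ⟨t, f, hf, rfl⟩ := h.span m
  refine ⟨t, f 1, ?_⟩
  have key : ∀ k, f k = f 1 := fun k => by
    have hk := hm k
    rw [map_add, h.fix, sum_rho_shift] at hk
    have := (h.ext_iff (fun g => hf (k⁻¹ * g)) hf hk).2 k
    rw [inv_mul_cancel] at this
    exact this.symm
  simp_rw [key]

/-- The norm of `ι t + ∑ g · f g` is `ι (|G| t)` plus the norm of `∑ f g`. By independence both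
parts vanish, so subtracting `∑ f g` changes nothing. -/
lemma exists_of_sum_eq_zero (h : IsSplit M ι F) {m : M} (hm : ∑ k, M.ρ k m = 0) :
    ∃ (t : T) (f : G → M), Fintype.card G • t = 0 ∧ m = ι t + ∑ g, (M.ρ g (f g) - f g) := by
  obtain ⟨t, f, hf, rfl⟩ := h.span m
  simp_rw [map_add] at hm
  rw [Finset.sum_add_distrib, h.sum_rho_incl, sum_rho_sum_rho] at hm
  have := h.indep _ (fun _ => ∑ g, f g) (fun _ => sum_mem fun g _ => hf g) hm
  refine ⟨t, f, this.1, ?_⟩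
  rw [Finset.sum_sub_distrib, this.2 1, sub_zero]

lemma exists_of_incl_eq_sum (h : IsSplit M ι F) {t : T} {m : M} (hm : ι t = ∑ k, M.ρ k m) :
    ∃ t', t = Fintype.card G • t' := by
  obtain ⟨t', f, hf, rfl⟩ := h.span m
  simp_rw [map_add] at hm
  rw [Finset.sum_add_distrib, h.sum_rho_incl, sum_rho_sum_rho] at hm
  refine ⟨t', (h.ext_iff (f := 0) (f' := fun _ => ∑ g, f g)
    (fun _ => zero_mem _) (fun _ => sum_mem fun g _ => hf g) ?_).1⟩
  rw [← hm]
  simp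

/-- Acting by `g` leaves the trivial component of `m` unchanged, so `g m - m` has trivial component
zero. -/
lemma eq_zero_of_incl_eq_sub (h : IsSplit M ι F) {t : T} {g : G} {m : M}
    (hm : ι t = M.ρ g m - m) : t = 0 := by
  obtain ⟨t', f, hf, rfl⟩ := h.span m
  rw [map_add, h.fix, sum_rho_shift, add_sub_add_left_eq_sub] at hm
  refine (h.ext_iff (t' := 0) (f := f) (f' := fun k => f (g⁻¹ * k)) hf (fun k => hf _) ?_).1
  rw [hm]
  simp

end IsSplit

end Splitting

section Trivial

variable {k G : Type} [CommRing k] [Group G] {M : Rep.{0} k G}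

lemma trivial_hom_ext {f f' : Rep.trivial k G k ⟶ M} (h : f.hom (1 : k) = f'.hom (1 : k)) :
    f = f' := by
  refine Rep.hom_ext (Representation.IntertwiningMap.ext (LinearMap.ext_ring h))

/-- The homomorphism from the trivial module that is determined by an invariant element. -/
def invariantHom (m : M) (hm : ∀ x, M.ρ x m = m) : Rep.trivial k G k ⟶ M :=
  Rep.ofHom ⟨LinearMap.toSpanSingleton k M m, fun x => LinearMap.ext_ring (by simp [hm])⟩

lemma invariantHom_one (m : M) (hm : ∀ x, M.ρ x m = m) :
    (invariantHom m hm).hom (1 : k) = m := one_smul k m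

/-- The homomorphisms from the trivial module that are determined by a group of invariant
elements. -/
def fixHom {T : Type} [AddCommGroup T] (ι : T →+ M) (h : ∀ x t, M.ρ x (ι t) = ι t) :
    T →+ (Rep.trivial k G k ⟶ M) :=
  AddMonoidHom.mk' (fun t => invariantHom (ι t) fun x => h x t) fun t t' => trivial_hom_ext (by
    rw [invariantHom_one, map_add]
    exact congrArg₂ _ (invariantHom_one _ _).symm (invariantHom_one _ _).symm)

lemma fixHom_one {T : Type} [AddCommGroup T] (ι : T →+ M) (h : ∀ x t, M.ρ x (ι t) = ι t) (t : T) :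
    (fixHom ι h t).hom (1 : k) = ι t :=
  invariantHom_one _ fun x => h x t

end Trivial

/-! ### Homomorphisms on the group ring of an abelian group. -/

section LeftRegular

variable {k G : Type} [CommRing k] [CommGroup G] {M N : Rep.{0} k G}

/-- The value at the generator of a homomorphism on the left regular representation. -/
def evOne (M : Rep.{0} k G) : (Rep.leftRegular k G ⟶ M) ≃+ M :=
  (Rep.leftRegularHomEquiv M).toAddEquiv

lemma evOne_comp (f : Rep.leftRegular k G ⟶ M) (φ : M ⟶ N) :
    evOne N (f ≫ φ) = φ.hom (evOne M f) := rfl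

lemma evOne_norm_comp [Fintype G] (f : Rep.leftRegular k G ⟶ M) :
    evOne M ((Rep.leftRegular k G).norm ≫ f) = ∑ x, M.ρ x (evOne M f) := by
  rw [← Rep.norm_comm, evOne_comp, Rep.norm_apply, Representation.norm, LinearMap.sum_apply]

lemma evOne_sub_comp (g : G) (f : Rep.leftRegular k G ⟶ M) :
    evOne M ((Rep.applyAsHom (Rep.leftRegular k G) g - 𝟙 _) ≫ f) =
      M.ρ g (evOne M f) - evOne M f := by
  rw [Preadditive.sub_comp, Rep.applyAsHom_comm, map_sub, evOne_comp, Category.id_comp,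
    Rep.applyAsHom_apply]

/-- The augmentation of the group ring. -/
def augment (k G : Type) [CommRing k] [CommGroup G] : Rep.leftRegular k G ⟶ Rep.trivial k G k :=
  (evOne _).symm (1 : k)

lemma evOne_augment (k G : Type) [CommRing k] [CommGroup G] :
    evOne (Rep.trivial k G k) (augment k G) = (1 : k) := (evOne _).apply_symm_apply _

/-- In the group ring of a cyclic group the augmentation ideal is generated by `g - 1`. -/
lemma exists_rho_sub [Finite G] {g : G} (hg : ∀ x, x ∈ Subgroup.zpowers g) (x : G) (m : M) :
    ∃ b, M.ρ x m - m = M.ρ g b - b := by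
  obtain ⟨b, hb⟩ := (Representation.FiniteCyclicGroup.coinvariantsKer_eq_range M.ρ g hg).le
    (Representation.Coinvariants.sub_mem_ker x m)
  exact ⟨b, hb.symm⟩

end LeftRegular

section Cyclic

variable {G : Type} [CommGroup G] [Fintype G] {g : G} (hg : ∀ x, x ∈ Subgroup.zpowers g)

/-- The periodic resolution. -/
abbrev periodic : ChainComplex (Rep.{0} ℤ G) ℕ := (Rep.FiniteCyclicGroup.resolution ℤ g hg).complex

lemma periodic_d_even {q : ℕ} (hq : Even q) :
    (periodic hg).d (q + 1) q = Rep.applyAsHom (Rep.leftRegular ℤ G) g - 𝟙 _ := by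
  refine (dif_pos (show (ComplexShape.down ℕ).Rel (q + 1) q by simp)).trans ?_
  exact dif_neg (by simpa [Nat.even_add_one] using hq)

lemma periodic_d_odd {q : ℕ} (hq : ¬ Even q) :
    (periodic hg).d (q + 1) q = (Rep.leftRegular ℤ G).norm := by
  refine (dif_pos (show (ComplexShape.down ℕ).Rel (q + 1) q by simp)).trans ?_
  exact dif_pos (by simpa [Nat.even_add_one] using hq)

end Cyclic

end GCW

end

noncomputable section
namespace GCW

/-! ## Cyclic classes -/

section CyclicClasses

/-- Homomorphisms `u q` from the terms of a resolution of `ℤ` to `ℤ` whose multiples by the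
invariants of a `ℤ[G]`-module represent the cohomology classes coming from a trivial summand. -/
structure IsCyclicClass {G : Type} [Group G] [Fintype G] (P : ChainComplex (Rep.{0} ℤ G) ℕ)
    (u : ∀ q, P.X q ⟶ Rep.trivial ℤ G ℤ) : Prop where
  d_comp : ∀ q, P.d (q + 1) q ≫ u q = (if Even q then 0 else Fintype.card G) • u (q + 1)
  exists_eq : ∀ {M : Rep.{0} ℤ G} {T : Type} [AddCommGroup T] {ι : T →+ M} {F : AddSubgroup M}
    (h : IsSplit M ι F) {q : ℕ}, q ≠ 0 → ∀ f ∈ cocyc P M q, ∃ t, (¬ Even q → Fintype.card G • t = 0) ∧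
      ∃ e : P.X (q - 1) ⟶ M, f = u q ≫ fixHom ι h.fix t + P.d q (q - 1) ≫ e
  exists_nsmul : ∀ {M : Rep.{0} ℤ G} {T : Type} [AddCommGroup T] {ι : T →+ M} {F : AddSubgroup M}
    (h : IsSplit M ι F) {q : ℕ}, q ≠ 0 → Even q → ∀ {t : T} {e : P.X (q - 1) ⟶ M},
      u q ≫ fixHom ι h.fix t = P.d q (q - 1) ≫ e → ∃ t', t = Fintype.card G • t'
  eq_zero : ∀ {M : Rep.{0} ℤ G} {T : Type} [AddCommGroup T] {ι : T →+ M} {F : AddSubgroup M}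
    (h : IsSplit M ι F) {q : ℕ}, ¬ Even q → ∀ {t : T} {e : P.X (q - 1) ⟶ M},
      Fintype.card G • t = 0 → u q ≫ fixHom ι h.fix t = P.d q (q - 1) ≫ e → t = 0

namespace IsCyclicClass

variable {G : Type} [Group G] [Fintype G] {P Q : ChainComplex (Rep.{0} ℤ G) ℕ}
  {u : ∀ q, P.X q ⟶ Rep.trivial ℤ G ℤ}
  {M : Rep.{0} ℤ G} {T : Type} [AddCommGroup T] {ι : T →+ M} {F : AddSubgroup M}


lemma d_comp_fixHom (hu : IsCyclicClass P u) (h : ∀ x t, M.ρ x (ι t) = ι t) (q : ℕ) (t : T) :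
    P.d (q + 1) q ≫ u q ≫ fixHom ι h t =
      u (q + 1) ≫ fixHom ι h ((if Even q then 0 else Fintype.card G) • t) := by
  rw [← Category.assoc, hu.d_comp, map_nsmul, Preadditive.nsmul_comp, Preadditive.comp_nsmul]

lemma mem_cocyc (hu : IsCyclicClass P u) (h : ∀ x t, M.ρ x (ι t) = ι t) {q : ℕ} {t : T}
    (ht : ¬ Even q → Fintype.card G • t = 0) : u q ≫ fixHom ι h t ∈ cocyc P M q := by
  rw [GCW.mem_cocyc, hu.d_comp_fixHom]
  split_ifs with hq
  · rw [zero_smul, map_zero, Limits.comp_zero]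
  · rw [ht hq, map_zero, Limits.comp_zero]

/-- Cyclic classes can be transported along homotopy equivalences. -/
lemma pull (hu : IsCyclicClass P u) (E : HomotopyEquiv Q P) : IsCyclicClass Q fun q => E.hom.f q ≫ u q where
  d_comp q := by
    rw [← E.hom.comm_assoc, hu.d_comp, Preadditive.comp_nsmul]
  exists_eq h q hq f hf := by
    obtain ⟨e, he⟩ := exists_pull_pull E hf
    obtain ⟨t, ht, e', he'⟩ := hu.exists_eq h hq _ (pull_mem_cocyc E.inv hf)
    refine ⟨t, ht, E.hom.f (q - 1) ≫ e' + e, ?_⟩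
    rw [he', Preadditive.comp_add, pull_d_comp, add_assoc, ← Preadditive.comp_add] at he
    rw [he, Category.assoc]
  exists_nsmul h q hq hq' t e he := by
    obtain ⟨e', he'⟩ := exists_coboundary_of_pull E.symm
      (hu.mem_cocyc h.fix (t := t) fun h => absurd hq' h) ⟨e, by rw [← he, Category.assoc]; rfl⟩
    exact hu.exists_nsmul h hq hq' he'
  eq_zero h q hq t e ht he := by
    obtain ⟨e', he'⟩ := exists_coboundary_of_pull E.symm
      (hu.mem_cocyc h.fix (t := t) fun _ => ht) ⟨e, by rw [← he, Category.assoc]; rfl⟩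
    exact hu.eq_zero h hq ht he'

end IsCyclicClass

section Periodic

variable {G : Type} [CommGroup G] [Fintype G] {g : G} (hg : ∀ x, x ∈ Subgroup.zpowers g)

/-- The augmentation, as a map on the terms of the periodic resolution. -/
def periodicAug (q : ℕ) : (periodic hg).X q ⟶ Rep.trivial ℤ G ℤ := augment ℤ G

/-- The value at the generator of a homomorphism on a term of the periodic resolution. -/
def evPer (q : ℕ) (M : Rep.{0} ℤ G) : ((periodic hg).X q ⟶ M) ≃+ M := evOne M

variable {M : Rep.{0} ℤ G}

lemma evPer_d_comp {q : ℕ} (f : (periodic hg).X q ⟶ M) :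
    evPer hg (q + 1) M ((periodic hg).d (q + 1) q ≫ f) =
      if Even q then M.ρ g (evPer hg q M f) - evPer hg q M f else ∑ x, M.ρ x (evPer hg q M f) := by
  split_ifs with hq
  · rw [periodic_d_even hg hq]
    exact evOne_sub_comp g f
  · rw [periodic_d_odd hg hq]
    exact evOne_norm_comp f

lemma evPer_aug_comp (q : ℕ) (φ : Rep.trivial ℤ G ℤ ⟶ M) :
    evPer hg q M (periodicAug hg q ≫ φ) = φ.hom (1 : ℤ) :=
  (evOne_comp (augment ℤ G) φ).trans (congrArg (fun x => φ.hom x) (evOne_augment ℤ G))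

/-- Evaluation at the generator turns `Hom(P, M)` into copies of `M` with differentials alternately
`g - 1` and the norm. Cocycles of even degree are invariant elements and those of odd degree have
norm zero, so the clauses reduce to the facts about norms and differences in split modules. -/
lemma isCyclicClass_periodic : IsCyclicClass (periodic hg) (periodicAug hg) where
  d_comp q := by
    apply (evPer hg (q + 1) _).injective
    have h1 : ∀ q, evPer hg q _ (periodicAug hg q) = (1 : ℤ) := fun _ => evOne_augment ℤ G
    rw [evPer_d_comp, map_nsmul, h1, h1]
    split_ifs with hq
    · rw [zero_smul]
      exact sub_self (1 : ℤ)
    · exact (Finset.sum_const (1 : ℤ)).trans (by rw [Finset.card_univ])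
  exists_eq {M T _ ι F} h q hq f hf := by
    obtain ⟨q, rfl⟩ := Nat.exists_eq_succ_of_ne_zero hq
    have hd := evPer_d_comp hg f
    rw [hf, map_zero] at hd
    by_cases he : Even (q + 1)
    · have hne : ¬ Even q := by simpa [Nat.even_add_one] using he
      rw [if_pos he, eq_comm, sub_eq_zero] at hd
      -- Invariance under the generator gives invariance under its powers, and in a finite group
      -- these are all elements.
      obtain ⟨t, c, hc⟩ := h.exists_of_invariant (m := evPer hg _ M f) fun k => by
        obtain ⟨n, rfl⟩ := mem_powers_iff_mem_zpowers.2 (hg k)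
        induction n with
        | zero => simp
        | succ n ih =>
          change M.ρ (g ^ n) _ = _ at ih
          change M.ρ (g ^ (n + 1)) _ = _
          rw [pow_succ, rho_mul, hd, ih]
      refine ⟨t, fun h => absurd he h, (evPer hg q M).symm c, (evPer hg (q + 1) M).injective ?_⟩
      refine hc.trans ?_
      rw [map_add, evPer_aug_comp, fixHom_one]
      refine congrArg _ (Eq.symm ((evPer_d_comp hg _).trans ?_))
      rw [if_neg hne, AddEquiv.apply_symm_apply]
    · have hev : Even q := by simpa [Nat.even_add_one] using he
      rw [if_neg he, eq_comm] at hd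
      obtain ⟨t, c, ht, hc⟩ := h.exists_of_sum_eq_zero hd
      -- Each difference `x c - c` is rewritten as a difference for the generator, so that the sum
      -- is one coboundary.
      choose b hb using exists_rho_sub (M := M) hg
      refine ⟨t, fun _ => ht, (evPer hg q M).symm (∑ x, b x (c x)),
        (evPer hg (q + 1) M).injective ?_⟩
      refine hc.trans ?_
      rw [map_add, evPer_aug_comp, fixHom_one]
      refine congrArg _ (Eq.symm ((evPer_d_comp hg _).trans ?_))
      rw [if_pos hev, AddEquiv.apply_symm_apply, map_sum, ← Finset.sum_sub_distrib]
      exact Finset.sum_congr rfl fun x _ => (hb x (c x)).symm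
  exists_nsmul {M T _ ι F} h q hq he t e hte := by
    obtain ⟨q, rfl⟩ := Nat.exists_eq_succ_of_ne_zero hq
    have hne : ¬ Even q := by simpa [Nat.even_add_one] using he
    have h1 := congrArg (evPer hg (q + 1) M) hte
    rw [evPer_aug_comp, fixHom_one] at h1
    replace h1 := h1.trans ((evPer_d_comp (q := q) hg e).trans (if_neg hne))
    exact h.exists_of_incl_eq_sum h1
  eq_zero {M T _ ι F} h q he t e _ hte := by
    obtain ⟨q, rfl⟩ := Nat.exists_eq_succ_of_ne_zero (show q ≠ 0 by rintro rfl; simp at he)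
    have hev : Even q := by simpa [Nat.even_add_one] using he
    have h1 := congrArg (evPer hg (q + 1) M) hte
    rw [evPer_aug_comp, fixHom_one] at h1
    replace h1 := h1.trans ((evPer_d_comp (q := q) hg e).trans (if_pos hev))
    exact h.eq_zero_of_incl_eq_sub h1

end Periodic

lemma exists_isCyclicClass {G : Type} [Group G] [Fintype G] [IsCyclic G]
    (P : ProjectiveResolution (Rep.trivial ℤ G ℤ)) : ∃ u, IsCyclicClass P.complex u := by
  let _ : CommGroup G := IsCyclic.commGroup
  obtain ⟨g, hg⟩ := IsCyclic.exists_generator (α := G)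
  exact ⟨_, (isCyclicClass_periodic hg).pull
    (P.homotopyEquiv (Rep.FiniteCyclicGroup.resolution ℤ g hg))⟩

end CyclicClasses

end GCW

end

noncomputable section
namespace GCW

/-! ## Permanent cycles and the row of invariants -/

section PermanentCycles

variable {𝓐 : Type*} [Category* 𝓐] [Preadditive 𝓐] {P C : ChainComplex 𝓐 ℕ}

lemma d_comp_single (s q : ℕ) (f : P.X q ⟶ C.X s) (i j : ℕ) :
    P.d j (j - 1) ≫ single s q f i (j - 1) = single s (q + 1) (P.d (q + 1) q ≫ f) i j := by
  rcases j with _ | j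
  · rw [single_of_ne (q := q + 1) _ (by omega)]
    simp
  · by_cases h : i = s ∧ j = q
    · obtain ⟨rfl, rfl⟩ := h
      rw [single_same]
      exact congrArg (P.d (j + 1) j ≫ ·) (single_same i j f)
    · rw [single_of_ne (j := j + 1) _ (by omega), single_of_ne _ (by omega), Limits.comp_zero]

lemma single_comp_d (s q : ℕ) (f : P.X q ⟶ C.X (s + 1)) (i j : ℕ) :
    single (s + 1) q f (i + 1) j ≫ C.d (i + 1) i = single s q (f ≫ C.d (s + 1) s) i j := by
  by_cases h : i = s ∧ j = q
  · obtain ⟨rfl, rfl⟩ := h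
    rw [single_same, single_same]
  · rw [single_of_ne _ (by omega), single_of_ne _ h, Limits.zero_comp]

lemma single_comp_d_eq_zero {s q : ℕ} {f : P.X q ⟶ C.X s} (h : f ≫ C.d s (s - 1) = 0) (i j : ℕ) :
    single s q f (i + 1) j ≫ C.d (i + 1) i = 0 := by
  by_cases h' : i + 1 = s ∧ j = q
  · obtain ⟨rfl, rfl⟩ := h'
    rw [single_same]
    exact h
  · rw [single_of_ne _ h', Limits.zero_comp]

lemma single_zero (s q : ℕ) : single s q (0 : P.X q ⟶ C.X s) = 0 := by
  simp [single]

lemma totD_single {s q : ℕ} {f : P.X q ⟶ C.X s} (h : f ≫ C.d s (s - 1) = 0) :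
    totD P C (single s q f) = (-1 : ℤ) ^ s • single s (q + 1) (P.d (q + 1) q ≫ f) := by
  funext i j
  rw [totD_apply, single_comp_d_eq_zero h, zero_add, d_comp_single]
  change _ = (-1 : ℤ) ^ s • single s (q + 1) (P.d (q + 1) q ≫ f) i j
  by_cases hi : i = s
  · rw [hi]
  · rw [single_of_ne _ (by omega), smul_zero, smul_zero]

/-- A cocycle is the leading term of a permanent cycle if its boundary is the coboundary of an
element with zero boundary. -/
lemma exists_cycInf_lead {s q : ℕ} (hq : q ≠ 0) {f : P.X q ⟶ C.X s} (hf : f ∈ cocyc P (C.X s) q)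
    {e : P.X (q - 1) ⟶ C.X (s - 1)} (h : f ≫ C.d s (s - 1) = P.d q (q - 1) ≫ e)
    (he : e ≫ C.d (s - 1) (s - 1 - 1) = 0) : ∃ z ∈ cycInf P C s (-q), z s q = f := by
  rcases s with _ | s
  · refine ⟨single 0 q f, (mem_cycInf rfl).2 ⟨single_mem_fil _ le_rfl (by ring), ?_⟩,
      single_same _ _ _⟩
    rw [totD_single (by simp), mem_cocyc.1 hf, single_zero, smul_zero]
  obtain ⟨q, rfl⟩ := Nat.exists_eq_succ_of_ne_zero hq
  replace h : f ≫ C.d (s + 1) s = P.d (q + 1) q ≫ e := h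
  -- Two components suffice: the coboundary of `e` cancels the boundary of `f`, and the boundary of
  -- `e` is zero by assumption.
  refine ⟨single (s + 1) (q + 1) f - (-1 : ℤ) ^ s • single s q e, (mem_cycInf rfl).2
    ⟨sub_mem (single_mem_fil _ le_rfl (by ring))
      (zsmul_mem (single_mem_fil _ (by push_cast; omega) (by push_cast; ring)) _), ?_⟩, ?_⟩
  · have h1 : totD P C (single s q e) = (-1 : ℤ) ^ s • single s (q + 1) (P.d (q + 1) q ≫ e) :=
      totD_single he
    have h2 : totD P C (single (s + 1) (q + 1) f) = single s (q + 1) (P.d (q + 1) q ≫ e) := by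
      funext i j
      rw [totD_apply, single_comp_d, h, d_comp_single, mem_cocyc.1 hf, single_zero]
      simp
    rw [map_sub, map_zsmul, h1, h2, neg_one_pow_smul_smul, sub_self]
  · change single (s + 1) (q + 1) f (s + 1) (q + 1) - (-1 : ℤ) ^ s • single s q e (s + 1) (q + 1) = f
    rw [single_same, single_of_ne _ (by omega), smul_zero, sub_zero]

end PermanentCycles

/-! ### The row of invariants. -/

section InvariantRow

variable {G : Type} [Group G] (P : ProjectiveResolution (Rep.trivial ℤ G ℤ))

/-- The augmentation of a projective resolution of `ℤ`. -/
def resolutionAug : P.complex.X 0 ⟶ Rep.trivial ℤ G ℤ := P.π.f 0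

lemma d_comp_resolutionAug : P.complex.d 1 0 ≫ resolutionAug P = 0 := P.complex_d_comp_π_f_zero

lemma resolutionAug_comp_injective {M : Rep.{0} ℤ G} {φ ψ : Rep.trivial ℤ G ℤ ⟶ M}
    (h : resolutionAug P ≫ φ = resolutionAug P ≫ ψ) : φ = ψ :=
  (cancel_epi (P.π.f 0)).1 h

lemma exists_resolutionAug_comp {M : Rep.{0} ℤ G} {f : P.complex.X 0 ⟶ M}
    (hf : P.complex.d 1 0 ≫ f = 0) : ∃ φ : Rep.trivial ℤ G ℤ ⟶ M, resolutionAug P ≫ φ = f := by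
  obtain ⟨φ, hφ⟩ := Limits.CokernelCofork.IsColimit.desc' P.isColimitCokernelCofork f hf
  exact ⟨φ, hφ⟩

lemma hom_one_invariant {M : Rep.{0} ℤ G} (φ : Rep.trivial ℤ G ℤ ⟶ M) (x : G) :
    M.ρ x (φ.hom (1 : ℤ)) = φ.hom (1 : ℤ) := (Rep.hom_comm_apply φ x (1 : ℤ)).symm

/-- The invariants of a `k[G]`-module. -/
def invariantsOf {k : Type} [CommRing k] (M : Rep.{0} k G) : AddSubgroup M :=
  M.ρ.invariants.toAddSubgroup

lemma invariantsOf_fix (M : Rep.{0} ℤ G) (x : G) (m : invariantsOf M) :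
    M.ρ x ((invariantsOf M).subtype m) = (invariantsOf M).subtype m := m.2 x

/-- The row `t = 0` of the second page is the homology of the complex of invariants. -/
lemma exists_pageTwoEquiv_invariants (C : ChainComplex (Rep.{0} ℤ G) ℕ) (s : ℕ) :
    Nonempty (Page P.complex C 2 s 0 ≃+
      (((Rep.invariantsFunctor ℤ G).mapHomologicalComplex _).obj C).homology s) := by
  -- The augmentation `P_0 ⟶ ℤ` is the cokernel of `P_1 ⟶ P_0`, so cocycles of degree zero are maps
  -- from `ℤ`, that is, invariants, and there are no coboundaries.
  have key := exists_pageTwoEquiv_homology (P := P.complex) (C := C) (q := 0)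
    (((Rep.invariantsFunctor ℤ G).mapHomologicalComplex _).obj C)
    (fun i => invariantsOf (C.X i))
    (fun i => AddMonoidHom.mk' (fun m => ⟨resolutionAug P ≫
      fixHom (invariantsOf (C.X i)).subtype (invariantsOf_fix _) m, by
        rw [mem_cocyc, ← Category.assoc, d_comp_resolutionAug, Limits.zero_comp]⟩)
      fun a b => Subtype.ext (by
        change _ ≫ fixHom _ _ (a + b) = _ ≫ fixHom _ _ a + _ ≫ fixHom _ _ b
        rw [map_add, Preadditive.comp_add]))
    (fun i => AddMonoidHom.mk' (fun m => ⟨m.1, m.2⟩) fun _ _ => rfl) (fun i m => ⟨⟨m.1, m.2⟩, rfl⟩)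
    ?_ ?_ ?_ s
  · have h0 : (-((0 : ℕ) : ℤ)) = 0 := by simp
    rwa [h0] at key
  · intro i f hf
    obtain ⟨φ, rfl⟩ := exists_resolutionAug_comp P hf
    refine ⟨⟨φ.hom (1 : ℤ), fun x => hom_one_invariant φ x⟩, 0, ?_⟩
    rw [Limits.comp_zero, add_zero]
    refine congrArg (resolutionAug P ≫ ·) (trivial_hom_ext ?_)
    exact (fixHom_one (invariantsOf (C.X i)).subtype (invariantsOf_fix _)
      ⟨φ.hom (1 : ℤ), fun x => hom_one_invariant φ x⟩).symm
  · intro i m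
    constructor
    · intro h
      refine ⟨0, ?_⟩
      obtain rfl : m = 0 := Subtype.ext (congrArg Subtype.val h)
      rw [map_zero, Limits.comp_zero]
      rfl
    · rintro ⟨e, he⟩
      have h1 : resolutionAug P ≫ fixHom (invariantsOf (C.X i)).subtype (invariantsOf_fix _) m =
          resolutionAug P ≫ 0 := by
        rw [Limits.comp_zero]
        exact he.trans (by simp)
      have h2 := congrArg (fun φ => φ.hom (1 : ℤ)) (resolutionAug_comp_injective P h1)
      exact Subtype.ext ((fixHom_one _ _ m).symm.trans h2)
  · intro i j m
    refine ⟨⟨(C.d i j).hom m.1, fun x => (Rep.hom_comm_apply (C.d i j) x m.1).symm.trans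
      (congrArg (fun y => (C.d i j).hom y) (m.2 x))⟩, rfl, ?_⟩
    refine (Category.assoc _ _ _).trans (congrArg (resolutionAug P ≫ ·) (trivial_hom_ext ?_))
    refine Eq.trans ?_ (fixHom_one _ _ _).symm
    exact congrArg (fun x => (C.d i j).hom x) (fixHom_one _ _ m)

end InvariantRow

end GCW

end

noncomputable section
namespace GCW

/-! ## Split complexes -/

/-- A complex of `ℤ[G]`-modules that split into a trivial and an induced summand, such that the
trivial summands form a subcomplex. -/
structure IsSplitComplex {G : Type} [Group G] [Fintype G] (C : ChainComplex (Rep.{0} ℤ G) ℕ)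
    {T : ℕ → Type} [∀ s, AddCommGroup (T s)] (ι : ∀ s, T s →+ C.X s) (F : ∀ s, AddSubgroup (C.X s))
    (del : ∀ s, T (s + 1) →+ T s) : Prop where
  split : ∀ s, IsSplit (C.X s) (ι s) (F s)
  d_incl : ∀ s t, (C.d (s + 1) s).hom (ι (s + 1) t) = ι s (del s t)

namespace IsSplitComplex

variable {G : Type} [Group G] [Fintype G] {P C : ChainComplex (Rep.{0} ℤ G) ℕ}
  {u : ∀ q, P.X q ⟶ Rep.trivial ℤ G ℤ}
  {T : ℕ → Type} [∀ s, AddCommGroup (T s)] {ι : ∀ s, T s →+ C.X s} {F : ∀ s, AddSubgroup (C.X s)}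
  {del : ∀ s, T (s + 1) →+ T s}

lemma fixHom_comp_d (h : IsSplitComplex C ι F del) (s : ℕ) (t : T (s + 1)) :
    fixHom (ι (s + 1)) (h.split (s + 1)).fix t ≫ C.d (s + 1) s =
      fixHom (ι s) (h.split s).fix (del s t) := by
  refine trivial_hom_ext ?_
  refine Eq.trans ?_ (fixHom_one _ _ _).symm
  exact (congrArg (fun x => (C.d (s + 1) s).hom x) (fixHom_one _ _ t)).trans (h.d_incl s t)

lemma incl_injective (h : IsSplitComplex C ι F del) (s : ℕ) {t : T s} (ht : ι s t = 0) : t = 0 :=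
  ((h.split s).indep t 0 (fun _ => zero_mem _) (by simp [ht])).1

lemma del_del (h : IsSplitComplex C ι F del) (s : ℕ) (t : T (s + 2)) :
    del s (del (s + 1) t) = 0 := by
  apply h.incl_injective
  rw [← h.d_incl, ← h.d_incl]
  exact congrArg (fun φ => φ.hom (ι (s + 2) t)) (C.d_comp_d (s + 2) (s + 1) s)

variable (u) in
/-- The cochains that come from the trivial summands. -/
def cochain (h : IsSplitComplex C ι F del) (s q : ℕ) : T s →+ (P.X q ⟶ C.X s) :=
  AddMonoidHom.mk' (fun t => u q ≫ fixHom (ι s) (h.split s).fix t) fun a b => by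
    rw [map_add, Preadditive.comp_add]

lemma cochain_comp_d (h : IsSplitComplex C ι F del) (s q : ℕ) (t : T (s + 1)) :
    h.cochain u (s + 1) q t ≫ C.d (s + 1) s = h.cochain u s q (del s t) :=
  (Category.assoc _ _ _).trans (congrArg (u q ≫ ·) (h.fixHom_comp_d s t))

/-- This relation makes `|G|` kill the even rows of `E^1`, and it also supplies the correction term
in `cyc_two_le`. -/
lemma d_comp_cochain (h : IsSplitComplex C ι F del) (hu : IsCyclicClass P u) (s : ℕ) {q : ℕ}
    (hq : q ≠ 0) (hq' : Even q) (t : T s) :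
    P.d q (q - 1) ≫ h.cochain u s (q - 1) t = h.cochain u s q (Fintype.card G • t) := by
  obtain ⟨q, rfl⟩ := Nat.exists_eq_succ_of_ne_zero hq
  have hne : ¬ Even q := by simpa [Nat.even_add_one] using hq'
  refine (hu.d_comp_fixHom (h.split s).fix q t).trans ?_
  rw [if_neg hne]
  rfl

lemma cochain_mem_cocyc (h : IsSplitComplex C ι F del) (hu : IsCyclicClass P u) {s q : ℕ} {t : T s}
    (ht : ¬ Even q → Fintype.card G • t = 0) : h.cochain u s q t ∈ cocyc P (C.X s) q :=
  hu.mem_cocyc (h.split s).fix ht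

/-- The rows of the second page below the first one. -/
lemma exists_pageTwoEquiv (h : IsSplitComplex C ι F del) (hu : IsCyclicClass P u)
    (D : ChainComplex (ModuleCat.{0} ℤ) ℕ) (γ : ∀ s, T s →+ D.X s)
    (hγd : ∀ s t, (D.d (s + 1) s).hom (γ (s + 1) t) = γ s (del s t))
    (hγ : ∀ s, Function.Surjective (γ s))
    (hγ0 : ∀ s t, γ s t = 0 ↔ ∃ t', t = Fintype.card G • t') {q : ℕ} (hq : q ≠ 0)
    (hT : Even q ∨ ∀ s (t : T s), Fintype.card G • t = 0) (s : ℕ) :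
    Nonempty (Page P C 2 s (-q) ≃+ D.homology s) := by
  have hc : ∀ {s} (t : T s), ¬ Even q → Fintype.card G • t = 0 := fun {s} t hne =>
    (hT.resolve_left hne) s t
  refine exists_pageTwoEquiv_homology D T
    (fun i => AddMonoidHom.mk' (fun t => ⟨h.cochain u i q t, h.cochain_mem_cocyc hu (hc t)⟩)
      fun a b => Subtype.ext (map_add (h.cochain u i q) a b)) γ hγ ?_ ?_ ?_ s
  · intro i f hf
    obtain ⟨t, -, e, he⟩ := hu.exists_eq (h.split i) hq f hf
    exact ⟨t, e, he⟩
  -- In even rows the class of the cochain vanishes exactly for multiples of `|G|`. In odd rows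
  -- `|G|` kills `T i`, so the same condition means `t = 0`.
  · intro i t
    change _ ↔ ∃ e, h.cochain u i q t = _
    rw [hγ0]
    constructor
    · rintro ⟨t', rfl⟩
      by_cases hq' : Even q
      · exact ⟨_, (h.d_comp_cochain hu i hq hq' t').symm⟩
      · refine ⟨0, ?_⟩
        rw [hc _ hq', map_zero, Limits.comp_zero]
    · rintro ⟨e, he⟩
      by_cases hq' : Even q
      · exact hu.exists_nsmul (h.split i) hq hq' he
      · exact ⟨0, by rw [smul_zero]; exact hu.eq_zero (h.split i) hq' (hc t hq') he⟩
  · intro i j t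
    by_cases hij : j + 1 = i
    · subst hij
      exact ⟨del j t, (hγd j t).symm, h.cochain_comp_d j q t⟩
    · refine ⟨0, ?_, ?_⟩
      · rw [D.shape i j hij, map_zero]
        rfl
      · change h.cochain u i q t ≫ _ = h.cochain u j q 0
        rw [C.shape i j hij, Limits.comp_zero, map_zero]

/-- The odd rows of the second page vanish if the trivial summands are torsion-free. -/
lemma pageTwo_subsingleton (h : IsSplitComplex C ι F del) (hu : IsCyclicClass P u)
    (hT : ∀ s (t : T s), Fintype.card G • t = 0 → t = 0) {q : ℕ} (hq : ¬ Even q) (s : ℕ) :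
    Subsingleton (Page P C 2 s (-q)) := by
  refine GCW.pageTwo_subsingleton fun f hf => ?_
  obtain ⟨t, ht, e, rfl⟩ := hu.exists_eq (h.split s) (by rintro rfl; simp at hq) f hf
  refine ⟨e, ?_⟩
  rw [hT s t (ht hq), map_zero, Limits.comp_zero, zero_add]

/-- Up to a coboundary the cocycle is `u q · t`, and `u q · ∂t` is a coboundary. In odd degree this
forces `∂t = 0`; in even degree it gives `∂t = |G| t'`. If `|G|` kills the groups, again `∂t = 0`.
If they are torsion-free, the correction `u (q - 1) · t'` has zero boundary. -/
lemma cyc_two_le (h : IsSplitComplex C ι F del) (hu : IsCyclicClass P u)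
    (hT : (∀ s (t : T s), Fintype.card G • t = 0) ∨
      ∀ s (t : T s), Fintype.card G • t = 0 → t = 0) (s t : ℤ) :
    cyc P C 2 s t ≤ cycInf P C s t ⊔ bdr P C 2 s t := by
  refine cyc_two_le_of_lead (fun s q hq f hf => ?_) s t
  obtain ⟨hf, e', he'⟩ := hf
  obtain ⟨t, ht, e, rfl⟩ := hu.exists_eq (h.split s) hq.ne' f hf
  change (h.cochain u s q t + _) ≫ _ = _ at he'
  rw [Preadditive.add_comp, Category.assoc, ← eq_sub_iff_add_eq, ← Preadditive.comp_sub] at he'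
  suffices ∃ a : P.X (q - 1) ⟶ C.X (s - 1),
      h.cochain u s q t ≫ C.d s (s - 1) = P.d q (q - 1) ≫ a ∧ a ≫ C.d (s - 1) (s - 1 - 1) = 0 by
    obtain ⟨a, ha, ha'⟩ := this
    obtain ⟨z, hz, hzt⟩ := exists_cycInf_lead hq.ne' (h.cochain_mem_cocyc hu ht) ha ha'
    exact ⟨z, hz, e, by rw [hzt]; rfl⟩
  rcases s with _ | s
  · exact ⟨0, by simp, by simp⟩
  change ∃ a : P.X (q - 1) ⟶ C.X s,
      h.cochain u (s + 1) q t ≫ C.d (s + 1) s = P.d q (q - 1) ≫ a ∧ a ≫ C.d s (s - 1) = 0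
  replace he' := (h.cochain_comp_d s q t).symm.trans he'
  rw [h.cochain_comp_d]
  have hzero : del s t = 0 → ∃ a : P.X (q - 1) ⟶ C.X s,
      h.cochain u s q (del s t) = P.d q (q - 1) ≫ a ∧ a ≫ C.d s (s - 1) = 0 := fun h0 =>
    ⟨0, by rw [h0, map_zero, Limits.comp_zero], Limits.zero_comp⟩
  by_cases hq' : Even q
  · obtain ⟨t', ht'⟩ := hu.exists_nsmul (h.split s) hq.ne' hq' he'
    rcases hT with hT | hT
    · exact hzero (ht'.trans (hT s t'))
    -- Its coboundary is `u q · |G| t' = u q · ∂t`, and `|G| ∂t' = ∂∂t = 0` gives `∂t' = 0` by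
    -- torsion-freeness.
    · refine ⟨h.cochain u s (q - 1) t', ?_, ?_⟩
      · rw [h.d_comp_cochain hu s hq.ne' hq', ht']
      · rcases s with _ | s
        · simp
        · refine (h.cochain_comp_d s (q - 1) t').trans ?_
          rw [hT s (del s t') (by rw [← map_nsmul, ← ht', h.del_del]), map_zero]
  · exact hzero (hu.eq_zero (h.split s) hq' (by rw [← map_nsmul, ht hq', map_zero]) he')

end IsSplitComplex

end GCW

end

noncomputable section
namespace GCW

/-! ## Reduction of coefficients and the main theorem -/

section Coefficients

variable {A B : Type} [AddCommGroup A] [AddCommGroup B] {X : Type} [TopologicalSpace X] {U V : Set X}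

lemma relCoeff_symm_relCoeff (e : A ≃+ B) (m : ℕ) (x : RelHomology A U V m) :
    relCoeff (e.symm : B →+ A) U V m (relCoeff (e : A →+ B) U V m x) = x := by
  obtain ⟨z, rfl⟩ := relClass_surjective _ _ _ x
  rw [relCoeff_relClass, relCoeff_relClass]
  refine congrArg _ (Subtype.ext (Finsupp.ext fun σ => ?_))
  exact e.symm_apply_apply (z.1 σ)

lemma nsmul_relHomology {p : ℕ} (h : ∀ a : A, p • a = 0) (m : ℕ) (x : RelHomology A U V m) :
    p • x = 0 := by
  obtain ⟨z, rfl⟩ := relClass_surjective _ _ _ x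
  rw [← map_nsmul]
  refine Eq.trans (congrArg _ (Subtype.ext (Finsupp.ext fun σ => ?_))) (map_zero _)
  exact h (z.1 σ)

end Coefficients

lemma rep_hom_eq_zero {k G : Type} [CommRing k] [Group G] {M N : Rep.{0} k G} (h : Subsingleton N)
    (f : M ⟶ N) : f = 0 :=
  Rep.hom_ext (Representation.IntertwiningMap.ext (LinearMap.ext fun _ => h.elim _ _))

section Differentials

lemma of_d_hom {k : Type} [Ring k] (X : ℕ → ModuleCat.{0} k) (d : ∀ n, X (n + 1) ⟶ X n) (s : ℕ) (c : X (s + 1)) :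
    (ChainComplex.of.d X d (s + 1) s).hom c = (d s).hom c := by
  rw [ChainComplex.of_d]
lemma of_d_rep {k G : Type} [CommRing k] [Group G] (X : ℕ → Rep.{0} k G) (d : ∀ n, X (n + 1) ⟶ X n) (s : ℕ) (c : X (s + 1)) :
    (ChainComplex.of.d X d (s + 1) s).hom c = (d s).hom c := by
  rw [ChainComplex.of_d]

variable (A : Type) [AddCommGroup A] {X : Type} [TopologicalSpace X] (F : ℕ → Set X)

lemma filtrationComplex_d (s : ℕ) (c : RelHomology A (F (s + 2)) (F (s + 1)) (s + 1)) :
    ((filtrationComplex A F).d (s + 1) s).hom c = cellularD A F s c :=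
  of_d_hom (fun n => ModuleCat.of ℤ (RelHomology A (F (n + 1)) (F n) n))
    (fun n => ModuleCat.ofHom (cellularD A F n).toIntLinearMap) s c

variable {G : Type} [Group G] [MulAction G X] [ContinuousConstSMul G X]
/-- The connecting maps of a filtration by invariant subspaces are equivariant. -/
def equivariantD (hF : ∀ (n : ℕ) (g : G), ∀ x ∈ F n, g • x ∈ F n) (n : ℕ) :
    Rep.of (relRep A (hF (n + 2)) (hF (n + 1)) (n + 1)) ⟶ Rep.of (relRep A (hF (n + 1)) (hF n) n) :=
  Rep.ofHom
    { toLinearMap := (cellularD A F n).toIntLinearMap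
      isIntertwining' := fun g => by
        refine LinearMap.ext fun x => ?_
        obtain ⟨⟨c, hc⟩, rfl⟩ := QuotientAddGroup.mk_surjective x
        exact congrArg (QuotientAddGroup.mk
          (s := (relBoundaries A (F (n + 1)) (F n) n).addSubgroupOf _))
          (Subtype.ext (chainAct_bdry A g (n + 1) c)) }

lemma filtrationRepComplex_d (hF : ∀ (n : ℕ) (g : G), ∀ x ∈ F n, g • x ∈ F n) (s : ℕ)
    (c : RelHomology A (F (s + 2)) (F (s + 1)) (s + 1)) :
    ((filtrationRepComplex A F G hF).d (s + 1) s).hom c = cellularD A F s c :=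
  of_d_rep (fun n => Rep.of (relRep A (hF (n + 1)) (hF n) n)) (equivariantD A F hF) s c

end Differentials

section Reduction

variable {A : Type} [AddCommGroup A] {p : ℕ}

/-- The reduction modulo `p` of an infinite cyclic group. -/
def reduction (p : ℕ) (e : A ≃+ ℤ) : A →+ ZMod p := (Int.castAddHom (ZMod p)).comp e.toAddMonoidHom

lemma reduction_surjective (e : A ≃+ ℤ) : Function.Surjective (reduction p e) :=
  (ZMod.intCast_surjective (n := p)).comp e.surjective

lemma exists_nsmul_of_reduction_eq_zero (e : A ≃+ ℤ) (a : A) (h : reduction p e a = 0) :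
    ∃ b, p • b = a := by
  obtain ⟨k, hk⟩ := (ZMod.intCast_zmod_eq_zero_iff_dvd (e a) p).1 h
  refine ⟨e.symm k, e.injective ?_⟩
  rw [map_nsmul, e.apply_symm_apply, hk, nsmul_eq_mul]

lemma nsmul_zmod (b : ZMod p) : p • b = 0 := by simp

lemma eq_zero_of_nsmul_eq_zero [Fact p.Prime] (e : A ≃+ ℤ) (a : A) (h : p • a = 0) : a = 0 := by
  have hp : (p : ℤ) ≠ 0 := by exact_mod_cast (Fact.out : p.Prime).ne_zero
  apply e.injective
  rw [map_zero]
  have h1 : p • e a = 0 := by rw [← map_nsmul, h, map_zero]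
  rw [nsmul_eq_mul] at h1
  exact (mul_eq_zero.1 h1).resolve_left hp

end Reduction

/-! ### Reduction modulo `p` of the cellular chains of the fixed point set. -/

section Cellular

variable {G : Type} [Group G] {X : Type} [TopologicalSpace X] [T2Space X] [MulAction G X]
  [ContinuousConstSMul G X] [CWComplex (Set.univ : Set X)] [IsGCWComplex G X]
  (A : Type) [AddCommGroup A]

lemma cellularRepComplex_d (s : ℕ) (c : CellChains X A (s + 1)) :
    ((cellularRepComplex G X A).d (s + 1) s).hom c = cellularD A (skel (Set.univ : Set X)) s c :=
  filtrationRepComplex_d A _ (smul_mem_skeletonLT G) s c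

lemma cellularComplex_d (B : Type) [AddCommGroup B] (s : ℕ) (c : FixChains G X B (s + 1)) :
    ((cellularComplex B (fixedSubcomplex G X : Set X)).d (s + 1) s).hom c =
      cellularD B (fixSkel G X) s c :=
  filtrationComplex_d B _ s c

lemma exists_hom_cellularRepComplex_eq_zero [CWComplex.Finite (Set.univ : Set X)]
    (P : ChainComplex (Rep.{0} ℤ G) ℕ) :
    ∃ N, ∀ s, N < s → ∀ q (f : P.X q ⟶ (cellularRepComplex G X A).X s), f = 0 := by
  obtain ⟨N, hN⟩ := exists_skel_eq (Set.univ : Set X)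
  refine ⟨N, fun s hs q f => ?_⟩
  exact rep_hom_eq_zero (relHomology_subsingleton A (hN s hs.le) s) f

variable {A}

/-- The coefficient homomorphism on the cellular chains of the fixed point set. -/
def fixCoeff {B : Type} [AddCommGroup B] (θ : A →+ B) (s : ℕ) :
    FixChains G X A s →+ (cellularComplex B (fixedSubcomplex G X : Set X)).X s :=
  relCoeff θ (fixSkel G X (s + 1)) (fixSkel G X s) s

lemma cellularComplex_d_fixCoeff {B : Type} [AddCommGroup B] (θ : A →+ B) (s : ℕ)
    (t : FixChains G X A (s + 1)) :
    ((cellularComplex B (fixedSubcomplex G X : Set X)).d (s + 1) s).hom (fixCoeff θ (s + 1) t) =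
      fixCoeff θ s (cellularD A (fixSkel G X) s t) :=
  (cellularComplex_d B s _).trans (cellularD_relCoeff θ (fixSkel G X) s t)

lemma fixCoeff_bijective {B : Type} [AddCommGroup B] (e : A ≃+ B) (s : ℕ) :
    Function.Bijective (fixCoeff (G := G) (X := X) (e : A →+ B) s) :=
  Function.bijective_iff_has_inverse.2
    ⟨relCoeff (e.symm : B →+ A) _ _ s, relCoeff_symm_relCoeff e s, relCoeff_symm_relCoeff e.symm s⟩

variable {p : ℕ}

lemma nsmul_fixChains (e : A ≃+ ZMod p) (s : ℕ) (t : FixChains G X A s) : p • t = 0 :=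
  nsmul_relHomology (fun a => e.injective (by rw [map_nsmul, map_zero]; simp)) s t

variable [Fact p.Prime]

lemma fixCoeff_reduction_eq_zero_iff (e : A ≃+ ℤ) (s : ℕ) (t : FixChains G X A s) :
    fixCoeff (reduction p e) s t = 0 ↔ ∃ t', t = p • t' := by
  constructor
  · intro h
    obtain ⟨t', ht'⟩ := exists_smul_of_relCoeff_eq_zero (reduction_surjective e)
      (exists_nsmul_of_reduction_eq_zero e) (eq_zero_of_nsmul_eq_zero e) h
    exact ⟨t', ht'.symm⟩
  · rintro ⟨t', rfl⟩
    rw [map_nsmul]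
    exact nsmul_relHomology nsmul_zmod s (relCoeff (reduction p e) _ _ s t')

variable [CWComplex.Finite (Set.univ : Set X)]

lemma eq_zero_of_nsmul_fixChains (e : A ≃+ ℤ) (s : ℕ) (t : FixChains G X A s) (ht : p • t = 0) :
    t = 0 :=
  eq_zero_of_smul_eq_zero (reduction_surjective e) (exists_nsmul_of_reduction_eq_zero e)
    nsmul_zmod (eq_zero_of_nsmul_eq_zero e) (fun _ hm => acyclicPair_skel _ _ hm) ht

lemma fixCoeff_reduction_surjective (e : A ≃+ ℤ) (s : ℕ) :
    Function.Surjective (fixCoeff (G := G) (X := X) (reduction p e) s) :=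
  relCoeff_surjective (reduction_surjective e) nsmul_zmod (exists_nsmul_of_reduction_eq_zero e)
    (eq_zero_of_nsmul_eq_zero e) (fun _ hm => acyclicPair_skel _ _ hm)

variable (A) in
lemma isSplitComplex_cellular [Fintype G] (hG : Nat.card G = p) :
    IsSplitComplex (cellularRepComplex G X A) (fixIncl G X A) (sheetChains G X A)
      (cellularD A (fixSkel G X)) where
  split := isSplit_cellular A hG
  d_incl s t := (cellularRepComplex_d A s _).trans (cellularD_fixIncl A s t)

end Cellular

end GCW

end

theorem theorem3p3 {p : ℕ} [Fact p.Prime] {G : Type} [Group G] (hG : Nat.card G = p)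
    {X : Type} [TopologicalSpace X] [T2Space X] [MulAction G X] [ContinuousConstSMul G X]
    [CWComplex (Set.univ : Set X)] [CWComplex.Finite (Set.univ : Set X)] [GCW.IsGCWComplex G X]
    (A : Type) [AddCommGroup A] (hA : Nonempty (A ≃+ ℤ) ∨ Nonempty (A ≃+ ZMod p))
    (P : ProjectiveResolution (Rep.trivial ℤ G ℤ)) :
    -- the terms `E^1_{s,t} = H^{-t}(G, C_s(X; A))`, with `d^1` induced by the boundary map
    (∃ φ : ∀ s q : ℕ, GCW.Page P.complex (GCW.cellularRepComplex G X A) 1 s (-q) ≃+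
        groupCohomology ((GCW.cellularRepComplex G X A).X s) q,
      ∀ (s q : ℕ) (hs : (s : ℤ) = ((s + 1 : ℕ) : ℤ) - 1) (ht : -(q : ℤ) = -(q : ℤ) + 1 - 1)
        (x : GCW.Page P.complex (GCW.cellularRepComplex G X A) 1 ((s + 1 : ℕ) : ℤ) (-q)),
        φ s q (GCW.pageD P.complex (GCW.cellularRepComplex G X A) 1 _ _ _ _ hs ht x) =
          ((groupCohomology.functor ℤ G q).map
            ((GCW.cellularRepComplex G X A).d (s + 1) s)).hom (φ (s + 1) q x)) ∧
    -- the spectral sequence lies in the fourth quadrant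
    (∀ r s t : ℤ, s < 0 ∨ 0 < t →
      Subsingleton (GCW.Page P.complex (GCW.cellularRepComplex G X A) r s t)) ∧
    -- convergence to `S_{s+t}(G, X; A)`
    GCW.Converges P.complex (GCW.cellularRepComplex G X A) ∧
    -- `E^2 = E^∞`
    GCW.DegeneratesAtE2 P.complex (GCW.cellularRepComplex G X A) ∧
    -- the row `t = 0` of `E^2`
    (∀ s : ℕ, Nonempty (GCW.Page P.complex (GCW.cellularRepComplex G X A) 2 s 0 ≃+
      GCW.invariantHomology G X A s)) ∧
    -- the rows `t < 0` of `E^2`, for `A = ℤ/p`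
    (Nonempty (A ≃+ ZMod p) → ∀ (s : ℕ) (t : ℤ), t < 0 →
      Nonempty (GCW.Page P.complex (GCW.cellularRepComplex G X A) 2 s t ≃+
        GCW.fixedHomology G X (ZMod p) s)) ∧
    -- the rows `t < 0` of `E^2`, for `A = ℤ`
    (Nonempty (A ≃+ ℤ) → ∀ (s : ℕ) (t : ℤ), t < 0 →
      (Even t → Nonempty (GCW.Page P.complex (GCW.cellularRepComplex G X A) 2 s t ≃+
        GCW.fixedHomology G X (ZMod p) s)) ∧
      (Odd t → Subsingleton (GCW.Page P.complex (GCW.cellularRepComplex G X A) 2 s t))) := by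
  have hfin : Finite G := Nat.finite_of_card_ne_zero (by
    rw [hG]; exact (Fact.out : p.Prime).ne_zero)
  have : Fintype G := Fintype.ofFinite G
  have : IsCyclic G := isCyclic_of_prime_card hG
  have hcard : Fintype.card G = p := Nat.card_eq_fintype_card.symm.trans hG
  obtain ⟨u, hu⟩ := GCW.exists_isCyclicClass P
  have hC := GCW.isSplitComplex_cellular (G := G) (X := X) A hG
  obtain ⟨N, hN⟩ := GCW.exists_hom_cellularRepComplex_eq_zero (G := G) (X := X) A P.complex
  -- The two coefficient groups realize the two alternatives: torsion-free for `ℤ`, killed by `p`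
  -- for `ℤ/p`.
  have hle := hC.cyc_two_le hu (by
    rw [hcard]
    rcases hA with ⟨⟨e⟩⟩ | ⟨⟨e⟩⟩
    · exact Or.inr fun s t ht => GCW.eq_zero_of_nsmul_fixChains e s t ht
    · exact Or.inl fun s t => GCW.nsmul_fixChains e s t)
  refine ⟨GCW.exists_pageOneEquiv_groupCohomology P _, fun r s t h => GCW.page_subsingleton r h,
    GCW.converges hN, GCW.degeneratesAtE2 hle hN,
    fun s => GCW.exists_pageTwoEquiv_invariants P _ s, ?_, ?_⟩
  · rintro ⟨e⟩ s t ht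
    obtain ⟨q, rfl⟩ : ∃ q : ℕ, t = -q := ⟨t.natAbs, by omega⟩
    -- Here `p` kills the trivial summands, so rows of both parities are alike and being a multiple
    -- of `p` means being zero.
    refine hC.exists_pageTwoEquiv hu (GCW.cellularComplex (ZMod p)
      (GCW.fixedSubcomplex G X : Set X)) (GCW.fixCoeff (e : A →+ ZMod p))
      (GCW.cellularComplex_d_fixCoeff _) (fun s => (GCW.fixCoeff_bijective e s).2) ?_ (by omega)
      (Or.inr ?_) s
    · intro s t
      rw [hcard]
      constructor
      · intro h
        exact ⟨0, by rw [smul_zero]; exact (GCW.fixCoeff_bijective e s).1 (h.trans (map_zero _).symm)⟩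
      · rintro ⟨t', rfl⟩
        rw [GCW.nsmul_fixChains e s t', map_zero]
    · intro s t
      rw [hcard]
      exact GCW.nsmul_fixChains e s t
  · rintro ⟨e⟩ s t ht
    obtain ⟨q, rfl⟩ : ∃ q : ℕ, t = -q := ⟨t.natAbs, by omega⟩
    constructor
    · intro hq
      -- The comparison map is now reduction modulo `p`, whose kernel consists of the multiples of
      -- `p`.
      refine hC.exists_pageTwoEquiv hu (GCW.cellularComplex (ZMod p)
        (GCW.fixedSubcomplex G X : Set X)) (GCW.fixCoeff (GCW.reduction p e))
        (GCW.cellularComplex_d_fixCoeff _) (GCW.fixCoeff_reduction_surjective e) ?_ (by omega)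
        (Or.inl (by simpa using hq)) s
      intro s t
      rw [hcard]
      exact GCW.fixCoeff_reduction_eq_zero_iff e s t
    · intro hq
      refine hC.pageTwo_subsingleton hu ?_ (by simpa using hq) s
      rw [hcard]
      exact GCW.eq_zero_of_nsmul_fixChains e
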